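/- Let $\Phi$ be an irreducible reduced (finite, crystallographic) root system of rank $r$ with Weyl group $W$, simple roots $\alpha_1,\dots,\alpha_r$ with simple reflections $\sigma_1,\dots,\sigma_r$, fundamental weights $\omega_1,\dots,\omega_r$ and root lattice $\Lambda$. Let $d(\sum_i k_i\alpha_i)=\sum_i k_i$ be the height function on $\Lambda$. Fix the $W$-invariant inner product for which short roots have squared length $1$, and put $c(i,j)=2\langle\alpha_i,\alpha_j\rangle/\langle\alpha_j,\alpha_j\rangle$. Let $\ell=(l_1,\dots,l_r)$ be nonnegative integers, $\theta=\sum_i(l_i+1)\omega_i$, and $w\bullet\lambda=w(\lambda-\theta)+\theta$, so that $\sigma_i\bullet\lambda=\sigma_i\lambda+(l_i+1)\alpha_i$. Let $n,q$ be positive integers and let $\gamma:\mathbb Z/n\to\mathbb C$ satisfy $\gamma(0)=-1$ and $\gamma(i)\gamma(-i)=1/q$ for $i\neq 0$. For $\alpha\in\Phi$ put $m(\alpha)=n/\gcd(n,\|\alpha\|^2)$, and let $\Lambda'\subset\Lambda$ be the sublattice generated by all $m(\alpha)\alpha$. Let $A=\mathbb C[\Lambda]$ be the ring of Laurent polynomials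 $\sum_\beta c_\beta\mathbf x^\beta$, with $x_i=\mathbf x^{\alpha_i}$, and $\widetilde A$ its field of fractions. For $\lambda\in\Lambda/\Lambda'$ let $\widetilde A_\lambda\subset\widetilde A$ be the set of quotients $f/g$, with $f,g\in A$, $g\ne0$, such that every exponent in the support of $g$ lies in $\Lambda'$ and every exponent in the support of $f$ lies in the class $\lambda$. Let $f(\mathbf x)\mapsto f(\sigma_j\mathbf x)$ be the automorphism of $\widetilde A$ over $\mathbb C$ given by the substitution $x_i\mapsto q^{-c(i,j)}x_ix_j^{-c(i,j)}$ for all $i$. For $\beta\in\Lambda$ put $\mu_{\ell,i}(\beta)=d(\sigma_i\bullet\beta-\beta)$ and, with $m=m(\alpha_i)$ and $(k)_m\in\{0,\dots,m-1\}$ the remainder of $k$ modulo $m$, $$\mathcal P_{\beta,\ell,i}(x)=(qx)^{l_i+1-(\mu_{\ell,i}(\beta))_m}\,\frac{1-1/q}{1-(qx)^m/q},\qquad \mathcal Q_{\beta,\ell,i}(x)=-\gamma\bigl(-\|\alpha_i\|^2\mu_{\ell,i}(\beta)\bigr)(qx)^{l_i+1-m}\,\frac{1-(qx)^m}{1-(qx)^m/q}.$$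 Then $\widetilde A=\bigoplus_{\lambda\in\Lambda/\Lambda'}\widetilde A_\lambda$, and for each $i$ there is a unique $\mathbb C$-linear operator $f\mapsto f|_\ell\sigma_i$ on $\widetilde A$ such that $$(f|_\ell\sigma_i)(\mathbf x)=\bigl(\mathcal P_{\beta,\ell,i}(x_i)+\mathcal Q_{\sigma_i\bullet\beta,\ell,i}(x_i)\bigr)f(\sigma_i\mathbf x)\qquad\text{for all }\beta\in\Lambda\text{ and } f\in\widetilde A_{\beta+\Lambda'}.$$ These operators satisfy the defining relations $(\sigma_i\sigma_j)^{r(i,j)}=1$ of $W$ for all $1\le i,j\le r$. Here nodes $i$ and $j$ are adjacent if $i\neq j$ and $(\sigma_i\sigma_j)^2\neq1$ in $W$, and $r(i,j)=1$ if $i=j$; $r(i,j)=2$ if $i\ne j$ are not adjacent; $r(i,j)=3$ if $i,j$ are adjacent and $\|\alpha_i\|=\|\alpha_j\|$; $r(i,j)=4$ if $i,j$ are adjacent with $\|\alpha_i\|\neq\|\alpha_j\|$ and $\Phi\neq G_2$; $r(i,j)=6$ if $i,j$ are adjacent and $\Phi=G_2$. Consequently they extend uniquely to a right action $f\mapsto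 f|_\ell w$ of $W$ on $\widetilde A$ by $\mathbb C$-linear operators. -/

import Mathlib

noncomputable section

namespace TwistedWeylAction

open RootPairing

variable {ι M N : Type*} [AddCommGroup M] [Module ℝ M] [AddCommGroup N] [Module ℝ N]
  {P : RootPairing ι ℝ M N}

/-! ### Normalised inner product and root lengths -/

/-- `B` is the `W`-invariant inner product on the span of the roots for which the shortest roots
have squared length `1`.  (Symmetry and invariance are part of `RootPairing.InvariantForm`.) -/
structure IsNormalizedInnerProduct (B : P.InvariantForm) : Prop where
  pos : ∀ x : M, x ≠ 0 → 0 < B.form x x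
  one_le : ∀ k : ι, 1 ≤ B.form (P.root k) (P.root k)
  exists_eq_one : ∃ k : ι, B.form (P.root k) (P.root k) = 1

/-- The squared length of the root with index `k`, as a natural number.  For the normalised inner
product it is `1`, `2` or `3`, so nothing is lost in taking the integer part; see
`normSq_cast`. -/
def normSq (B : P.InvariantForm) (k : ι) : ℕ := ⌊B.form (P.root k) (P.root k)⌋₊

/-- For the normalised inner product, `normSq` is exactly the squared length. -/
theorem normSq_cast [Finite ι] [P.IsCrystallographic] [P.IsReduced] [P.IsIrreducible]
    (B : P.InvariantForm) (hB : IsNormalizedInnerProduct B) (k : ι) :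
    (normSq B k : ℝ) = B.form (P.root k) (P.root k) := by
  obtain ⟨s, hs⟩ := hB.exists_eq_one
  have hk := hB.one_le k
  have key : B.form (P.root k) (P.root k) = 1 ∨ B.form (P.root k) (P.root k) = 2 ∨
      B.form (P.root k) (P.root k) = 3 := by
    rcases B.apply_eq_or k s with h | h | h | h | h <;> rw [hs] at h
    · exact Or.inl h
    · exact Or.inr (Or.inl (by linarith))
    · exact Or.inr (Or.inr (by linarith))
    · linarith
    · linarith
  unfold normSq
  rcases key with h | h | h <;> rw [h] <;> norm_num

/-- `m(α) = n / gcd(n, ‖α‖²)`. -/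
def rootMult (B : P.InvariantForm) (n : ℕ) (k : ι) : ℕ := n / Nat.gcd n (normSq B k)

/-! ### The root lattice -/

variable (P) in
/-- The root lattice `Λ`. -/
abbrev Lattice : Type _ := P.rootSpan ℤ

/-- The reflection `σ_k` on the root lattice. -/
def latticeReflection [P.IsCrystallographic] (k : ι) : Lattice P →ₗ[ℤ] Lattice P :=
  LinearMap.id - (P.coroot'In ℤ k).smulRight (P.rootSpanMem ℤ k)

theorem latticeReflection_apply [P.IsCrystallographic] (k : ι) (β : Lattice P) :
    latticeReflection k β = β - P.coroot'In ℤ k β • P.rootSpanMem ℤ k := rfl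

/-- `latticeReflection` is the restriction of the reflection, that is, of the action of the Weyl
group, to the root lattice. -/
theorem coe_latticeReflection [P.IsCrystallographic] (k : ι) (β : Lattice P) :
    (latticeReflection k β : M) = weylGroup.ofIdx P k • (β : M) := by
  have h := P.algebraMap_coroot'In_apply ℤ k β
  rw [weylGroup.ofIdx_smul, Equiv.reflection_smul, P.reflection_apply, latticeReflection_apply,
    ← h]
  simp [Int.cast_smul_eq_zsmul]

theorem latticeReflection_latticeReflection [P.IsCrystallographic] (k : ι) (β : Lattice P) :
    latticeReflection k (latticeReflection k β) = β := by
  apply Subtype.ext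
  rw [coe_latticeReflection, coe_latticeReflection]
  simp only [weylGroup.ofIdx_smul, Equiv.reflection_smul, P.reflection_same]

/-- The height function `d(k₁ α₁ + ⋯ + k_r α_r) = k₁ + ⋯ + k_r` on the root lattice. -/
def height (b : P.Base) : Lattice P →ₗ[ℤ] ℤ := ∑ i, b.toWeightBasisInt.coord i

theorem height_simple (b : P.Base) (i : b.support) : height b (P.rootSpanMem ℤ i) = 1 := by
  classical
  have h : P.rootSpanMem ℤ (i : ι) = b.toWeightBasisInt i := Subtype.ext (by simp)
  rw [h]
  simp [height, Finsupp.single_apply]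

variable (P) in
/-- The sublattice `Λ'` generated by all `m(α) α`. -/
def subLattice (B : P.InvariantForm) (n : ℕ) : Submodule ℤ (Lattice P) :=
  Submodule.span ℤ (Set.range fun k : ι => (rootMult B n k : ℤ) • P.rootSpanMem ℤ k)

/-! ### The twisting parameter and the dot action -/

/-- The fundamental weights `ω_i`, characterised by `⟨ω_i, α_j^∨⟩ = δ_{ij}`. -/
def fundamentalWeight [P.IsRootSystem] (b : P.Base) (i : b.support) : M :=
  P.toPerfPair.symm (b.toCoweightBasis.coord i)

/-- The strongly dominant weight `θ = ∑ (l_i + 1) ω_i`. -/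
def theta [P.IsRootSystem] (b : P.Base) (l : b.support → ℕ) : M :=
  ∑ i, ((l i : ℝ) + 1) • fundamentalWeight b i

/-- The affine action `w • v = w (v - θ) + θ`. -/
def dotAction [P.IsRootSystem] (b : P.Base) (l : b.support → ℕ) (w : P.weylGroup) (v : M) : M :=
  w • (v - theta b l) + theta b l

/-- The affine action of a simple reflection on the root lattice:
`σ_i • β = σ_i β + (l_i + 1) α_i`. -/
def simpleDot [P.IsCrystallographic] (b : P.Base) (l : b.support → ℕ) (i : b.support)
    (β : Lattice P) : Lattice P :=
  latticeReflection (i : ι) β + ((l i : ℤ) + 1) • P.rootSpanMem ℤ (i : ι)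

theorem theta_pairing [P.IsRootSystem] (b : P.Base) (l : b.support → ℕ) (i : b.support) :
    P.toLinearMap (theta b l) (P.coroot i) = (l i : ℝ) + 1 := by
  classical
  have h (j : b.support) : P.toLinearMap (fundamentalWeight b j) (P.coroot i) =
      if i = j then 1 else 0 := by
    rw [fundamentalWeight, LinearMap.apply_symm_toPerfPair_self, Module.Basis.coord_apply,
      b.toCoweightBasis_repr_coroot, Finsupp.single_apply]
  simp [theta, h]

/-- `simpleDot` is the restriction of `dotAction` to the root lattice. -/
theorem coe_simpleDot [P.IsCrystallographic] [P.IsRootSystem] (b : P.Base) (l : b.support → ℕ)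
    (i : b.support) (β : Lattice P) :
    (simpleDot b l i β : M) = dotAction b l (weylGroup.ofIdx P (i : ι)) β := by
  have h : weylGroup.ofIdx P (i : ι) • theta b l =
      theta b l - ((l i : ℝ) + 1) • P.root i := by
    rw [weylGroup.ofIdx_smul, Equiv.reflection_smul, P.reflection_apply]
    congr 2
    exact theta_pairing b l i
  have h2 : (((((l i : ℤ) + 1) • P.rootSpanMem ℤ (i : ι) : Lattice P)) : M) =
      ((l i : ℝ) + 1) • P.root i := by
    rw [Submodule.coe_smul, ← Int.cast_smul_eq_zsmul ℝ]
    push_cast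
    rfl
  rw [simpleDot, dotAction, smul_sub, h, Submodule.coe_add, coe_latticeReflection, h2]
  abel

/-- The integer `μ_{ℓ,i}(β) = d(σ_i • β - β)`. -/
def mu [P.IsCrystallographic] (b : P.Base) (l : b.support → ℕ) (i : b.support)
    (β : Lattice P) : ℤ :=
  height b (simpleDot b l i β - β)

/-! ### Laurent polynomials and rational functions -/

variable (P) in
/-- The ring `A = ℂ[Λ]` of Laurent polynomials on the root lattice. -/
abbrev Laurent : Type _ := AddMonoidAlgebra ℂ (Lattice P)

instance instIsAddTorsionFreeLattice : IsAddTorsionFree (Lattice P) :=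
  haveI : IsAddTorsionFree M := .of_isTorsionFree ℝ M
  Function.Injective.isAddTorsionFree (P.rootSpan ℤ).subtype.toAddMonoidHom
    Subtype.val_injective

instance instIsDomainLaurent [Finite ι] : IsDomain (Laurent P) := by
  have : AddMonoid.FG (Lattice P) :=
    AddGroup.fg_iff_addMonoid_fg.mp (Module.Finite.iff_addGroup_fg.mp inferInstance)
  exact NoZeroDivisors.to_isDomain _

variable (P) in
/-- The field of fractions of `A`. -/
abbrev RatFun : Type _ := FractionRing (Laurent P)

/-- The variable `x_i = x^{α_i}`, as an element of the fraction field. -/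
def simpleVar (b : P.Base) (i : b.support) : RatFun P :=
  algebraMap (Laurent P) (RatFun P) (AddMonoidAlgebra.single (P.rootSpanMem ℤ (i : ι)) 1)

/-- The projection `ν : Λ → Λ / Λ'`. -/
def classOf (B : P.InvariantForm) (n : ℕ) : Lattice P →+ Lattice P ⧸ subLattice P B n :=
  (subLattice P B n).mkQ.toAddMonoidHom

instance instDecidableEqClass (B : P.InvariantForm) (n : ℕ) :
    DecidableEq (Lattice P ⧸ subLattice P B n) := Classical.decEq _

/-- The homogeneous piece indexed by a class `c` in `Λ / Λ'`: the quotients `f / g` of Laurent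
polynomials with `g ≠ 0`, the support of `g` contained in the kernel `Λ'` of `ν`, and the support
of `f` mapped to `c` by `ν`. -/
def piece [Finite ι] (B : P.InvariantForm) (n : ℕ) (c : Lattice P ⧸ subLattice P B n) :
    Submodule ℂ (RatFun P) where
  carrier := {F | ∃ f g : Laurent P, g ≠ 0 ∧
    (∀ x ∈ g.coeff.support, classOf B n x = 0) ∧
    (∀ x ∈ f.coeff.support, classOf B n x = c) ∧
    F = algebraMap (Laurent P) (RatFun P) f / algebraMap (Laurent P) (RatFun P) g}
  zero_mem' := ⟨0, 1, one_ne_zero,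
    (SetLike.GradedOne.one_mem : (1 : Laurent P) ∈ AddMonoidAlgebra.gradeBy ℂ (classOf B n) 0),
    (AddMonoidAlgebra.gradeBy ℂ (classOf B n) c).zero_mem, by simp⟩
  add_mem' := by
    rintro _ _ ⟨f, g, hg, hg', hf, rfl⟩ ⟨f₁, g₁, hg₁, hg₁', hf₁, rfl⟩
    have inj := IsFractionRing.injective (Laurent P) (RatFun P)
    change g ∈ AddMonoidAlgebra.gradeBy ℂ (classOf B n) 0 at hg'
    change g₁ ∈ AddMonoidAlgebra.gradeBy ℂ (classOf B n) 0 at hg₁'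
    change f ∈ AddMonoidAlgebra.gradeBy ℂ (classOf B n) c at hf
    change f₁ ∈ AddMonoidAlgebra.gradeBy ℂ (classOf B n) c at hf₁
    have e₁ : f * g₁ ∈ AddMonoidAlgebra.gradeBy ℂ (classOf B n) c := by
      simpa using SetLike.GradedMul.mul_mem hf hg₁'
    have e₂ : g * f₁ ∈ AddMonoidAlgebra.gradeBy ℂ (classOf B n) c := by
      simpa using SetLike.GradedMul.mul_mem hg' hf₁
    have e₃ : g * g₁ ∈ AddMonoidAlgebra.gradeBy ℂ (classOf B n) 0 := by
      simpa using SetLike.GradedMul.mul_mem hg' hg₁'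
    refine ⟨f * g₁ + g * f₁, g * g₁, mul_ne_zero hg hg₁, e₃, Submodule.add_mem _ e₁ e₂, ?_⟩
    rw [div_add_div _ _ ((map_ne_zero_iff _ inj).mpr hg) ((map_ne_zero_iff _ inj).mpr hg₁)]
    simp
  smul_mem' := by
    rintro a _ ⟨f, g, hg, hg', hf, rfl⟩
    refine ⟨a • f, g, hg, hg', (AddMonoidAlgebra.gradeBy ℂ (classOf B n) c).smul_mem a hf, ?_⟩
    rw [Algebra.smul_def, Algebra.smul_def, map_mul, mul_div_assoc,
      ← IsScalarTower.algebraMap_apply]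

/-- The substitution `f(x) ↦ f(σ_j x)` on Laurent polynomials as an algebra homomorphism; on
monomials it is `x^β ↦ q^{d(σ_j β - β)} x^{σ_j β}`. -/
def substHom [P.IsCrystallographic] (b : P.Base) (q : ℕ) [NeZero q] (j : b.support) :
    Laurent P →ₐ[ℂ] Laurent P :=
  AddMonoidAlgebra.lift ℂ (Laurent P) (Lattice P)
    { toFun := fun β => AddMonoidAlgebra.single (latticeReflection (j : ι) β.toAdd)
        ((q : ℂ) ^ (height b (latticeReflection (j : ι) β.toAdd - β.toAdd)))
      map_one' := by simp [AddMonoidAlgebra.one_def]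
      map_mul' := fun β γ => by
        have hq : (q : ℂ) ≠ 0 := NeZero.ne _
        rw [AddMonoidAlgebra.single_mul_single, ← zpow_add₀ hq, ← map_add, toAdd_mul, map_add,
          add_sub_add_comm, map_add (height b)] }

theorem substHom_single [P.IsCrystallographic] (b : P.Base) (q : ℕ) [NeZero q] (j : b.support)
    (β : Lattice P) (a : ℂ) :
    substHom b q j (AddMonoidAlgebra.single β a) =
      AddMonoidAlgebra.single (latticeReflection (j : ι) β)
        (a * (q : ℂ) ^ (height b (latticeReflection (j : ι) β - β))) := by
  rw [substHom, AddMonoidAlgebra.lift_single]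
  simp

theorem substHom_comp_self [P.IsCrystallographic] (b : P.Base) (q : ℕ) [NeZero q]
    (j : b.support) : (substHom b q j).comp (substHom b q j) = AlgHom.id ℂ (Laurent P) := by
  have hq : (q : ℂ) ≠ 0 := NeZero.ne _
  refine AddMonoidAlgebra.algHom_ext (fun β => ?_) (by ext)
  rw [AlgHom.comp_apply, substHom_single, substHom_single, latticeReflection_latticeReflection,
    mul_assoc, ← zpow_add₀ hq, ← map_add]
  simp

/-- The substitution `f(x) ↦ f(σ_j x)` as an automorphism of the ring of Laurent polynomials. -/
def substEquiv [P.IsCrystallographic] (b : P.Base) (q : ℕ) [NeZero q] (j : b.support) :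
    Laurent P ≃ₐ[ℂ] Laurent P :=
  AlgEquiv.ofAlgHom (substHom b q j) (substHom b q j) (substHom_comp_self b q j)
    (substHom_comp_self b q j)

/-- The change of variables `f(x) ↦ f(σ_j x)` on the field of fractions of `A`. -/
def changeVar [P.IsCrystallographic] [Finite ι] (b : P.Base) (q : ℕ) [NeZero q]
    (j : b.support) : RatFun P ≃+* RatFun P :=
  IsFractionRing.ringEquivOfRingEquiv (substEquiv b q j).toRingEquiv

theorem algebraMap_single_zsmul [Finite ι] (β : Lattice P) (k : ℤ) :
    algebraMap (Laurent P) (RatFun P) (AddMonoidAlgebra.single (k • β) 1) =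
      algebraMap (Laurent P) (RatFun P) (AddMonoidAlgebra.single β 1) ^ k := by
  let φ : Multiplicative (Lattice P) →* RatFun P :=
    (algebraMap (Laurent P) (RatFun P) : Laurent P →* RatFun P).comp
      (AddMonoidAlgebra.of ℂ (Lattice P))
  have h := congrArg Units.val (map_zpow φ.toHomUnits (Multiplicative.ofAdd β) k)
  rw [Units.val_zpow_eq_zpow_val] at h
  exact h

/-- `changeVar` is the substitution `x_i ↦ q^{-c(i,j)} x_i x_j^{-c(i,j)}`. -/
theorem changeVar_simpleVar [P.IsCrystallographic] [Finite ι] (b : P.Base) (q : ℕ) [NeZero q]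
    (i j : b.support) :
    changeVar b q j (simpleVar b i) =
      (q : RatFun P) ^ (-P.pairingIn ℤ i j) * simpleVar b i *
        simpleVar b j ^ (-P.pairingIn ℤ i j) := by
  have e : substHom b q j (AddMonoidAlgebra.single (P.rootSpanMem ℤ (i : ι)) 1) =
      algebraMap ℂ (Laurent P) ((q : ℂ) ^ (-P.pairingIn ℤ i j)) *
        (AddMonoidAlgebra.single (P.rootSpanMem ℤ (i : ι)) 1 *
          AddMonoidAlgebra.single ((-P.pairingIn ℤ i j) • P.rootSpanMem ℤ (j : ι)) 1) := by
    rw [substHom_single, latticeReflection_apply, P.coroot'In_rootSpanMem_eq_pairingIn,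
      sub_sub_cancel_left, map_neg, map_smul, height_simple, AddMonoidAlgebra.single_mul_single,
      ← Algebra.smul_def, AddMonoidAlgebra.smul_single, sub_eq_add_neg, neg_smul]
    simp
  rw [simpleVar, changeVar, IsFractionRing.ringEquivOfRingEquiv_algebraMap]
  refine (congrArg (algebraMap (Laurent P) (RatFun P)) e).trans ?_
  rw [map_mul, map_mul, algebraMap_single_zsmul, ← IsScalarTower.algebraMap_apply, map_zpow₀,
    map_natCast, mul_assoc]
  rfl

theorem changeVar_algebraMap [P.IsCrystallographic] [Finite ι] (b : P.Base) (q : ℕ) [NeZero q]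
    (j : b.support) (a : ℂ) :
    changeVar b q j (algebraMap ℂ (RatFun P) a) = algebraMap ℂ (RatFun P) a := by
  rw [IsScalarTower.algebraMap_apply ℂ (Laurent P) (RatFun P), changeVar,
    IsFractionRing.ringEquivOfRingEquiv_algebraMap]
  congr 1
  exact (substEquiv b q j).commutes a

/-! ### The twisted operators -/

/-- The rational function `𝒫_{β,ℓ,i}(x)`. -/
def ratP [P.IsCrystallographic] [Finite ι] (b : P.Base) (B : P.InvariantForm)
    (l : b.support → ℕ) (n q : ℕ) (β : Lattice P) (i : b.support) (x : RatFun P) : RatFun P :=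
  ((q : RatFun P) * x) ^ ((l i : ℤ) + 1 - mu b l i β % (rootMult B n i : ℤ)) *
    ((1 - 1 / (q : RatFun P)) /
      (1 - ((q : RatFun P) * x) ^ rootMult B n i / (q : RatFun P)))

/-- The rational function `𝒬_{β,ℓ,i}(x)`. -/
def ratQ [P.IsCrystallographic] [Finite ι] (b : P.Base) (B : P.InvariantForm)
    (l : b.support → ℕ) (n q : ℕ) (γ : ZMod n → ℂ) (β : Lattice P) (i : b.support)
    (x : RatFun P) : RatFun P :=
  -algebraMap ℂ (RatFun P) (γ ((-(normSq B i : ℤ) * mu b l i β : ℤ) : ZMod n)) *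
    ((q : RatFun P) * x) ^ ((l i : ℤ) + 1 - (rootMult B n i : ℤ)) *
    ((1 - ((q : RatFun P) * x) ^ rootMult B n i) /
      (1 - ((q : RatFun P) * x) ^ rootMult B n i / (q : RatFun P)))

/-- `T` is the linear operator `f ↦ f|_ℓ σ_i` on the fraction field: on the piece indexed by the
class of `β` it is
`(f|_ℓ σ_i)(x) = (𝒫_{β,ℓ,i}(x_i) + 𝒬_{σ_i • β,ℓ,i}(x_i)) f(σ_i x)`,
for every representative `β` of the class. -/
def IsTwistedReflection [P.IsCrystallographic] [Finite ι] (b : P.Base) (B : P.InvariantForm)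
    (l : b.support → ℕ) (n q : ℕ) [NeZero q] (γ : ZMod n → ℂ) (i : b.support)
    (T : Module.End ℂ (RatFun P)) : Prop :=
  ∀ (β : Lattice P), ∀ f ∈ piece B n (classOf B n β),
    T f = (ratP b B l n q β i (simpleVar b i) +
      ratQ b B l n q γ (simpleDot b l i β) i (simpleVar b i)) * changeVar b q i f

/-! ### The defining relations of the Weyl group -/

/-- The nodes `i` and `j` are adjacent: `i ≠ j` and `(σ_i σ_j)² ≠ 1`. -/
def Adjacent (b : P.Base) (i j : b.support) : Prop :=
  i ≠ j ∧ (weylGroup.ofIdx P (i : ι) * weylGroup.ofIdx P (j : ι)) ^ 2 ≠ 1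

open Classical in
/-- The exponents `r(i,j)` of the defining relations `(σ_i σ_j)^{r(i,j)} = 1` of `W`. -/
def relExponent (b : P.Base) (B : P.InvariantForm) (i j : b.support) : ℕ :=
  if i = j then 1
  else if ¬ Adjacent b i j then 2
  else if B.form (P.root i) (P.root i) = B.form (P.root j) (P.root j) then 3
  else if ¬ P.IsG2 then 4
  else 6

end TwistedWeylAction

end

noncomputable section

namespace TwistedWeylAction

open RootPairing

set_option linter.unusedSectionVars false

/-! Write y^β = (qx)^β (`mon b q β`), v = 1/q and κ_i(β) = ⟨β - θ, α_i^∨⟩ (`kappa b l i β`). In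
these variables the substitution is y^β ↦ y^{σ_i β}, with no power of q left over. The quotients
supported on Λ' form a field Ã₀ containing Y_i = y^{m(α_i)α_i}; each graded piece is the line Ã₀
y^β, and each twisted operator T_i is semilinear over Ã₀. Relations between the T_i therefore need
checking only on one monomial for each class modulo Λ'.

The representative β is chosen as close to θ as possible. Comparing β with β ± m(α_i)α_i gives
|κ_i(β)| ≤ m(α_i), and the dot action preserves minimality, because it is isometric about θ and
preserves Λ'. In the range 0 ≤ κ_i(β) ≤ m(α_i) the remainders and the values of γ drop out of the
formula for T_i (`IsTwistedReflection.apply_mon_of_nonneg`,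
`IsTwistedReflection.apply_mon_simpleDot`). After y^{σ_i • β} is rescaled by a constant and T_i is
divided by (1 - Y_i⁻¹)/(1 - v Y_i), it acts on the two vectors as a Hecke generator with eigenvalues
1 and -v, plus the scalar (1 - v)/(Y_i - 1).

For two nodes, start from a minimal β with κ_i(β), κ_j(β) ≥ 0 and follow both alternating words. The
vectors met on the way behave like the basis of the regular representation of a Hecke algebra of
rank two, and the braid relation reduces to identities between the values F(y) = (1 - v)/(y - 1) at
the positive roots. All of these follow from F(xz)(F(x) + F(z) + 1 - v) = F(x)F(z). Since the T_i
are involutions, the braid relation gives (T_i T_j)^r y^β = y^β (`iterate_mon_of_dominant`). The map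
(T_i T_j)^r is Ã₀-linear and its fixed vectors are stable under T_i and T_j, so the result spreads
from dominant to all minimal β (`mul_pow_relExponent_of_ne`).

The step from the defining relations to an action of W is the Coxeter presentation. Counting
inversions gives the deletion property (`deletionProperty`), and a shortest relation of W violated
by the operators would have to be an alternating word in two letters
(`wordProd_eq_one_of_deletionProperty`). -/

/-! ### Semilinear operators and dihedral ladders -/

section Ladder

variable {L V : Type*} [Field L] [AddCommGroup V] [Module L V]

/-- Two semilinear operators `H₁`, `H₂` acting on vectors `a k`, `b k`, indexed by the alternating
words of length `k` in two letters, as the affine Hecke algebra of rank two acts on its regular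
representation: `F j` is attached to the `j`-th positive root. -/
structure HeckeLadder (r : ℕ) (σ₁ σ₂ : L →+* L) (H₁ H₂ : V →+ V) (s v : L) (F : ℕ → L)
    (a b : ℕ → V) : Prop where
  semilinear₁ : ∀ c x, H₁ (c • x) = σ₁ c • H₁ x
  semilinear₂ : ∀ c x, H₂ (c • x) = σ₂ c • H₂ x
  map_v₁ : σ₁ v = v
  map_v₂ : σ₂ v = v
  map_s₁ : σ₁ s = s
  map_s₂ : σ₂ s = s
  map_F₁ : ∀ j, 2 ≤ j → j ≤ r → σ₁ (F j) = F (r + 2 - j)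
  map_F₂ : ∀ j, 1 ≤ j → j < r → σ₂ (F j) = F (r - j)
  zero_eq : b 0 = a 0
  top_eq : b r = a r
  up₁ : ∀ k < r, H₁ (b k) = a (k + 1) + F 1 • b k
  up₂ : ∀ k < r, H₂ (a k) = b (k + 1) + F r • a k
  down₁ : ∀ k < r, H₁ (a (k + 1)) = (F 1 + s) • a (k + 1) + v • b k
  down₂ : ∀ k < r, H₂ (b (k + 1)) = (F r + s) • b (k + 1) + v • a k

variable {σ₁ σ₂ : L →+* L} {H₁ H₂ : V →+ V} {s v : L} {F : ℕ → L} {a b : ℕ → V}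

theorem HeckeLadder.braid_two (h : HeckeLadder 2 σ₁ σ₂ H₁ H₂ s v F a b) :
    H₁ (H₂ (a 0)) = H₂ (H₁ (a 0)) := by
  have z := h.zero_eq
  have t := h.top_eq
  have s1 := h.semilinear₁
  have s2 := h.semilinear₂
  have e1 := h.map_F₁ 2 (by norm_num) (by norm_num)
  have e2 := h.map_F₂ 1 (by norm_num) (by norm_num)
  have u0 := h.up₁ 0 (by norm_num)
  have u1 := h.up₁ 1 (by norm_num)
  have w0 := h.up₂ 0 (by norm_num)
  have w1 := h.up₂ 1 (by norm_num)
  norm_num [z] at e1 e2 u0 u1 w0 w1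
  simp only [u0, u1, w0, w1, map_add, s1, s2, e1, e2, t]
  module

/-- Expand both sides with the up and down rules. The top vectors coincide, and the remaining
difference is a multiple of `a 1 - b 1` whose coefficient is the identity `I`. In type B₂ below, the
same happens with `a 2 - b 2`. -/
theorem HeckeLadder.braid_three (h : HeckeLadder 3 σ₁ σ₂ H₁ H₂ s v F a b)
    (I : F 2 * (F 1 + F 3 + s) = F 1 * F 3) :
    H₁ (H₂ (H₁ (a 0))) = H₂ (H₁ (H₂ (a 0))) := by
  have z := h.zero_eq
  have t := h.top_eq
  have s1 := h.semilinear₁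
  have s2 := h.semilinear₂
  have e1 := h.map_F₁ 2 (by norm_num) (by norm_num)
  have e2 := h.map_F₂ 1 (by norm_num) (by norm_num)
  have e1' := h.map_F₁ 3 (by norm_num) (by norm_num)
  have e2' := h.map_F₂ 2 (by norm_num) (by norm_num)
  have u0 := h.up₁ 0 (by norm_num)
  have u1 := h.up₁ 1 (by norm_num)
  have u2 := h.up₁ 2 (by norm_num)
  have w0 := h.up₂ 0 (by norm_num)
  have w1 := h.up₂ 1 (by norm_num)
  have w2 := h.up₂ 2 (by norm_num)
  have d0 := h.down₁ 0 (by norm_num)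
  have c0 := h.down₂ 0 (by norm_num)
  norm_num [z] at e1 e2 e1' e2' u0 u1 w0 w1 u2 w2 d0 c0
  simp only [u0, u1, u2, w0, w1, w2, d0, c0, map_add, s1, s2, e1, e2, e1', e2', t]
  linear_combination (norm := module) I • a 1 - I • b 1

theorem HeckeLadder.braid_four (h : HeckeLadder 4 σ₁ σ₂ H₁ H₂ s v F a b)
    (I : F 1 * F 2 + F 2 * F 3 + F 3 * F 4 + s * (F 2 + F 3) = F 1 * F 4) :
    H₁ (H₂ (H₁ (H₂ (a 0)))) =
      H₂ (H₁ (H₂ (H₁ (a 0)))) := by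
  have s1 := h.semilinear₁
  have s2 := h.semilinear₂
  have e2 : σ₁ (F 2) = F 4 := h.map_F₁ 2 (by norm_num) (by norm_num)
  have e3 : σ₁ (F 3) = F 3 := h.map_F₁ 3 (by norm_num) (by norm_num)
  have e4 : σ₁ (F 4) = F 2 := h.map_F₁ 4 (by norm_num) (by norm_num)
  have g1 : σ₂ (F 1) = F 3 := h.map_F₂ 1 (by norm_num) (by norm_num)
  have g2 : σ₂ (F 2) = F 2 := h.map_F₂ 2 (by norm_num) (by norm_num)
  have g3 : σ₂ (F 3) = F 1 := h.map_F₂ 3 (by norm_num) (by norm_num)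
  have u0 := h.up₁ 0 (by norm_num)
  have w0 := h.up₂ 0 (by norm_num)
  have u1 := h.up₁ 1 (by norm_num)
  have w1 := h.up₂ 1 (by norm_num)
  have u2 := h.up₁ 2 (by norm_num)
  have w2 := h.up₂ 2 (by norm_num)
  have u3 := h.up₁ 3 (by norm_num)
  have w3 := h.up₂ 3 (by norm_num)
  have d0 := h.down₁ 0 (by norm_num)
  have c0 := h.down₂ 0 (by norm_num)
  have d1 := h.down₁ 1 (by norm_num)
  have c1 := h.down₂ 1 (by norm_num)
  norm_num [h.zero_eq] at u0 w0 u1 w1 u2 w2 u3 w3 d0 c0 d1 c1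
  simp only [e2, e3, e4, g1, g2, g3, u0, w0, u1, w1, u2, w2, u3, w3, d0, c0, d1, c1,
    map_add, map_mul, s1, s2, h.map_v₁, h.map_v₂, h.map_s₁, h.map_s₂, h.top_eq, smul_add, smul_smul]
  linear_combination (norm := module) I • a 2 - I • b 2

/-- After expansion the two sides differ only by multiples of `a 4 - b 4` and `a 2 - b 2`; the first
coefficient vanishes by `I₁`, the second by `I₃ + v * I₂`. -/
theorem HeckeLadder.braid_six (h : HeckeLadder 6 σ₁ σ₂ H₁ H₂ s v F a b)
    (I₁ : F 1 * F 2 + F 2 * F 3 + F 3 * F 4 + F 4 * F 5 + F 5 * F 6 + s * (F 2 + F 3 + F 4 + F 5) =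
      F 1 * F 6)
    (I₂ : (F 3 + F 4) * s + F 4 * F 6 + F 3 * F 5 + F 2 * F 4 + F 1 * F 3 =
      F 2 * F 6 + F 1 * F 5)
    (I₃ : F 3 * F 5 * s ^ 2 + F 3 * F 5 * F 6 * s + F 3 * F 4 * F 5 * s +
        F 3 * F 4 * F 5 * F 6 + F 2 * F 5 * s ^ 2 + F 2 * F 5 * F 6 * s + F 2 * F 4 * s ^ 2 +
        F 2 * F 4 * F 5 * s + F 2 * F 3 * F 5 * s + F 2 * F 3 * F 5 * F 6 +
        F 2 * F 3 * F 4 * s + F 2 * F 3 * F 4 * F 5 + F 1 * F 2 * F 5 * s +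
        F 1 * F 2 * F 5 * F 6 + F 1 * F 2 * F 4 * s + F 1 * F 2 * F 4 * F 5 +
        F 1 * F 2 * F 3 * F 4 = F 1 * F 4 * F 6 * s + F 1 * F 4 * F 5 * F 6 +
        F 1 * F 3 * F 6 * s + F 1 * F 3 * F 4 * F 6 + F 1 * F 2 * F 3 * F 6) :
    H₁ (H₂ (H₁ (H₂ (H₁ (H₂ (a 0)))))) =
      H₂ (H₁ (H₂ (H₁ (H₂ (H₁ (a 0)))))) := by
  have s1 := h.semilinear₁
  have s2 := h.semilinear₂
  have e2 : σ₁ (F 2) = F 6 := h.map_F₁ 2 (by norm_num) (by norm_num)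
  have e3 : σ₁ (F 3) = F 5 := h.map_F₁ 3 (by norm_num) (by norm_num)
  have e4 : σ₁ (F 4) = F 4 := h.map_F₁ 4 (by norm_num) (by norm_num)
  have e5 : σ₁ (F 5) = F 3 := h.map_F₁ 5 (by norm_num) (by norm_num)
  have e6 : σ₁ (F 6) = F 2 := h.map_F₁ 6 (by norm_num) (by norm_num)
  have g1 : σ₂ (F 1) = F 5 := h.map_F₂ 1 (by norm_num) (by norm_num)
  have g2 : σ₂ (F 2) = F 4 := h.map_F₂ 2 (by norm_num) (by norm_num)
  have g3 : σ₂ (F 3) = F 3 := h.map_F₂ 3 (by norm_num) (by norm_num)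
  have g4 : σ₂ (F 4) = F 2 := h.map_F₂ 4 (by norm_num) (by norm_num)
  have g5 : σ₂ (F 5) = F 1 := h.map_F₂ 5 (by norm_num) (by norm_num)
  have u0 := h.up₁ 0 (by norm_num)
  have w0 := h.up₂ 0 (by norm_num)
  have u1 := h.up₁ 1 (by norm_num)
  have w1 := h.up₂ 1 (by norm_num)
  have u2 := h.up₁ 2 (by norm_num)
  have w2 := h.up₂ 2 (by norm_num)
  have u3 := h.up₁ 3 (by norm_num)
  have w3 := h.up₂ 3 (by norm_num)
  have u4 := h.up₁ 4 (by norm_num)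
  have w4 := h.up₂ 4 (by norm_num)
  have u5 := h.up₁ 5 (by norm_num)
  have w5 := h.up₂ 5 (by norm_num)
  have d0 := h.down₁ 0 (by norm_num)
  have c0 := h.down₂ 0 (by norm_num)
  have d1 := h.down₁ 1 (by norm_num)
  have c1 := h.down₂ 1 (by norm_num)
  have d2 := h.down₁ 2 (by norm_num)
  have c2 := h.down₂ 2 (by norm_num)
  have d3 := h.down₁ 3 (by norm_num)
  have c3 := h.down₂ 3 (by norm_num)
  norm_num [h.zero_eq] at u0 w0 u1 w1 u2 w2 u3 w3 u4 w4 u5 w5 d0 c0 d1 c1 d2 c2 d3 c3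
  simp only [e2, e3, e4, e5, e6, g1, g2, g3, g4, g5, u0, w0, u1, w1, u2, w2, u3, w3, u4, w4, u5,
      w5, d0, c0, d1, c1, d2, c2, d3, c3,
    map_add, map_mul, s1, s2, h.map_v₁, h.map_v₂, h.map_s₁, h.map_s₂, h.top_eq, smul_add, smul_smul]
  linear_combination (norm := module) (I₃ + v * I₂) • a 2 - (I₃ + v * I₂) • b 2 +
      I₁ • a 4 - I₁ • b 4


/-- A `HeckeLadder` before normalisation: `y j` is the value of the `j`-th positive root, and `T₁`,
`T₂` are involutions. -/
structure TwistedLadder (r : ℕ) (σ₁ σ₂ : L →+* L) (T₁ T₂ : V →+ V) (v : L) (y : ℕ → L)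
    (a b : ℕ → V) : Prop where
  semilinear₁ : ∀ c x, T₁ (c • x) = σ₁ c • T₁ x
  semilinear₂ : ∀ c x, T₂ (c • x) = σ₂ c • T₂ x
  involutive₁ : ∀ x, T₁ (T₁ x) = x
  involutive₂ : ∀ x, T₂ (T₂ x) = x
  map_v₁ : σ₁ v = v
  map_v₂ : σ₂ v = v
  map_y₁ : ∀ j, 2 ≤ j → j ≤ r → σ₁ (y j) = y (r + 2 - j)
  map_y₂ : ∀ j, 1 ≤ j → j < r → σ₂ (y j) = y (r - j)
  y_ne_one : ∀ j, 1 ≤ j → j ≤ r → y j ≠ 1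
  v_mul_y_ne_one : ∀ j, 1 ≤ j → j ≤ r → 1 - v * y j ≠ 0
  zero_eq : b 0 = a 0
  top_eq : b r = a r
  up₁ : ∀ k < r, T₁ (b k) =
    ((1 - (y 1)⁻¹) / (1 - v * y 1)) • (a (k + 1) + ((1 - v) / (y 1 - 1)) • b k)
  up₂ : ∀ k < r, T₂ (a k) =
    ((1 - (y r)⁻¹) / (1 - v * y r)) • (b (k + 1) + ((1 - v) / (y r - 1)) • a k)
  down₁ : ∀ k < r, T₁ (a (k + 1)) = ((1 - (y 1)⁻¹) / (1 - v * y 1)) •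
    (((1 - v) / (y 1 - 1) + (1 - v)) • a (k + 1) + v • b k)
  down₂ : ∀ k < r, T₂ (b (k + 1)) = ((1 - (y r)⁻¹) / (1 - v * y r)) •
    (((1 - v) / (y r - 1) + (1 - v)) • b (k + 1) + v • a k)

variable {T₁ T₂ : V →+ V} {y : ℕ → L}

theorem TwistedLadder.factor_ne_zero {r : ℕ} (h : TwistedLadder r σ₁ σ₂ T₁ T₂ v y a b) {j : ℕ}
    (h1 : 1 ≤ j) (h2 : j ≤ r) : (1 - (y j)⁻¹) / (1 - v * y j) ≠ 0 := by
  refine div_ne_zero (sub_ne_zero.mpr fun e => h.y_ne_one j h1 h2 ?_) (h.v_mul_y_ne_one j h1 h2)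
  rw [← inv_inv (y j), ← e, inv_one]

/-- Dividing by the common factor leaves the scalar `F 1` plus a map sending `b k` to `a (k + 1)`
and `a (k + 1)` to `(1 - v) • a (k + 1) + v • b k`: a Hecke generator X with (X - 1)(X + v) = 0. -/
theorem TwistedLadder.heckeLadder {r : ℕ} (hr : 1 ≤ r)
    (h : TwistedLadder r σ₁ σ₂ T₁ T₂ v y a b) :
    HeckeLadder r σ₁ σ₂
      ((DistribSMul.toAddMonoidHom V ((1 - (y 1)⁻¹) / (1 - v * y 1))⁻¹).comp T₁)
      ((DistribSMul.toAddMonoidHom V ((1 - (y r)⁻¹) / (1 - v * y r))⁻¹).comp T₂)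
      (1 - v) v (fun j => (1 - v) / (y j - 1)) a b where
  semilinear₁ c x := by
    simp only [AddMonoidHom.comp_apply, DistribSMul.toAddMonoidHom_apply, h.semilinear₁]
    rw [smul_comm]
  semilinear₂ c x := by
    simp only [AddMonoidHom.comp_apply, DistribSMul.toAddMonoidHom_apply, h.semilinear₂]
    rw [smul_comm]
  map_v₁ := h.map_v₁
  map_v₂ := h.map_v₂
  map_s₁ := by simp [h.map_v₁]
  map_s₂ := by simp [h.map_v₂]
  map_F₁ j h1 h2 := by simp [h.map_v₁, h.map_y₁ j h1 h2]
  map_F₂ j h1 h2 := by simp [h.map_v₂, h.map_y₂ j h1 h2]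
  zero_eq := h.zero_eq
  top_eq := h.top_eq
  up₁ k hk := by
    simp only [AddMonoidHom.comp_apply, DistribSMul.toAddMonoidHom_apply]
    rw [h.up₁ k hk, inv_smul_smul₀ (h.factor_ne_zero le_rfl hr)]
  up₂ k hk := by
    simp only [AddMonoidHom.comp_apply, DistribSMul.toAddMonoidHom_apply]
    rw [h.up₂ k hk, inv_smul_smul₀ (h.factor_ne_zero hr le_rfl)]
  down₁ k hk := by
    simp only [AddMonoidHom.comp_apply, DistribSMul.toAddMonoidHom_apply]
    rw [h.down₁ k hk, inv_smul_smul₀ (h.factor_ne_zero le_rfl hr)]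
  down₂ k hk := by
    simp only [AddMonoidHom.comp_apply, DistribSMul.toAddMonoidHom_apply]
    rw [h.down₂ k hk, inv_smul_smul₀ (h.factor_ne_zero hr le_rfl)]

/-- This rests on 1/(x-1) + 1/(z-1) + 1 = (xz-1)/((x-1)(z-1)). It is the one source of all the braid
identities, applied whenever one positive root is the sum of two others. -/
theorem div_sub_one_relation {x z s : L} (hx : x ≠ 1) (hz : z ≠ 1) (hxz : x * z ≠ 1) :
    s / (x * z - 1) * (s / (x - 1) + s / (z - 1) + s) = s / (x - 1) * (s / (z - 1)) := by
  have h1 := sub_ne_zero.mpr hx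
  have h2 := sub_ne_zero.mpr hz
  have h3 := sub_ne_zero.mpr hxz
  field_simp
  ring

theorem TwistedLadder.relation {r : ℕ} (h : TwistedLadder r σ₁ σ₂ T₁ T₂ v y a b) (i j k : ℕ)
    (hi : 1 ≤ i ∧ i ≤ r) (hj : 1 ≤ j ∧ j ≤ r) (hk : 1 ≤ k ∧ k ≤ r) (e : y k = y i * y j) :
    (1 - v) / (y k - 1) * ((1 - v) / (y i - 1) + (1 - v) / (y j - 1) + (1 - v)) =
      (1 - v) / (y i - 1) * ((1 - v) / (y j - 1)) := by
  rw [e]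
  exact div_sub_one_relation (h.y_ne_one i hi.1 hi.2) (h.y_ne_one j hj.1 hj.2)
    (e ▸ h.y_ne_one k hk.1 hk.2)

theorem TwistedLadder.eq_smul₁ {r : ℕ} (hr : 1 ≤ r) (h : TwistedLadder r σ₁ σ₂ T₁ T₂ v y a b)
    (x : V) : T₁ x = ((1 - (y 1)⁻¹) / (1 - v * y 1)) •
      (DistribSMul.toAddMonoidHom V ((1 - (y 1)⁻¹) / (1 - v * y 1))⁻¹).comp T₁ x := by
  simp only [AddMonoidHom.comp_apply, DistribSMul.toAddMonoidHom_apply]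
  rw [smul_inv_smul₀ (h.factor_ne_zero le_rfl hr)]

theorem TwistedLadder.eq_smul₂ {r : ℕ} (hr : 1 ≤ r) (h : TwistedLadder r σ₁ σ₂ T₁ T₂ v y a b)
    (x : V) : T₂ x = ((1 - (y r)⁻¹) / (1 - v * y r)) •
      (DistribSMul.toAddMonoidHom V ((1 - (y r)⁻¹) / (1 - v * y r))⁻¹).comp T₂ x := by
  simp only [AddMonoidHom.comp_apply, DistribSMul.toAddMonoidHom_apply]
  rw [smul_inv_smul₀ (h.factor_ne_zero hr le_rfl)]

theorem TwistedLadder.map_factor₁ {r : ℕ} (h : TwistedLadder r σ₁ σ₂ T₁ T₂ v y a b) (j : ℕ)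
    (h1 : 2 ≤ j) (h2 : j ≤ r) : σ₁ ((1 - (y j)⁻¹) / (1 - v * y j)) =
      (1 - (y (r + 2 - j))⁻¹) / (1 - v * y (r + 2 - j)) := by
  simp [h.map_v₁, h.map_y₁ j h1 h2]

theorem TwistedLadder.map_factor₂ {r : ℕ} (h : TwistedLadder r σ₁ σ₂ T₁ T₂ v y a b) (j : ℕ)
    (h1 : 1 ≤ j) (h2 : j < r) : σ₂ ((1 - (y j)⁻¹) / (1 - v * y j)) =
      (1 - (y (r - j))⁻¹) / (1 - v * y (r - j)) := by
  simp [h.map_v₂, h.map_y₂ j h1 h2]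

/-- Pull the normalising factors to the front. The substitutions permute the positive roots other
than their own, so each side of the braid relation collects one factor for every positive root. The
two products agree, and the relation passes from the Hecke operators to `T₁`, `T₂`; involutivity
then gives the power. The longer cases work the same way. -/
theorem TwistedLadder.iterate_two (h : TwistedLadder 2 σ₁ σ₂ T₁ T₂ v y a b) :
    (T₁ ∘ T₂)^[2] (a 0) = a 0 := by
  have K := (h.heckeLadder (by norm_num)).braid_two
  have i1 := h.involutive₁
  have i2 := h.involutive₂
  have t1 := h.eq_smul₁ (by norm_num)
  have t2 := h.eq_smul₂ (by norm_num)
  have s1 := (h.heckeLadder (by norm_num)).semilinear₁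
  have s2 := (h.heckeLadder (by norm_num)).semilinear₂
  have p2 := h.map_factor₁ 2 (by norm_num) (by norm_num)
  have q1 := h.map_factor₂ 1 (by norm_num) (by norm_num)
  norm_num only at p2 q1
  set H₁ := (DistribSMul.toAddMonoidHom V ((1 - (y 1)⁻¹) / (1 - v * y 1))⁻¹).comp T₁
  set H₂ := (DistribSMul.toAddMonoidHom V ((1 - (y 2)⁻¹) / (1 - v * y 2))⁻¹).comp T₂
  set c1 := (1 - (y 1)⁻¹) / (1 - v * y 1)
  set c2 := (1 - (y 2)⁻¹) / (1 - v * y 2)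
  have br : T₁ (T₂ (a 0)) = T₂ (T₁ (a 0)) := by
    simp only [t1, t2, s1, s2, smul_smul, p2, q1]
    rw [K]
    congr 1
    ring
  simp only [Function.iterate_succ, Function.iterate_zero, Function.comp_apply, id]
  rw [br]
  simp only [i1, i2]

theorem TwistedLadder.iterate_three (h : TwistedLadder 3 σ₁ σ₂ T₁ T₂ v y a b)
    (e : y 2 = y 1 * y 3) :
    (T₁ ∘ T₂)^[3] (a 0) = a 0 := by
  have K := (h.heckeLadder (by norm_num)).braid_three (h.relation 1 3 2 (by norm_num)
      (by norm_num) (by norm_num) e)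
  have i1 := h.involutive₁
  have i2 := h.involutive₂
  have t1 := h.eq_smul₁ (by norm_num)
  have t2 := h.eq_smul₂ (by norm_num)
  have s1 := (h.heckeLadder (by norm_num)).semilinear₁
  have s2 := (h.heckeLadder (by norm_num)).semilinear₂
  have p2 := h.map_factor₁ 2 (by norm_num) (by norm_num)
  have p3 := h.map_factor₁ 3 (by norm_num) (by norm_num)
  have q1 := h.map_factor₂ 1 (by norm_num) (by norm_num)
  have q2 := h.map_factor₂ 2 (by norm_num) (by norm_num)
  norm_num only at p2 p3 q1 q2
  set H₁ := (DistribSMul.toAddMonoidHom V ((1 - (y 1)⁻¹) / (1 - v * y 1))⁻¹).comp T₁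
  set H₂ := (DistribSMul.toAddMonoidHom V ((1 - (y 3)⁻¹) / (1 - v * y 3))⁻¹).comp T₂
  set c1 := (1 - (y 1)⁻¹) / (1 - v * y 1)
  set c2 := (1 - (y 2)⁻¹) / (1 - v * y 2)
  set c3 := (1 - (y 3)⁻¹) / (1 - v * y 3)
  have br : T₁ (T₂ (T₁ (a 0))) = T₂ (T₁ (T₂ (a 0))) := by
    simp only [t1, t2, s1, s2, map_mul, smul_smul, p2, p3, q1, q2]
    rw [K]
    congr 1
    ring
  simp only [Function.iterate_succ, Function.iterate_zero, Function.comp_apply, id]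
  rw [← br]
  simp only [i1, i2]

/-- Here the positive roots, in order, are β₁, 2β₁+β₄, β₁+β₄, β₄. In the dual version below it is β₄
that can occur twice. -/
theorem TwistedLadder.iterate_four (h : TwistedLadder 4 σ₁ σ₂ T₁ T₂ v y a b)
    (e2 : y 2 = y 1 * y 3)
    (e3 : y 3 = y 1 * y 4) :
    (T₁ ∘ T₂)^[4] (a 0) = a 0 := by
  have r2 := h.relation 1 3 2 (by norm_num) (by norm_num) (by norm_num) e2
  have r3 := h.relation 1 4 3 (by norm_num) (by norm_num) (by norm_num) e3
  have K := (h.heckeLadder (by norm_num)).braid_four (by linear_combination r2 + r3)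
  have i1 := h.involutive₁
  have i2 := h.involutive₂
  have t1 := h.eq_smul₁ (by norm_num)
  have t2 := h.eq_smul₂ (by norm_num)
  have s1 := (h.heckeLadder (by norm_num)).semilinear₁
  have s2 := (h.heckeLadder (by norm_num)).semilinear₂
  have p2 := h.map_factor₁ 2 (by norm_num) (by norm_num)
  have p3 := h.map_factor₁ 3 (by norm_num) (by norm_num)
  have p4 := h.map_factor₁ 4 (by norm_num) (by norm_num)
  have q1 := h.map_factor₂ 1 (by norm_num) (by norm_num)
  have q2 := h.map_factor₂ 2 (by norm_num) (by norm_num)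
  have q3 := h.map_factor₂ 3 (by norm_num) (by norm_num)
  norm_num only at p2 p3 p4 q1 q2 q3
  set H₁ := (DistribSMul.toAddMonoidHom V ((1 - (y 1)⁻¹) / (1 - v * y 1))⁻¹).comp T₁
  set H₂ := (DistribSMul.toAddMonoidHom V ((1 - (y 4)⁻¹) / (1 - v * y 4))⁻¹).comp T₂
  set c1 := (1 - (y 1)⁻¹) / (1 - v * y 1)
  set c2 := (1 - (y 2)⁻¹) / (1 - v * y 2)
  set c3 := (1 - (y 3)⁻¹) / (1 - v * y 3)
  set c4 := (1 - (y 4)⁻¹) / (1 - v * y 4)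
  have br : T₁ (T₂ (T₁ (T₂ (a 0)))) = T₂ (T₁ (T₂ (T₁ (a 0)))) := by
    simp only [t1, t2, s1, s2, map_mul, smul_smul, p2, p3, p4, q1, q2, q3]
    rw [K]
    congr 1
    ring
  simp only [Function.iterate_succ, Function.iterate_zero, Function.comp_apply, id]
  rw [br]
  simp only [i1, i2]

theorem TwistedLadder.iterate_four_dual (h : TwistedLadder 4 σ₁ σ₂ T₁ T₂ v y a b)
    (e3 : y 3 = y 4 * y 2)
    (e2 : y 2 = y 4 * y 1) :
    (T₁ ∘ T₂)^[4] (a 0) = a 0 := by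
  have r3 := h.relation 4 2 3 (by norm_num) (by norm_num) (by norm_num) e3
  have r2 := h.relation 4 1 2 (by norm_num) (by norm_num) (by norm_num) e2
  have K := (h.heckeLadder (by norm_num)).braid_four (by linear_combination r3 + r2)
  have i1 := h.involutive₁
  have i2 := h.involutive₂
  have t1 := h.eq_smul₁ (by norm_num)
  have t2 := h.eq_smul₂ (by norm_num)
  have s1 := (h.heckeLadder (by norm_num)).semilinear₁
  have s2 := (h.heckeLadder (by norm_num)).semilinear₂
  have p2 := h.map_factor₁ 2 (by norm_num) (by norm_num)
  have p3 := h.map_factor₁ 3 (by norm_num) (by norm_num)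
  have p4 := h.map_factor₁ 4 (by norm_num) (by norm_num)
  have q1 := h.map_factor₂ 1 (by norm_num) (by norm_num)
  have q2 := h.map_factor₂ 2 (by norm_num) (by norm_num)
  have q3 := h.map_factor₂ 3 (by norm_num) (by norm_num)
  norm_num only at p2 p3 p4 q1 q2 q3
  set H₁ := (DistribSMul.toAddMonoidHom V ((1 - (y 1)⁻¹) / (1 - v * y 1))⁻¹).comp T₁
  set H₂ := (DistribSMul.toAddMonoidHom V ((1 - (y 4)⁻¹) / (1 - v * y 4))⁻¹).comp T₂
  set c1 := (1 - (y 1)⁻¹) / (1 - v * y 1)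
  set c2 := (1 - (y 2)⁻¹) / (1 - v * y 2)
  set c3 := (1 - (y 3)⁻¹) / (1 - v * y 3)
  set c4 := (1 - (y 4)⁻¹) / (1 - v * y 4)
  have br : T₁ (T₂ (T₁ (T₂ (a 0)))) = T₂ (T₁ (T₂ (T₁ (a 0)))) := by
    simp only [t1, t2, s1, s2, map_mul, smul_smul, p2, p3, p4, q1, q2, q3]
    rw [K]
    congr 1
    ring
  simp only [Function.iterate_succ, Function.iterate_zero, Function.comp_apply, id]
  rw [br]
  simp only [i1, i2]

/-- The positive roots, in order, are β₁, 3β₁+β₆, 2β₁+β₆, 3β₁+2β₆, β₁+β₆, β₆. The dual version below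
lists them with the roles of β₁ and β₆ exchanged. -/
theorem TwistedLadder.iterate_six (h : TwistedLadder 6 σ₁ σ₂ T₁ T₂ v y a b)
    (e123 : y 2 = y 1 * y 3)
    (e135 : y 3 = y 1 * y 5)
    (e156 : y 5 = y 1 * y 6)
    (e246 : y 4 = y 2 * y 6)
    (e345 : y 4 = y 3 * y 5) :
    (T₁ ∘ T₂)^[6] (a 0) = a 0 := by
  have r123 := h.relation 1 3 2 (by norm_num) (by norm_num) (by norm_num) e123
  have r135 := h.relation 1 5 3 (by norm_num) (by norm_num) (by norm_num) e135
  have r156 := h.relation 1 6 5 (by norm_num) (by norm_num) (by norm_num) e156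
  have r246 := h.relation 2 6 4 (by norm_num) (by norm_num) (by norm_num) e246
  have r345 := h.relation 3 5 4 (by norm_num) (by norm_num) (by norm_num) e345
  have K := (h.heckeLadder (by norm_num)).braid_six
    (by linear_combination r123 + r135 + r156 + r345)
    (by linear_combination r135 + r246)
    -- The quartic identity lies in the ideal generated by four of the quadratic relations; these
    -- coefficients are a certificate of membership.
    (by linear_combination (((1 - v) / (y 5 - 1))*(1 - v) + ((1 - v) / (y 4 - 1))*(1 - v) +
        2*((1 - v) / (y 4 - 1))*((1 - v) / (y 5 - 1))) * r123 + (((1 - v) / (y 5 - 1))*(1 - v) +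
        ((1 - v) / (y 5 - 1))*((1 - v) / (y 6 - 1)) + -1*((1 - v) / (y 1 - 1))*((1 - v) /
        (y 6 - 1)) + ((1 - v) / (y 1 - 1))*((1 - v) / (y 5 - 1))) * r135 + (-1*((1 - v) /
        (y 4 - 1))*((1 - v) / (y 6 - 1)) + -1*((1 - v) / (y 3 - 1))*((1 - v) / (y 5 - 1)) +
        2*((1 - v) / (y 3 - 1))*((1 - v) / (y 4 - 1)) + ((1 - v) / (y 2 - 1))*((1 - v) /
        (y 6 - 1)) + -1*((1 - v) / (y 2 - 1))*((1 - v) / (y 4 - 1)) + ((1 - v) /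
        (y 1 - 1))*((1 - v) / (y 5 - 1)) + -1*((1 - v) / (y 1 - 1))*((1 - v) /
        (y 3 - 1))) * r156 + (((1 - v) / (y 5 - 1))*((1 - v) / (y 6 - 1)) + -1*((1 - v) /
        (y 3 - 1))*((1 - v) / (y 5 - 1)) + -1*((1 - v) / (y 1 - 1))*((1 - v) / (y 6 - 1)) +
        ((1 - v) / (y 1 - 1))*((1 - v) / (y 3 - 1))) * r246)
  have i1 := h.involutive₁
  have i2 := h.involutive₂
  have t1 := h.eq_smul₁ (by norm_num)
  have t2 := h.eq_smul₂ (by norm_num)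
  have s1 := (h.heckeLadder (by norm_num)).semilinear₁
  have s2 := (h.heckeLadder (by norm_num)).semilinear₂
  have p2 := h.map_factor₁ 2 (by norm_num) (by norm_num)
  have p3 := h.map_factor₁ 3 (by norm_num) (by norm_num)
  have p4 := h.map_factor₁ 4 (by norm_num) (by norm_num)
  have p5 := h.map_factor₁ 5 (by norm_num) (by norm_num)
  have p6 := h.map_factor₁ 6 (by norm_num) (by norm_num)
  have q1 := h.map_factor₂ 1 (by norm_num) (by norm_num)
  have q2 := h.map_factor₂ 2 (by norm_num) (by norm_num)
  have q3 := h.map_factor₂ 3 (by norm_num) (by norm_num)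
  have q4 := h.map_factor₂ 4 (by norm_num) (by norm_num)
  have q5 := h.map_factor₂ 5 (by norm_num) (by norm_num)
  norm_num only at p2 p3 p4 p5 p6 q1 q2 q3 q4 q5
  set H₁ := (DistribSMul.toAddMonoidHom V ((1 - (y 1)⁻¹) / (1 - v * y 1))⁻¹).comp T₁
  set H₂ := (DistribSMul.toAddMonoidHom V ((1 - (y 6)⁻¹) / (1 - v * y 6))⁻¹).comp T₂
  set c1 := (1 - (y 1)⁻¹) / (1 - v * y 1)
  set c2 := (1 - (y 2)⁻¹) / (1 - v * y 2)
  set c3 := (1 - (y 3)⁻¹) / (1 - v * y 3)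
  set c4 := (1 - (y 4)⁻¹) / (1 - v * y 4)
  set c5 := (1 - (y 5)⁻¹) / (1 - v * y 5)
  set c6 := (1 - (y 6)⁻¹) / (1 - v * y 6)
  have br : T₁ (T₂ (T₁ (T₂ (T₁ (T₂ (a 0)))))) = T₂ (T₁ (T₂ (T₁ (T₂ (T₁ (a 0)))))) := by
    simp only [t1, t2, s1, s2, map_mul, smul_smul, p2, p3, p4, p5, p6, q1, q2, q3, q4, q5]
    rw [K]
    congr 1
    ring
  simp only [Function.iterate_succ, Function.iterate_zero, Function.comp_apply, id]
  rw [br]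
  simp only [i1, i2]

theorem TwistedLadder.iterate_six_dual (h : TwistedLadder 6 σ₁ σ₂ T₁ T₂ v y a b)
    (e654 : y 5 = y 6 * y 4)
    (e642 : y 4 = y 6 * y 2)
    (e621 : y 2 = y 6 * y 1)
    (e531 : y 3 = y 5 * y 1)
    (e432 : y 3 = y 4 * y 2) :
    (T₁ ∘ T₂)^[6] (a 0) = a 0 := by
  have r654 := h.relation 6 4 5 (by norm_num) (by norm_num) (by norm_num) e654
  have r642 := h.relation 6 2 4 (by norm_num) (by norm_num) (by norm_num) e642
  have r621 := h.relation 6 1 2 (by norm_num) (by norm_num) (by norm_num) e621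
  have r531 := h.relation 5 1 3 (by norm_num) (by norm_num) (by norm_num) e531
  have r432 := h.relation 4 2 3 (by norm_num) (by norm_num) (by norm_num) e432
  have K := (h.heckeLadder (by norm_num)).braid_six
    (by linear_combination r654 + r642 + r621 + r432)
    (by linear_combination r642 + r531)
    (by linear_combination ((((1 - v) / (y 2 - 1))*(1 - v) + ((1 - v) / (y 3 - 1))*(1 - v) +
        2*((1 - v) / (y 3 - 1))*((1 - v) / (y 2 - 1))) * r654 + (((1 - v) / (y 2 - 1))*(1 - v) +
        ((1 - v) / (y 2 - 1))*((1 - v) / (y 1 - 1)) + -1*((1 - v) / (y 6 - 1))*((1 - v) /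
        (y 1 - 1)) + ((1 - v) / (y 6 - 1))*((1 - v) / (y 2 - 1))) * r642 + (-1*((1 - v) /
        (y 3 - 1))*((1 - v) / (y 1 - 1)) + -1*((1 - v) / (y 4 - 1))*((1 - v) / (y 2 - 1)) +
        2*((1 - v) / (y 4 - 1))*((1 - v) / (y 3 - 1)) + ((1 - v) / (y 5 - 1))*((1 - v) /
        (y 1 - 1)) + -1*((1 - v) / (y 5 - 1))*((1 - v) / (y 3 - 1)) + ((1 - v) /
        (y 6 - 1))*((1 - v) / (y 2 - 1)) + -1*((1 - v) / (y 6 - 1))*((1 - v) /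
        (y 4 - 1))) * r621 + (((1 - v) / (y 2 - 1))*((1 - v) / (y 1 - 1)) + -1*((1 - v) /
        (y 4 - 1))*((1 - v) / (y 2 - 1)) + -1*((1 - v) / (y 6 - 1))*((1 - v) / (y 1 - 1)) +
        ((1 - v) / (y 6 - 1))*((1 - v) / (y 4 - 1))) * r531))
  have i1 := h.involutive₁
  have i2 := h.involutive₂
  have t1 := h.eq_smul₁ (by norm_num)
  have t2 := h.eq_smul₂ (by norm_num)
  have s1 := (h.heckeLadder (by norm_num)).semilinear₁
  have s2 := (h.heckeLadder (by norm_num)).semilinear₂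
  have p2 := h.map_factor₁ 2 (by norm_num) (by norm_num)
  have p3 := h.map_factor₁ 3 (by norm_num) (by norm_num)
  have p4 := h.map_factor₁ 4 (by norm_num) (by norm_num)
  have p5 := h.map_factor₁ 5 (by norm_num) (by norm_num)
  have p6 := h.map_factor₁ 6 (by norm_num) (by norm_num)
  have q1 := h.map_factor₂ 1 (by norm_num) (by norm_num)
  have q2 := h.map_factor₂ 2 (by norm_num) (by norm_num)
  have q3 := h.map_factor₂ 3 (by norm_num) (by norm_num)
  have q4 := h.map_factor₂ 4 (by norm_num) (by norm_num)
  have q5 := h.map_factor₂ 5 (by norm_num) (by norm_num)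
  norm_num only at p2 p3 p4 p5 p6 q1 q2 q3 q4 q5
  set H₁ := (DistribSMul.toAddMonoidHom V ((1 - (y 1)⁻¹) / (1 - v * y 1))⁻¹).comp T₁
  set H₂ := (DistribSMul.toAddMonoidHom V ((1 - (y 6)⁻¹) / (1 - v * y 6))⁻¹).comp T₂
  set c1 := (1 - (y 1)⁻¹) / (1 - v * y 1)
  set c2 := (1 - (y 2)⁻¹) / (1 - v * y 2)
  set c3 := (1 - (y 3)⁻¹) / (1 - v * y 3)
  set c4 := (1 - (y 4)⁻¹) / (1 - v * y 4)
  set c5 := (1 - (y 5)⁻¹) / (1 - v * y 5)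
  set c6 := (1 - (y 6)⁻¹) / (1 - v * y 6)
  have br : T₁ (T₂ (T₁ (T₂ (T₁ (T₂ (a 0)))))) = T₂ (T₁ (T₂ (T₁ (T₂ (T₁ (a 0)))))) := by
    simp only [t1, t2, s1, s2, map_mul, smul_smul, p2, p3, p4, p5, p6, q1, q2, q3, q4, q5]
    rw [K]
    congr 1
    ring
  simp only [Function.iterate_succ, Function.iterate_zero, Function.comp_apply, id]
  rw [br]
  simp only [i1, i2]

end Ladder

/-! ### Groups generated by involutions with the deletion property -/

section Presentation

variable {S W H : Type*} [Group W] [Monoid H]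

/-- The product of a word in the generators. -/
def wordProd {G : Type*} [Monoid G] (s : S → G) (u : List S) : G := (u.map s).prod

section wordProd

variable {G : Type*} [Monoid G] (s : S → G)

@[simp] theorem wordProd_nil : wordProd s [] = 1 := rfl

@[simp] theorem wordProd_cons (x : S) (u : List S) :
    wordProd s (x :: u) = s x * wordProd s u := by simp [wordProd]

@[simp] theorem wordProd_append (u w : List S) :
    wordProd s (u ++ w) = wordProd s u * wordProd s w := by simp [wordProd]

variable {s}

theorem wordProd_reverse_mul (hs : ∀ x, s x * s x = 1) (u : List S) :
    wordProd s u.reverse * wordProd s u = 1 := by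
  induction u with
  | nil => simp
  | cons x u ih =>
    rw [List.reverse_cons, wordProd_append, wordProd_cons, wordProd_cons, wordProd_nil, mul_one,
      mul_assoc, ← mul_assoc (s x), hs, one_mul, ih]

theorem wordProd_mul_reverse (hs : ∀ x, s x * s x = 1) (u : List S) :
    wordProd s u * wordProd s u.reverse = 1 := by
  simpa using wordProd_reverse_mul hs u.reverse

theorem wordProd_eq_of_append_reverse (hs : ∀ x, s x * s x = 1) {u w : List S}
    (h : wordProd s (u ++ w.reverse) = 1) : wordProd s u = wordProd s w := by
  rw [wordProd_append] at h
  calc wordProd s u = wordProd s u * (wordProd s w.reverse * wordProd s w) := by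
        rw [wordProd_reverse_mul hs, mul_one]
    _ = wordProd s w := by rw [← mul_assoc, h, one_mul]

theorem wordProd_append_reverse_of_eq (hs : ∀ x, s x * s x = 1) {u w : List S}
    (h : wordProd s u = wordProd s w) : wordProd s (u ++ w.reverse) = 1 := by
  rw [wordProd_append, h, wordProd_mul_reverse hs]

theorem wordProd_append_comm (hs : ∀ x, s x * s x = 1) {u w : List S}
    (h : wordProd s (u ++ w) = 1) : wordProd s (w ++ u) = 1 := by
  rw [wordProd_append] at h ⊢
  have e : wordProd s w = wordProd s u.reverse := by
    calc wordProd s w = (wordProd s u.reverse * wordProd s u) * wordProd s w := by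
          rw [wordProd_reverse_mul hs, one_mul]
      _ = _ := by rw [mul_assoc, h, mul_one]
  rw [e, wordProd_reverse_mul hs]

theorem wordProd_delete (hs : ∀ x, s x * s x = 1) {A B C : List S} {x y : S}
    (h : s x * wordProd s B = wordProd s B * s y) :
    wordProd s (A ++ x :: (B ++ y :: C)) = wordProd s (A ++ B ++ C) := by
  simp only [wordProd_append, wordProd_cons]
  rw [← mul_assoc (s x), h, mul_assoc (wordProd s B), ← mul_assoc (s y), hs, one_mul, mul_assoc]

theorem wordProd_alternating {p : ℕ} {x y : S} {u : List S} (hu : u.length = 2 * p)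
    (h : ∀ i (hi : i < u.length), u[i] = if i % 2 = 0 then x else y) :
    wordProd s u = (s x * s y) ^ p := by
  induction p generalizing u with
  | zero => simp [List.eq_nil_of_length_eq_zero hu]
  | succ p ih =>
    match u, hu, h with
    | a :: c :: u, hu, h =>
      have ha : a = x := (h 0 (by simp)).trans (if_pos rfl)
      have hc : c = y := (h 1 (by simp)).trans (if_neg (by norm_num))
      have := ih (u := u) (by simp at hu; omega) fun i hi => by
        refine Eq.trans ?_ (h (i + 2) (by simpa using hi) |>.trans (by simp))
        simp
      rw [wordProd_cons, wordProd_cons, this, ha, hc, pow_succ', mul_assoc]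

end wordProd

/-- The deletion property: a word which is not reduced contains two letters which can be deleted
together. -/
def DeletionProperty (s : S → W) : Prop :=
  ∀ u w : List S, wordProd s u = wordProd s w → w.length < u.length →
    ∃ (A : List S) (x : S) (B : List S) (y : S) (C : List S), u = A ++ x :: (B ++ y :: C) ∧
      s x * wordProd s B = wordProd s B * s y

variable {s : S → W} {t : S → H}

theorem wordProd_eq_one_of_delete (hs : ∀ x, s x * s x = 1) (ht : ∀ x, t x * t x = 1) {n : ℕ}
    (ih : ∀ u : List S, u.length < n → wordProd s u = 1 → wordProd t u = 1)
    {A B C : List S} {x y : S} (hn : (A ++ x :: (B ++ y :: C)).length = n)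
    (hu : wordProd s (A ++ x :: (B ++ y :: C)) = 1)
    (h : s x * wordProd s B = wordProd s B * s y)
    (h' : t x * wordProd t B = wordProd t B * t y) :
    wordProd t (A ++ x :: (B ++ y :: C)) = 1 := by
  rw [wordProd_delete ht h']
  rw [wordProd_delete hs h] at hu
  exact ih _ (by simp at hn ⊢; omega) hu

/-- A relation of length n says that its first n/2+1 letters have the same product as fewer letters,
so two of them can be deleted. The relation justifying the deletion has length 2|B|+2; if this is
less than n, it holds for `t` by induction, and so does the deleted word. Otherwise the deleted
letters are the first and the last of that initial segment. -/
theorem wordProd_eq_one_or_half (hs : ∀ x, s x * s x = 1) (ht : ∀ x, t x * t x = 1)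
    (hdel : DeletionProperty s) {n : ℕ}
    (ih : ∀ u : List S, u.length < n → wordProd s u = 1 → wordProd t u = 1)
    {u : List S} (hn : u.length = n) (h0 : 0 < n) (hu : wordProd s u = 1) :
    wordProd t u = 1 ∨ ∃ (x : S) (B : List S) (y : S) (C : List S), u = x :: (B ++ y :: C) ∧
      n = 2 * (B.length + 1) ∧ s x * wordProd s B = wordProd s B * s y := by
  obtain ⟨A, x, B, y, C, e, h⟩ := hdel (u.take (n / 2 + 1)) (u.drop (n / 2 + 1)).reverse
    (wordProd_eq_of_append_reverse hs (by simpa using hu)) (by simp [hn]; omega)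
  have e' : u = A ++ x :: (B ++ y :: (C ++ u.drop (n / 2 + 1))) := by
    conv_lhs => rw [← List.take_append_drop (n / 2 + 1) u, e]
    simp
  have hl := congrArg List.length e
  simp only [List.length_take, hn, List.length_append, List.length_cons] at hl
  by_cases hB : 2 * B.length + 2 < n
  · left
    have h' : wordProd s (x :: B ++ (B ++ [y]).reverse) = 1 :=
      wordProd_append_reverse_of_eq hs (by simpa using h)
    have h'' := wordProd_eq_of_append_reverse ht (ih _ (by simp; omega) h')
    rw [e'] at hu hn ⊢
    exact wordProd_eq_one_of_delete hs ht ih hn hu h (by simpa using h'')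
  · right
    have hA : A = [] := List.eq_nil_of_length_eq_zero (by omega)
    exact ⟨x, B, y, C ++ u.drop (n / 2 + 1), by simpa [hA] using e', by omega, h⟩

/-- The half-length relation is applied to the word, to its rotation by one letter, and to a third
relation of the same length built from the second. The first and the third then conjugate the same
letter by the same word, which identifies `a` with `c`. -/
theorem first_eq_third (hs : ∀ x, s x * s x = 1) (ht : ∀ x, t x * t x = 1)
    (hinj : Function.Injective s) (hdel : DeletionProperty s) {n : ℕ}
    (ih : ∀ u : List S, u.length < n → wordProd s u = 1 → wordProd t u = 1)
    {a b c : S} {u : List S} (hn : (a :: b :: c :: u).length = n)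
    (hu : wordProd s (a :: b :: c :: u) = 1) (hu' : wordProd t (a :: b :: c :: u) ≠ 1) :
    a = c := by
  have h0 : 0 < n := by simp at hn; omega
  rcases wordProd_eq_one_or_half hs ht hdel ih hn h0 hu with h | ⟨x, B, y, C, e0, hp, h⟩
  · exact absurd h hu'
  obtain ⟨rfl, e⟩ := List.cons.inj e0
  clear e0
  match B, e, hp, h with
  | [], e, hp, h => simp at hn hp; omega
  | b' :: B, e', hp, h =>
    obtain ⟨rfl, e⟩ := List.cons.inj e'
    clear e'
    have hrot : wordProd s (b :: c :: u ++ [a]) = 1 := wordProd_append_comm hs (u := [a]) hu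
    have hrot' : wordProd t (b :: c :: u ++ [a]) ≠ 1 :=
      fun h => hu' (wordProd_append_comm ht (w := [a]) h)
    rcases wordProd_eq_one_or_half hs ht hdel ih (by simpa using hn) h0 hrot with
      h1 | ⟨x, D, z, E, e1', hp1, h1⟩
    · exact absurd h1 hrot'
    obtain ⟨rfl, e1⟩ := List.cons.inj e1'
    clear e1'
    have hD : D = B ++ [y] := by
      change (c :: u) ++ [a] = _ at e1
      rw [show c :: u = B ++ [y] ++ C by simpa using e, List.append_assoc] at e1
      exact (List.append_inj_left e1 (by simp at hp hp1 ⊢; omega)).symm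
    match D, e1, hp1, h1, hD with
    | [], e1, hp1, h1, hD => simp at hD
    | c' :: D, e1', hp1, h1, hD =>
      obtain ⟨rfl, e1⟩ := List.cons.inj e1'
      clear e1'
      -- From b(cD) = (cD)z follows c·b·(cD) = Dz, a new relation, again of length n.
      have hR : wordProd s (c :: b :: c :: D ++ (D ++ [z]).reverse) = 1 := by
        refine wordProd_append_reverse_of_eq hs ?_
        rw [wordProd_cons, wordProd_cons, h1, wordProd_cons, ← mul_assoc, ← mul_assoc, hs, one_mul]
        simp
      have hRl : (c :: b :: c :: D ++ (D ++ [z]).reverse).length = n := by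
        simp at hp1 ⊢; omega
      rcases wordProd_eq_one_or_half hs ht hdel ih hRl h0 hR with h2 | ⟨x, F, w, E', e2', hp2, h2⟩
      -- If the new relation held for `t`, it would license the deletion in the rotated word, and
      -- the counterexample would disappear.
      · refine absurd ?_ hrot'
        have h3 := wordProd_eq_of_append_reverse ht h2
        have e3 : b :: c :: u ++ [a] = [] ++ b :: (c :: D ++ z :: E) := by
          simpa using e1
        rw [e3] at hrot ⊢
        refine wordProd_eq_one_of_delete hs ht ih (by rw [← e3]; simpa using hn) hrot h1 ?_
        rw [wordProd_cons] at h3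
        have h4 : t b * wordProd t (c :: D) = t c * wordProd t (D ++ [z]) := by
          rw [← h3, ← mul_assoc, ht, one_mul, wordProd_cons t b]
        rw [h4]
        simp [mul_assoc]
      · obtain ⟨rfl, e2⟩ := List.cons.inj e2'
        clear e2'
        -- Since cD = By, the half-length relation for the new word reads c·(bB) = (bB)·y, to be
        -- compared with a·(bB) = (bB)·y.
        have e4 : b :: B = F ∧ y = w := by
          change b :: (c :: D) ++ _ = _ at e2
          rw [hD, show F ++ w :: E' = F ++ [w] ++ E' by simp] at e2
          have e5 := List.append_inj_left e2 (by simp at hp hp2 ⊢; omega)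
          rw [← List.cons_append] at e5
          have := List.append_inj' e5 (by simp)
          simpa using this
        obtain ⟨rfl, rfl⟩ := e4
        exact hinj (mul_right_cancel (h.trans h2.symm))

theorem getElem_zero_eq_getElem_two (hs : ∀ x, s x * s x = 1) (ht : ∀ x, t x * t x = 1)
    (hinj : Function.Injective s) (hdel : DeletionProperty s) {n : ℕ}
    (ih : ∀ u : List S, u.length < n → wordProd s u = 1 → wordProd t u = 1)
    {u : List S} (hn : u.length = n) (hu : wordProd s u = 1) (hu' : wordProd t u ≠ 1)
    (h2 : 2 < u.length) : u[0] = u[2] := by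
  match u, hn, hu, hu', h2 with
  | a :: b :: c :: u, hn, hu, hu', h2 => exact first_eq_third hs ht hinj hdel ih hn hu hu'

/-- A relation between involutions with the deletion property is a consequence of the relations
involving at most two of them. -/
theorem wordProd_eq_one_of_deletionProperty (hs : ∀ x, s x * s x = 1) (ht : ∀ x, t x * t x = 1)
    (hinj : Function.Injective s) (hdel : DeletionProperty s)
    (hrank : ∀ x y p, (s x * s y) ^ p = 1 → (t x * t y) ^ p = 1) (u : List S)
    (hu : wordProd s u = 1) : wordProd t u = 1 := by
  induction hn : u.length using Nat.strong_induction_on generalizing u with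
  | _ n ih =>
    replace ih : ∀ u : List S, u.length < n → wordProd s u = 1 → wordProd t u = 1 :=
      fun u hl hu => ih _ hl u hu rfl
    by_contra hu'
    rcases Nat.eq_zero_or_pos n with h0 | h0
    · rw [h0] at hn
      rw [List.eq_nil_of_length_eq_zero hn] at hu'
      exact hu' rfl
    obtain ⟨p, hp⟩ : ∃ p, n = 2 * p := by
      rcases wordProd_eq_one_or_half hs ht hdel ih hn h0 hu with h | ⟨x, B, y, C, e, hp, h⟩
      · exact absurd h hu'
      · exact ⟨_, hp⟩
    -- Rotations of a minimal counterexample are minimal counterexamples, so any two letters at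
    -- distance two agree and the word alternates.
    have hrot (k : ℕ) : wordProd s (u.rotate k) = 1 ∧ wordProd t (u.rotate k) ≠ 1 := by
      rw [List.rotate_eq_drop_append_take_mod]
      exact ⟨wordProd_append_comm hs (by simpa using hu),
        fun h => hu' (by simpa using wordProd_append_comm ht h)⟩
    have hpos : 0 < u.length := by omega
    have hstep (k : ℕ) (hk : k + 2 < u.length) : u[k + 2] = u[k] := by
      have hl : (u.rotate k).length = n := by simpa using hn
      obtain ⟨h1, h2⟩ := hrot k
      have g0 : (u.rotate k)[0]'(by simpa using hpos) = u[k] := by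
        rw [List.getElem_rotate]; congr 1; rw [zero_add, Nat.mod_eq_of_lt (by omega)]
      have g2 : (u.rotate k)[2]'(by simp; omega) = u[k + 2] := by
        rw [List.getElem_rotate]; congr 1; rw [add_comm, Nat.mod_eq_of_lt (by omega)]
      rw [← g0, ← g2]
      exact (getElem_zero_eq_getElem_two hs ht hinj hdel ih hl h1 h2 _).symm
    have hone : 1 < u.length := by omega
    have hpat (i : ℕ) (hi : i < u.length) :
        u[i] = if i % 2 = 0 then u[0] else u[1] := by
      induction i using Nat.strong_induction_on with
      | _ i IH =>
        match i with
        | 0 => simp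
        | 1 => simp
        | i + 2 =>
          rw [hstep i hi, IH i (by omega) (by omega)]
          simp
    rw [wordProd_alternating (hn.trans hp) hpat] at hu hu'
    exact hu' (hrank _ _ _ hu)

/-- Extension of a map on generators to a monoid homomorphism. -/
theorem existsUnique_monoidHom (hs : ∀ x, s x * s x = 1) (ht : ∀ x, t x * t x = 1)
    (hgen : Subgroup.closure (Set.range s) = ⊤)
    (hrel : ∀ u, wordProd s u = 1 → wordProd t u = 1) :
    ∃! ρ : W →* H, ∀ x, ρ (s x) = t x := by
  have hsurj (w : W) : ∃ u, wordProd s u = w := by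
    have hw : w ∈ Subgroup.closure (Set.range s) := hgen ▸ Subgroup.mem_top w
    induction hw using Subgroup.closure_induction with
    | mem x hx => obtain ⟨i, rfl⟩ := hx; exact ⟨[i], by simp⟩
    | one => exact ⟨[], rfl⟩
    | mul x y _ _ hx hy =>
      obtain ⟨u, rfl⟩ := hx; obtain ⟨w, rfl⟩ := hy; exact ⟨u ++ w, by simp⟩
    | inv x _ hx =>
      obtain ⟨u, rfl⟩ := hx
      exact ⟨u.reverse, eq_inv_of_mul_eq_one_left (wordProd_reverse_mul hs u)⟩
  have hwd {u w : List S} (h : wordProd s u = wordProd s w) : wordProd t u = wordProd t w :=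
    wordProd_eq_of_append_reverse ht (hrel _ (wordProd_append_reverse_of_eq hs h))
  choose f hf using hsurj
  refine ⟨{ toFun := fun w => wordProd t (f w), map_one' := ?_, map_mul' := ?_ }, ?_, ?_⟩
  · exact hwd (w := []) (hf 1)
  · intro x y
    rw [← wordProd_append]
    exact hwd (by rw [hf, wordProd_append, hf, hf])
  · intro x
    exact (hwd (w := [x]) (by rw [hf]; simp)).trans (by simp)
  · intro ρ hρ
    ext w
    have (u : List S) : ρ (wordProd s u) = wordProd t u := by
      induction u with
      | nil => simp
      | cons x u ih => simp [ih, hρ]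
    change ρ w = wordProd t (f w)
    rw [← this, hf]

end Presentation

/-! ### Rank two reflection groups acting on an abelian group -/

section RankTwo

variable {A : Type*} [AddCommGroup A]

/-- Two affine reflections `β ↦ β - κ₁ β • α₁` and `β ↦ β - κ₂ β • α₂` of an abelian group, whose
Cartan integers are `-p₁` and `-p₂`. -/
structure ReflectionPair (α₁ α₂ : A) (κ₁ κ₂ : A → ℤ) (p₁ p₂ : ℤ) : Prop where
  add₁₁ : ∀ β n, κ₁ (β + n • α₁) = κ₁ β + 2 * n
  add₁₂ : ∀ β n, κ₁ (β + n • α₂) = κ₁ β - p₂ * n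
  add₂₁ : ∀ β n, κ₂ (β + n • α₁) = κ₂ β - p₁ * n
  add₂₂ : ∀ β n, κ₂ (β + n • α₂) = κ₂ β + 2 * n

variable {α₁ α₂ : A} {κ₁ κ₂ : A → ℤ} {p₁ p₂ : ℤ}

/-- The affine reflection `β ↦ β - κ β • α`. -/
def affineReflection (α : A) (κ : A → ℤ) (β : A) : A := β - κ β • α

namespace ReflectionPair

theorem symm (h : ReflectionPair α₁ α₂ κ₁ κ₂ p₁ p₂) : ReflectionPair α₂ α₁ κ₂ κ₁ p₂ p₁ :=
  ⟨h.add₂₂, h.add₂₁, h.add₁₂, h.add₁₁⟩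

theorem κ₁_reflection₁ (h : ReflectionPair α₁ α₂ κ₁ κ₂ p₁ p₂) (β : A) :
    κ₁ (affineReflection α₁ κ₁ β) = -κ₁ β := by
  rw [affineReflection, sub_eq_add_neg, ← neg_smul, h.add₁₁]; ring

theorem κ₂_reflection₁ (h : ReflectionPair α₁ α₂ κ₁ κ₂ p₁ p₂) (β : A) :
    κ₂ (affineReflection α₁ κ₁ β) = κ₂ β + p₁ * κ₁ β := by
  rw [affineReflection, sub_eq_add_neg, ← neg_smul, h.add₂₁]; ring

theorem κ₂_reflection₂ (h : ReflectionPair α₁ α₂ κ₁ κ₂ p₁ p₂) (β : A) :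
    κ₂ (affineReflection α₂ κ₂ β) = -κ₂ β := h.symm.κ₁_reflection₁ β

theorem κ₁_reflection₂ (h : ReflectionPair α₁ α₂ κ₁ κ₂ p₁ p₂) (β : A) :
    κ₁ (affineReflection α₂ κ₂ β) = κ₁ β + p₂ * κ₂ β := h.symm.κ₂_reflection₁ β

theorem reflection_reflection₁ (h : ReflectionPair α₁ α₂ κ₁ κ₂ p₁ p₂) (β : A) :
    affineReflection α₁ κ₁ (affineReflection α₁ κ₁ β) = β := by
  rw [affineReflection, h.κ₁_reflection₁, affineReflection]
  module

theorem reflection_reflection₂ (h : ReflectionPair α₁ α₂ κ₁ κ₂ p₁ p₂) (β : A) :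
    affineReflection α₂ κ₂ (affineReflection α₂ κ₂ β) = β := h.symm.reflection_reflection₁ β

/-- The pair of coordinates of the product of the two reflections. -/
theorem iterate_coordinates (h : ReflectionPair α₁ α₂ κ₁ κ₂ p₁ p₂) (k : ℕ) (β : A) :
    (κ₁ ((affineReflection α₁ κ₁ ∘ affineReflection α₂ κ₂)^[k] β),
      κ₂ ((affineReflection α₁ κ₁ ∘ affineReflection α₂ κ₂)^[k] β)) =
    (fun x : ℤ × ℤ => (-(x.1 + p₂ * x.2), -x.2 + p₁ * (x.1 + p₂ * x.2)))^[k] (κ₁ β, κ₂ β) := by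
  refine Function.Semiconj.iterate_right (f := fun β => (κ₁ β, κ₂ β)) (fun β => ?_) k β
  simp only [Function.comp_apply, h.κ₁_reflection₁, h.κ₂_reflection₁, h.κ₁_reflection₂,
    h.κ₂_reflection₂]

/-- This keeps a composite of reflections in coordinates relative to a fixed base point, so that the
braid relations become identities between the coefficients of α₁ and α₂. -/
theorem reflection₁_sub (h : ReflectionPair α₁ α₂ κ₁ κ₂ p₁ p₂) (β : A) (x y : ℤ) :
    affineReflection α₁ κ₁ (β - x • α₁ - y • α₂) =
      β - (κ₁ β - x + p₂ * y) • α₁ - y • α₂ := by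
  have e : κ₁ (β - x • α₁ - y • α₂) = κ₁ β - 2 * x + p₂ * y := by
    rw [sub_eq_add_neg, sub_eq_add_neg, ← neg_smul, ← neg_smul, h.add₁₂, h.add₁₁]; ring
  rw [affineReflection, e]
  module

theorem reflection₂_sub (h : ReflectionPair α₁ α₂ κ₁ κ₂ p₁ p₂) (β : A) (x y : ℤ) :
    affineReflection α₂ κ₂ (β - x • α₁ - y • α₂) =
      β - x • α₁ - (κ₂ β - y + p₁ * x) • α₂ := by
  rw [sub_right_comm, h.symm.reflection₁_sub, sub_right_comm]

theorem braid_two (h : ReflectionPair α₁ α₂ κ₁ κ₂ 0 0) (β : A) :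
    affineReflection α₁ κ₁ (affineReflection α₂ κ₂ β) =
      affineReflection α₂ κ₂ (affineReflection α₁ κ₁ β) := by
  -- The point is renamed and written with zero coefficients, so that the coordinate rules can be
  -- used as rewrite rules.
  obtain ⟨γ, hγ⟩ : ∃ γ, γ = β := ⟨β, rfl⟩
  have e : β = γ - (0 : ℤ) • α₁ - (0 : ℤ) • α₂ := by simp [hγ]
  rw [e]
  simp only [h.reflection₁_sub, h.reflection₂_sub]
  match_scalars <;> ring

theorem braid_three (h : ReflectionPair α₁ α₂ κ₁ κ₂ 1 1) (β : A) :
    affineReflection α₁ κ₁ (affineReflection α₂ κ₂ (affineReflection α₁ κ₁ β)) =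
      affineReflection α₂ κ₂ (affineReflection α₁ κ₁ (affineReflection α₂ κ₂ β)) := by
  obtain ⟨γ, hγ⟩ : ∃ γ, γ = β := ⟨β, rfl⟩
  have e : β = γ - (0 : ℤ) • α₁ - (0 : ℤ) • α₂ := by simp [hγ]
  rw [e]
  simp only [h.reflection₁_sub, h.reflection₂_sub]
  match_scalars <;> ring

theorem braid_four (h : ReflectionPair α₁ α₂ κ₁ κ₂ p₁ p₂) (hp : p₁ * p₂ = 2) (β : A) :
    (affineReflection α₁ κ₁ ∘ affineReflection α₂ κ₂)^[2] β =
      (affineReflection α₂ κ₂ ∘ affineReflection α₁ κ₁)^[2] β := by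
  obtain ⟨γ, hγ⟩ : ∃ γ, γ = β := ⟨β, rfl⟩
  have e : β = γ - (0 : ℤ) • α₁ - (0 : ℤ) • α₂ := by simp [hγ]
  rw [e]
  simp only [Function.iterate_succ, Function.iterate_zero, Function.comp_apply, id,
    h.reflection₁_sub, h.reflection₂_sub]
  match_scalars
  · ring
  · linear_combination (-p₂ * κ₂ γ) * hp
  · linear_combination p₁ * κ₁ γ * hp

theorem braid_six (h : ReflectionPair α₁ α₂ κ₁ κ₂ p₁ p₂) (hp : p₁ * p₂ = 3) (β : A) :
    (affineReflection α₁ κ₁ ∘ affineReflection α₂ κ₂)^[3] β =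
      (affineReflection α₂ κ₂ ∘ affineReflection α₁ κ₁)^[3] β := by
  obtain ⟨γ, hγ⟩ : ∃ γ, γ = β := ⟨β, rfl⟩
  have e : β = γ - (0 : ℤ) • α₁ - (0 : ℤ) • α₂ := by simp [hγ]
  rw [e]
  simp only [Function.iterate_succ, Function.iterate_zero, Function.comp_apply, id,
    h.reflection₁_sub, h.reflection₂_sub]
  match_scalars
  · ring
  · linear_combination (-p₂ * κ₂ γ) * (p₁ * p₂ - 1) * hp
  · linear_combination p₁ * κ₁ γ * (p₁ * p₂ - 1) * hp

/-- The pairs of (negated) Cartan integers of the root systems of rank two,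
    with the order `r` of the
product of the simple reflections. -/
inductive _root_.TwistedWeylAction.IsRankTwoType : ℤ → ℤ → ℕ → Prop
  | A₁A₁ : IsRankTwoType 0 0 2
  | A₂ : IsRankTwoType 1 1 3
  | B₂ : IsRankTwoType 1 2 4
  | C₂ : IsRankTwoType 2 1 4
  | G₂ : IsRankTwoType 1 3 6
  | G₂' : IsRankTwoType 3 1 6

theorem iterate_eq_self {r : ℕ} (hr : IsRankTwoType p₁ p₂ r)
    (h : ReflectionPair α₁ α₂ κ₁ κ₂ p₁ p₂) (β : A) :
    (affineReflection α₁ κ₁ ∘ affineReflection α₂ κ₂)^[r] β = β := by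
  have r₁ := h.reflection_reflection₁
  have r₂ := h.reflection_reflection₂
  have four (hp : p₁ * p₂ = 2) :
      (affineReflection α₁ κ₁ ∘ affineReflection α₂ κ₂)^[2 + 2] β = β := by
    rw [Function.iterate_add_apply, h.braid_four hp]
    simp only [Function.iterate_succ, Function.iterate_zero, Function.comp_apply, id, r₁, r₂]
  have six (hp : p₁ * p₂ = 3) :
      (affineReflection α₁ κ₁ ∘ affineReflection α₂ κ₂)^[3 + 3] β = β := by
    rw [Function.iterate_add_apply, h.braid_six hp]
    simp only [Function.iterate_succ, Function.iterate_zero, Function.comp_apply, id, r₁, r₂]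
  cases hr with
  | A₁A₁ =>
    simp only [Function.iterate_succ, Function.iterate_zero, Function.comp_apply, id]
    rw [h.braid_two, r₁, r₂]
  | A₂ =>
    simp only [Function.iterate_succ, Function.iterate_zero, Function.comp_apply, id]
    rw [← h.braid_three]
    simp only [r₁, r₂]
  | B₂ => exact four rfl
  | C₂ => exact four rfl
  | G₂ => exact six rfl
  | G₂' => exact six rfl

/-- The hypotheses on β are the κ-values of α₁ itself for the linear reflections. Its orbit under
the rotation has exactly r points, already visible in the pair (κ₁, κ₂), so only finitely many
residues need inspection. -/
theorem dvd_of_iterate_eq_self {r k : ℕ} (hr : IsRankTwoType p₁ p₂ r)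
    (h : ReflectionPair α₁ α₂ κ₁ κ₂ p₁ p₂) {β : A} (h₁ : κ₁ β = 2) (h₂ : κ₂ β = -p₁)
    (hk : (affineReflection α₁ κ₁ ∘ affineReflection α₂ κ₂)^[k] β = β) : r ∣ k := by
  have hr0 : 0 < r := by cases hr <;> norm_num
  have hk' : (affineReflection α₁ κ₁ ∘ affineReflection α₂ κ₂)^[k % r] β = β := by
    have e : (affineReflection α₁ κ₁ ∘ affineReflection α₂ κ₂)^[r] = id :=
      funext fun γ => h.iterate_eq_self hr γ
    conv_lhs at hk => rw [← Nat.mod_add_div k r, Function.iterate_add_apply, Function.iterate_mul,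
      e, Function.iterate_id, id]
    exact hk
  have hc := h.iterate_coordinates (k % r) β
  rw [hk', h₁, h₂] at hc
  have hlt := Nat.mod_lt k hr0
  refine Nat.dvd_of_mod_eq_zero ?_
  generalize k % r = u at hc hlt
  clear hk hk'
  cases hr <;> interval_cases u <;> first | rfl | (exfalso; revert hc; decide)

end ReflectionPair

end RankTwo

variable {ι M N : Type*} [AddCommGroup M] [Module ℝ M] [AddCommGroup N] [Module ℝ N]
  {P : RootPairing ι ℝ M N}

/-! ### Reflections of the root lattice and the Weyl group -/

theorem latticeReflection_eq [P.IsCrystallographic] (k : ι) :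
    (latticeReflection k : Lattice P → Lattice P) =
      affineReflection (P.rootSpanMem ℤ k) (P.coroot'In ℤ k) := rfl

/-- The number `⟨β - θ, α_i^∨⟩`. -/
def kappa [P.IsCrystallographic] (b : P.Base) (l : b.support → ℕ) (i : b.support)
    (β : Lattice P) : ℤ := P.coroot'In ℤ (i : ι) β - ((l i : ℤ) + 1)

theorem simpleDot_eq [P.IsCrystallographic] (b : P.Base) (l : b.support → ℕ) (i : b.support) :
    simpleDot b l i = affineReflection (P.rootSpanMem ℤ (i : ι)) (kappa b l i) := by
  ext1 β
  rw [simpleDot, latticeReflection_apply, affineReflection, kappa]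
  module

theorem mu_eq_neg_kappa [P.IsCrystallographic] (b : P.Base) (l : b.support → ℕ) (i : b.support)
    (β : Lattice P) : mu b l i β = -kappa b l i β := by
  rw [mu, simpleDot_eq, affineReflection, sub_sub_cancel_left, map_neg, map_smul, height_simple]
  simp

theorem coroot'In_add_zsmul [P.IsCrystallographic] (j k : ι) (β : Lattice P) (m : ℤ) :
    P.coroot'In ℤ k (β + m • P.rootSpanMem ℤ j) =
      P.coroot'In ℤ k β + P.pairingIn ℤ j k * m := by
  rw [map_add, map_smul, P.coroot'In_rootSpanMem_eq_pairingIn, smul_eq_mul, mul_comm]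

theorem reflectionPair_lattice [P.IsCrystallographic] (j k : ι) :
    ReflectionPair (P.rootSpanMem ℤ j) (P.rootSpanMem ℤ k) (P.coroot'In ℤ j) (P.coroot'In ℤ k)
      (-P.pairingIn ℤ j k) (-P.pairingIn ℤ k j) where
  add₁₁ β m := by rw [coroot'In_add_zsmul, pairingIn_same]
  add₁₂ β m := by rw [coroot'In_add_zsmul]; ring
  add₂₁ β m := by rw [coroot'In_add_zsmul]; ring
  add₂₂ β m := by rw [coroot'In_add_zsmul, pairingIn_same]

/-- The affine κ differs from the coroot by a constant, so the dot action has the same Cartan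
integers as the linear one. -/
theorem reflectionPair_dot [P.IsCrystallographic] (b : P.Base) (l : b.support → ℕ)
    (i j : b.support) :
    ReflectionPair (P.rootSpanMem ℤ (i : ι)) (P.rootSpanMem ℤ (j : ι)) (kappa b l i)
      (kappa b l j) (-P.pairingIn ℤ i j) (-P.pairingIn ℤ j i) where
  add₁₁ β m := by rw [kappa, kappa, coroot'In_add_zsmul, pairingIn_same]; ring
  add₁₂ β m := by rw [kappa, kappa, coroot'In_add_zsmul]; ring
  add₂₁ β m := by rw [kappa, kappa, coroot'In_add_zsmul]; ring
  add₂₂ β m := by rw [kappa, kappa, coroot'In_add_zsmul, pairingIn_same]; ring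

theorem coe_iterate_latticeReflection [P.IsCrystallographic] (i j : ι) (k : ℕ) (β : Lattice P) :
    (((latticeReflection i ∘ latticeReflection j)^[k] β : Lattice P) : M) =
      (weylGroup.ofIdx P i * weylGroup.ofIdx P j) ^ k • (β : M) := by
  induction k generalizing β with
  | zero => simp
  | succ k ih =>
    rw [Function.iterate_succ_apply, ih, pow_succ, mul_smul, Function.comp_apply,
      coe_latticeReflection, coe_latticeReflection, mul_smul]

theorem weylGroup_ext [P.IsRootSystem] {g h : P.weylGroup}
    (e : ∀ k, g • P.root k = h • P.root k) : g = h := by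
  apply Subtype.ext
  apply Equiv.weightHom_injective P
  apply LinearEquiv.ext
  intro x
  have hx : x ∈ P.rootSpan ℝ := by simp
  change g • x = h • x
  induction hx using Submodule.span_induction with
  | mem x hx => obtain ⟨k, rfl⟩ := hx; exact e k
  | zero => simp
  | add x y _ _ hx hy => rw [smul_add, smul_add, hx, hy]
  | smul a x _ hx =>
    have hg (w : P.weylGroup) : w • a • x = a • w • x := smul_comm (w : P.Aut) a x
    rw [hg, hg, hx]

theorem mul_pow_eq_one_iff [P.IsRootSystem] [P.IsCrystallographic] (i j : ι) (k : ℕ) :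
    (weylGroup.ofIdx P i * weylGroup.ofIdx P j) ^ k = 1 ↔
      ∀ β : Lattice P, (latticeReflection i ∘ latticeReflection j)^[k] β = β := by
  constructor
  · intro h β
    apply Subtype.ext
    rw [coe_iterate_latticeReflection, h, one_smul]
  · intro h
    refine weylGroup_ext fun m => ?_
    have := congrArg Subtype.val (h (P.rootSpanMem ℤ m))
    rw [coe_iterate_latticeReflection] at this
    simpa using this

theorem ofIdx_mul_self (i : ι) : weylGroup.ofIdx P i * weylGroup.ofIdx P i = 1 := by
  have : weylGroup.ofIdx P i = (weylGroup.ofIdx P i)⁻¹ :=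
    Subtype.ext (Equiv.reflection_inv P i).symm
  exact mul_eq_one_iff_eq_inv.mpr this

theorem pairingIn_mul_form [P.IsCrystallographic] (B : P.InvariantForm) (i j : ι) :
    (P.pairingIn ℤ i j : ℝ) * B.form (P.root j) (P.root j) =
      P.pairingIn ℤ j i * B.form (P.root i) (P.root i) := by
  have h := B.pairing_mul_eq_pairing_mul_swap j i
  rwa [← P.algebraMap_pairingIn ℤ, ← P.algebraMap_pairingIn ℤ] at h

/-- The Cartan integers of two simple roots are nonpositive with product at most 3. Their ratio is
the ratio of squared lengths, and the value -3 occurs exactly for G₂, so the case distinctions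
defining the exponent match the list of rank-two types. -/
theorem isRankTwoType [Finite ι] [P.IsRootSystem] [P.IsCrystallographic] [P.IsReduced]
    [P.IsIrreducible] (b : P.Base) (B : P.InvariantForm) {i j : b.support} (hij : i ≠ j) :
    IsRankTwoType (-P.pairingIn ℤ i j) (-P.pairingIn ℤ j i) (relExponent b B i j) := by
  have hij' : (i : ι) ≠ j := fun h => hij (Subtype.ext h)
  have hroot : P.root i ≠ P.root j := fun h => hij' (P.root.injective h)
  have hneg := b.root_ne_neg_of_ne i.2 j.2 hij'
  have h1 := b.pairingIn_le_zero_of_ne hij' i.2 j.2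
  have h2 := b.pairingIn_le_zero_of_ne hij'.symm j.2 i.2
  have hmem := P.pairingIn_pairingIn_mem_set_of_isCrystal_of_isRed' i j hroot hneg
  have hB := pairingIn_mul_form B i j
  have hi := B.ne_zero i
  have hj := B.ne_zero j
  -- The rotation has order exactly r, so its square is trivial precisely when r divides 2.
  have adj {r : ℕ} (hr : IsRankTwoType (-P.pairingIn ℤ i j) (-P.pairingIn ℤ j i) r) :
      Adjacent b i j ↔ ¬ r ∣ 2 := by
    rw [Adjacent, and_iff_right hij, ne_eq, mul_pow_eq_one_iff, not_iff_not]
    constructor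
    · intro h
      exact (reflectionPair_lattice (P := P) i j).dvd_of_iterate_eq_self hr
        (β := P.rootSpanMem ℤ (i : ι))
        (by rw [P.coroot'In_rootSpanMem_eq_pairingIn, pairingIn_same])
        (by rw [P.coroot'In_rootSpanMem_eq_pairingIn, neg_neg]) (h _)
    · rintro ⟨u, hu⟩ β
      have e := fun β => (reflectionPair_lattice (P := P) i j).iterate_eq_self hr β
      rw [hu, Function.iterate_mul, latticeReflection_eq, latticeReflection_eq, funext e]
      exact congrFun (Function.iterate_id u) β
  have hG : P.IsG2 → P.pairingIn ℤ i j ∈ ({-3, -1, 0, 1, 3} : Set ℤ) ∧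
      P.pairingIn ℤ j i ∈ ({-3, -1, 0, 1, 3} : Set ℤ) := fun h =>
    ⟨IsG2.pairingIn_mem_zero_one_three P i j hroot hneg,
      IsG2.pairingIn_mem_zero_one_three P j i hroot.symm fun h => hneg (by rw [h, neg_neg])⟩
  have hG' : P.pairingIn ℤ i j = -3 ∨ P.pairingIn ℤ j i = -3 → P.IsG2 := by
    rintro (h | h)
    · exact P.isG2_iff.mpr ⟨_, _, h⟩
    · exact P.isG2_iff.mpr ⟨_, _, h⟩
  simp only [Set.mem_insert_iff, Set.mem_singleton_iff, Prod.mk.injEq] at hmem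
  rw [relExponent, if_neg hij]
  generalize P.pairingIn ℤ i j = x at *
  generalize P.pairingIn ℤ j i = y at *
  generalize B.form (P.root i) (P.root i) = u at *
  generalize B.form (P.root j) (P.root j) = w at *
  have cases : (x = 0 ∧ y = 0) ∨ (x = -1 ∧ y = -1) ∨ (x = -1 ∧ y = -2) ∨ (x = -2 ∧ y = -1) ∨
      (x = -1 ∧ y = -3) ∨ (x = -3 ∧ y = -1) := by omega
  rcases cases with ⟨rfl, rfl⟩ | ⟨rfl, rfl⟩ | ⟨rfl, rfl⟩ | ⟨rfl, rfl⟩ | ⟨rfl, rfl⟩ | ⟨rfl, rfl⟩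
  · have := (adj .A₁A₁).not
    rw [if_pos (by simpa using this)]
    exact .A₁A₁
  · have := adj .A₂
    rw [if_neg (by simp [this]), if_pos (by push_cast at hB; linarith)]
    exact .A₂
  · have := adj .B₂
    rw [if_neg (by simp [this]), if_neg (by push_cast at hB; grind),
      if_pos fun h => by simpa using (hG h).2]
    exact .B₂
  · have := adj .C₂
    rw [if_neg (by simp [this]), if_neg (by push_cast at hB; grind),
      if_pos fun h => by simpa using (hG h).1]
    exact .C₂
  · have := adj .G₂
    rw [if_neg (by simp [this]), if_neg (by push_cast at hB; grind),
      if_neg (not_not.mpr (hG' (by simp)))]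
    exact .G₂
  · have := adj .G₂'
    rw [if_neg (by simp [this]), if_neg (by push_cast at hB; grind),
      if_neg (not_not.mpr (hG' (by simp)))]
    exact .G₂'

/-! ### The deletion property of the Weyl group -/

theorem form_root [P.IsCrystallographic] (B : P.InvariantForm) (x : M) (k : ι) :
    2 * B.form x (P.root k) = P.toLinearMap x (P.coroot k) * B.form (P.root k) (P.root k) := by
  have h := B.isOrthogonal_reflection k x (P.root k)
  rw [P.reflection_apply, P.reflection_apply_self] at h
  simp only [map_sub, map_smul, LinearMap.sub_apply, LinearMap.smul_apply, map_neg,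
    smul_eq_mul] at h
  have e : P.coroot' k x = P.toLinearMap x (P.coroot k) := rfl
  rw [e] at h
  linarith

/-- Invariance of the form gives ⟨gx, (gα)^∨⟩ = ⟨x, α^∨⟩, hence the conjugation rule for
reflections. -/
theorem ofIdx_eq_conj [P.IsRootSystem] [P.IsCrystallographic] (B : P.InvariantForm)
    {g : P.weylGroup} {k m : ι}
    (h : P.weylGroupToPerm g k = m) : weylGroup.ofIdx P m * g = g * weylGroup.ofIdx P k := by
  refine weylGroup_ext fun a => ?_
  have hg : g • P.root k = P.root m := by rw [weylGroup_apply_root, h]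
  have hB := form_root B (g • P.root a) m
  rw [← hg, B.apply_weylGroup_smul, B.apply_weylGroup_smul, form_root] at hB
  have hc := mul_right_cancel₀ (B.ne_zero k) hB
  have hsub (x y : M) (c : ℝ) : g • (x - c • y) = g • x - c • g • y := by
    have : g • c • y = c • g • y := smul_comm (g : P.Aut) c y
    rw [smul_sub, this]
  rw [mul_smul, mul_smul, weylGroup.ofIdx_smul, weylGroup.ofIdx_smul, Equiv.reflection_smul,
    Equiv.reflection_smul, P.reflection_apply, P.reflection_apply, hsub, hg]
  congr 2
  exact hc.symm

theorem weylGroupToPerm_ofIdx (j k : ι) :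
    P.weylGroupToPerm (weylGroup.ofIdx P j) k = P.reflectionPerm j k := rfl

theorem weylGroupToPerm_neg (g : P.weylGroup) (k : ι) :
    P.weylGroupToPerm g (P.reflectionPerm k k) =
      P.reflectionPerm (P.weylGroupToPerm g k) (P.weylGroupToPerm g k) := by
  apply P.root.injective
  rw [← weylGroup_apply_root, P.root_reflectionPerm, P.reflection_apply_self,
    P.root_reflectionPerm, P.reflection_apply_self, smul_neg, weylGroup_apply_root]

theorem isPos_weylGroupToPerm_neg (b : P.Base) (g : P.weylGroup) (k : ι) :
    b.IsPos (P.weylGroupToPerm g (P.reflectionPerm k k)) ↔ ¬ b.IsPos (P.weylGroupToPerm g k) := by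
  rw [weylGroupToPerm_neg]
  exact Base.IsPos.neg_iff_not b _

theorem ofIdx_simple_injective (b : P.Base) : Function.Injective
    (fun i : b.support => weylGroup.ofIdx P i) := by
  intro i j h
  by_contra hij
  have hli := b.linearIndependent_pair_of_ne hij
  have e := congrArg (fun g : P.weylGroup => g • P.root i) h
  simp only [weylGroup.ofIdx_smul, Equiv.reflection_smul, P.reflection_apply_self,
    P.reflection_apply] at e
  rw [LinearIndependent.pair_iff] at hli
  have := (hli 2 (-(P.coroot' (j : ι) (P.root i))) (by
    have h2 : P.root (i : ι) + P.root i - P.coroot' (j : ι) (P.root i) • P.root j = 0 := by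
      rw [add_sub_assoc, ← e]; simp
    rw [← h2]; module)).1
  norm_num at this

/-! ### Inversion sets and the deletion argument. -/

section Inversions

variable [Finite ι] (b : P.Base)

/-- The positive roots made negative by a Weyl group element. -/
def inversions (g : P.weylGroup) : Finset ι :=
  (Set.toFinite {k | b.IsPos k ∧ ¬ b.IsPos (P.weylGroupToPerm g k)}).toFinset

theorem mem_inversions (g : P.weylGroup) (k : ι) :
    k ∈ inversions b g ↔ b.IsPos k ∧ ¬ b.IsPos (P.weylGroupToPerm g k) :=
  Set.Finite.mem_toFinset _

variable [P.IsRootSystem] [P.IsCrystallographic] [P.IsReduced]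

open Classical in
-- A simple reflection permutes the positive roots other than its own. Right multiplication by it
-- can therefore change the inversion count only through that one root.
theorem card_inversions_erase (g : P.weylGroup) (y : b.support) :
    ((inversions b (g * weylGroup.ofIdx P y)).erase y).card =
      ((inversions b g).erase y).card := by
  have hy (k : ι) (hk : k ≠ y) (hp : b.IsPos k) : P.reflectionPerm (y : ι) k ≠ y := by
    intro e
    have h1 := hp.reflectionPerm y.2 hk
    have h2 : P.reflectionPerm (y : ι) y = k := by
      rw [← e]
      nth_rewrite 1 [e]
      simp
    rw [← h2] at hp
    exact (Base.IsPos.neg_iff_not b (y : ι)).mp hp (Base.isPos_of_mem_support y.2)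
  refine Finset.card_nbij' (P.reflectionPerm (y : ι)) (P.reflectionPerm (y : ι)) ?_ ?_ ?_ ?_
  · intro k hk
    simp only [Finset.coe_erase, Set.mem_sdiff, Finset.mem_coe, mem_inversions,
      Set.mem_singleton_iff, map_mul, Equiv.Perm.mul_apply, weylGroupToPerm_ofIdx] at hk ⊢
    obtain ⟨⟨h1, h2⟩, h3⟩ := hk
    exact ⟨⟨h1.reflectionPerm y.2 h3, h2⟩, hy k h3 h1⟩
  · intro k hk
    simp only [Finset.coe_erase, Set.mem_sdiff, Finset.mem_coe, mem_inversions,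
      Set.mem_singleton_iff, map_mul, Equiv.Perm.mul_apply, weylGroupToPerm_ofIdx] at hk ⊢
    obtain ⟨⟨h1, h2⟩, h3⟩ := hk
    exact ⟨⟨h1.reflectionPerm y.2 h3, by simpa using h2⟩, hy k h3 h1⟩
  · intro k _; simp
  · intro k _; simp

theorem card_inversions_mul (g : P.weylGroup) (y : b.support) :
    (b.IsPos (P.weylGroupToPerm g y) →
      (inversions b (g * weylGroup.ofIdx P y)).card = (inversions b g).card + 1) ∧
    (inversions b (g * weylGroup.ofIdx P y)).card ≤ (inversions b g).card + 1 := by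
  classical
  have h := card_inversions_erase b g y
  have hp := Base.isPos_of_mem_support y.2
  have e : (y : ι) ∈ inversions b (g * weylGroup.ofIdx P y) ↔
      b.IsPos (P.weylGroupToPerm g y) := by
    rw [mem_inversions, and_iff_right hp, map_mul, Equiv.Perm.mul_apply, weylGroupToPerm_ofIdx,
      isPos_weylGroupToPerm_neg, not_not]
  have e' : (y : ι) ∈ inversions b g ↔ ¬ b.IsPos (P.weylGroupToPerm g y) := by
    rw [mem_inversions, and_iff_right hp]
  by_cases hg : b.IsPos (P.weylGroupToPerm g y)
  · have h1 := Finset.card_erase_add_one (e.mpr hg)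
    rw [Finset.erase_eq_of_notMem (s := inversions b g) (by simpa [e'] using hg)] at h
    exact ⟨fun _ => by omega, by omega⟩
  · have h1 := Finset.card_erase_add_one (e'.mpr hg)
    rw [Finset.erase_eq_of_notMem (by simpa [e] using hg)] at h
    exact ⟨fun h => absurd h hg, by omega⟩

theorem card_inversions_wordProd_le (u : List b.support) :
    (inversions b (wordProd (fun i : b.support => weylGroup.ofIdx P i) u)).card ≤ u.length := by
  induction u using List.reverseRecOn with
  | nil =>
    rw [wordProd_nil, List.length_nil, Nat.le_zero, Finset.card_eq_zero,
      Finset.eq_empty_iff_forall_notMem]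
    intro k hk
    rw [mem_inversions, map_one] at hk
    exact hk.2 hk.1
  | append_singleton u y ih =>
    have := (card_inversions_mul b (wordProd (fun i : b.support => weylGroup.ofIdx P i) u) y).2
    simp only [wordProd_append, wordProd_cons, wordProd_nil, mul_one, List.length_append,
      List.length_singleton]
    omega

/-- Apply the letters of A to α_y from right to left. At the letter x where the root first turns
negative it must equal α_x, and conjugation turns this into x·D = D·y. -/
theorem exists_conj_of_not_isPos (B : P.InvariantForm) (y : b.support) (A : List b.support)
    (h : ¬ b.IsPos (P.weylGroupToPerm
      (wordProd (fun i : b.support => weylGroup.ofIdx P i) A) y)) :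
    ∃ (A' : List b.support) (x : b.support) (D : List b.support), A = A' ++ x :: D ∧
      weylGroup.ofIdx P x * wordProd (fun i : b.support => weylGroup.ofIdx P i) D =
        wordProd (fun i : b.support => weylGroup.ofIdx P i) D * weylGroup.ofIdx P y := by
  induction A with
  | nil => exact absurd (Base.isPos_of_mem_support y.2) (by simpa using h)
  | cons x D ih =>
    by_cases hD : b.IsPos (P.weylGroupToPerm
        (wordProd (fun i : b.support => weylGroup.ofIdx P i) D) y)
    · refine ⟨[], x, D, rfl, ofIdx_eq_conj B ?_⟩
      by_contra hne
      refine h ?_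
      rw [wordProd_cons, map_mul, Equiv.Perm.mul_apply, weylGroupToPerm_ofIdx]
      exact hD.reflectionPerm x.2 hne
    · obtain ⟨A', x', D', rfl, e⟩ := ih hD
      exact ⟨x :: A', x', D', rfl, e⟩

/-- If every letter met a positive root, each would add one inversion and the count would equal the
length. -/
theorem exists_not_isPos (u : List b.support)
    (h : (inversions b (wordProd (fun i : b.support => weylGroup.ofIdx P i) u)).card <
      u.length) :
    ∃ (A : List b.support) (y : b.support) (C : List b.support), u = A ++ y :: C ∧
      ¬ b.IsPos (P.weylGroupToPerm
        (wordProd (fun i : b.support => weylGroup.ofIdx P i) A) y) := by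
  induction u using List.reverseRecOn with
  | nil => simp at h
  | append_singleton u y ih =>
    by_cases hy : b.IsPos (P.weylGroupToPerm
        (wordProd (fun i : b.support => weylGroup.ofIdx P i) u) y)
    · have := (card_inversions_mul b (wordProd (fun i : b.support => weylGroup.ofIdx P i) u) y).1 hy
      simp only [wordProd_append, wordProd_cons, wordProd_nil, mul_one, List.length_append,
        List.length_singleton] at h
      obtain ⟨A, z, C, rfl, hz⟩ := ih (by omega)
      exact ⟨A, z, C ++ [y], by simp, hz⟩
    · exact ⟨u, y, [], rfl, hy⟩

theorem deletionProperty (B : P.InvariantForm) :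
    DeletionProperty (fun i : b.support => weylGroup.ofIdx P i) := by
  intro u w h hl
  have hw := card_inversions_wordProd_le b w
  rw [← h] at hw
  obtain ⟨A, y, C, rfl, hy⟩ := exists_not_isPos b u (by omega)
  obtain ⟨A', x, D, rfl, e⟩ := exists_conj_of_not_isPos b B y A hy
  exact ⟨A', x, D, y, C, by simp, e⟩

theorem closure_ofIdx_simple (B : P.InvariantForm) :
    Subgroup.closure (Set.range fun i : b.support => weylGroup.ofIdx P i) = ⊤ := by
  have hmem (k : ι) : weylGroup.ofIdx P k ∈
      Subgroup.closure (Set.range fun i : b.support => weylGroup.ofIdx P i) := by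
    have hconj {g : P.weylGroup} {k m : ι}
        (hg : g ∈ Subgroup.closure (Set.range fun i : b.support => weylGroup.ofIdx P i))
        (hk : weylGroup.ofIdx P k ∈
          Subgroup.closure (Set.range fun i : b.support => weylGroup.ofIdx P i))
        (e : P.weylGroupToPerm g k = m) : weylGroup.ofIdx P m ∈
          Subgroup.closure (Set.range fun i : b.support => weylGroup.ofIdx P i) := by
      have := ofIdx_eq_conj B e
      rw [← eq_mul_inv_iff_mul_eq] at this
      rw [this]
      exact mul_mem (mul_mem hg hk) (inv_mem hg)
    refine b.induction_reflect k (fun k hk => hconj hk hk (weylGroupToPerm_ofIdx k k))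
      (fun k hk => Subgroup.subset_closure ⟨⟨k, hk⟩, rfl⟩) (fun k j hk hj =>
        hconj (Subgroup.subset_closure ⟨⟨j, hj⟩, rfl⟩) hk (weylGroupToPerm_ofIdx j k))
  rw [eq_top_iff]
  rintro ⟨g, hg⟩ -
  induction hg using weylGroup.induction with
  | mem k => exact hmem k
  | one => exact one_mem _
  | mul x y hx hy h1 h2 => exact mul_mem h1 h2

end Inversions

/-! ### Arithmetic of the sublattice `Λ'` -/

theorem rootMult_dvd (B : P.InvariantForm) (n : ℕ) (k : ι) : rootMult B n k ∣ n :=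
  Nat.div_dvd_of_dvd (Nat.gcd_dvd_left _ _)

theorem rootMult_pos (B : P.InvariantForm) (n : ℕ) [NeZero n] (k : ι) : 0 < rootMult B n k :=
  Nat.pos_of_ne_zero fun h => NeZero.ne n (Nat.eq_zero_of_zero_dvd (h ▸ rootMult_dvd B n k))

theorem dvd_normSq_mul_iff (B : P.InvariantForm) (n : ℕ) [NeZero n] (k : ι) (t : ℤ) :
    (n : ℤ) ∣ (normSq B k : ℤ) * t ↔ (rootMult B n k : ℤ) ∣ t := by
  have hg : 0 < Nat.gcd n (normSq B k) := Nat.gcd_pos_of_pos_left _ (NeZero.pos n)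
  have h1 : n = Nat.gcd n (normSq B k) * rootMult B n k :=
    (Nat.mul_div_cancel' (Nat.gcd_dvd_left _ _)).symm
  have h2 : normSq B k = Nat.gcd n (normSq B k) * (normSq B k / Nat.gcd n (normSq B k)) :=
    (Nat.mul_div_cancel' (Nat.gcd_dvd_right _ _)).symm
  have hc : IsCoprime (rootMult B n k : ℤ) ((normSq B k / Nat.gcd n (normSq B k) : ℕ) : ℤ) :=
    Nat.isCoprime_iff_coprime.mpr (Nat.coprime_div_gcd_div_gcd hg)
  have hg' : ((Nat.gcd n (normSq B k) : ℕ) : ℤ) ≠ 0 := by exact_mod_cast hg.ne'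
  conv_lhs => rw [h2]
  nth_rewrite 1 [h1]
  push_cast
  rw [mul_assoc, mul_dvd_mul_iff_left hg']
  exact ⟨fun h => hc.dvd_of_dvd_mul_left h, fun h => h.mul_left _⟩

theorem zsmul_root_mem_subLattice (B : P.InvariantForm) (n : ℕ) (k : ι) :
    (rootMult B n k : ℤ) • P.rootSpanMem ℤ k ∈ subLattice P B n :=
  Submodule.subset_span ⟨k, rfl⟩

/-- Every m(α) divides n. This makes Λ/Λ' a torsion group, which is what allows denominators to be
moved into degree zero. -/
theorem zsmul_mem_subLattice (b : P.Base) (B : P.InvariantForm) (n : ℕ) (β : Lattice P) :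
    (n : ℤ) • β ∈ subLattice P B n := by
  rw [← b.toWeightBasisInt.sum_repr β, Finset.smul_sum]
  refine Submodule.sum_mem _ fun i _ => ?_
  rw [smul_comm]
  refine Submodule.smul_mem _ _ ?_
  have h : b.toWeightBasisInt i = P.rootSpanMem ℤ (i : ι) := Subtype.ext (by simp)
  obtain ⟨c, hc⟩ := rootMult_dvd B n (i : ι)
  have e : (n : ℤ) = (c : ℤ) * rootMult B n (i : ι) := by rw [mul_comm]; exact_mod_cast hc
  rw [h, (congrArg (· • P.rootSpanMem ℤ (i : ι)) e).trans (mul_smul _ _ _)]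
  exact Submodule.smul_mem _ _ (zsmul_root_mem_subLattice B n i)

theorem rootMult_reflectionPerm (B : P.InvariantForm) (n : ℕ) (j k : ι) :
    rootMult B n (P.reflectionPerm j k) = rootMult B n k := by
  rw [rootMult, rootMult, normSq, normSq, P.root_reflectionPerm, B.apply_reflection_reflection]

section Crystallographic

variable [P.IsCrystallographic]

theorem latticeReflection_rootSpanMem (j k : ι) :
    latticeReflection j (P.rootSpanMem ℤ k) = P.rootSpanMem ℤ (P.reflectionPerm j k) := by
  apply Subtype.ext
  rw [coe_latticeReflection, weylGroup.ofIdx_smul, Equiv.reflection_smul]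
  exact (P.root_reflectionPerm j k).symm

theorem latticeReflection_mem_subLattice (B : P.InvariantForm) (n : ℕ) (j : ι) {x : Lattice P}
    (hx : x ∈ subLattice P B n) : latticeReflection j x ∈ subLattice P B n := by
  induction hx using Submodule.span_induction with
  | mem x hx =>
    obtain ⟨k, rfl⟩ := hx
    simp only [map_smul, latticeReflection_rootSpanMem]
    rw [← rootMult_reflectionPerm B n j k]
    exact zsmul_root_mem_subLattice B n _
  | zero => simp
  | add x y _ _ hx hy => rw [map_add]; exact add_mem hx hy
  | smul a x _ hx => rw [map_smul]; exact Submodule.smul_mem _ _ hx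

variable [Finite ι] [P.IsReduced] [P.IsIrreducible]

theorem pairingIn_mul_normSq {B : P.InvariantForm} (hB : IsNormalizedInnerProduct B) (j k : ι) :
    P.pairingIn ℤ j k * normSq B k = P.pairingIn ℤ k j * normSq B j := by
  have h := pairingIn_mul_form B j k
  rw [← normSq_cast B hB, ← normSq_cast B hB] at h
  exact_mod_cast h

/-- By symmetry of the form, ⟨α_j, α_k^∨⟩‖α_k‖² = ⟨α_k, α_j^∨⟩‖α_j‖², and n divides m(α_j)‖α_j‖².
Hence κ_k modulo m(α_k) depends only on the class modulo Λ'. -/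
theorem rootMult_dvd_coroot'In {B : P.InvariantForm} (hB : IsNormalizedInnerProduct B) {n : ℕ}
    [NeZero n] (k : ι) {x : Lattice P} (hx : x ∈ subLattice P B n) :
    (rootMult B n k : ℤ) ∣ P.coroot'In ℤ k x := by
  induction hx using Submodule.span_induction with
  | mem x hx =>
    obtain ⟨j, rfl⟩ := hx
    rw [← dvd_normSq_mul_iff]
    simp only [map_smul, P.coroot'In_rootSpanMem_eq_pairingIn, smul_eq_mul]
    have h : (n : ℤ) ∣ (normSq B j : ℤ) * rootMult B n j :=
      (dvd_normSq_mul_iff B n j _).mpr dvd_rfl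
    have e := pairingIn_mul_normSq hB j k
    obtain ⟨c, hc⟩ := h
    exact ⟨c * P.pairingIn ℤ k j, by linear_combination rootMult B n j * e + P.pairingIn ℤ k j * hc⟩
  | zero => simp
  | add x y _ _ hx hy => rw [map_add]; exact dvd_add hx hy
  | smul a x _ hx => rw [map_smul]; exact hx.mul_left _

end Crystallographic

/-! ### The grading of the fraction field -/

section Grading

variable [Finite ι]

theorem div_mem_piece {B : P.InvariantForm} {n : ℕ} {c : Lattice P ⧸ subLattice P B n}
    {f g : Laurent P} (hg0 : g ≠ 0) (hg : g ∈ AddMonoidAlgebra.gradeBy ℂ (classOf B n) 0)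
    (hf : f ∈ AddMonoidAlgebra.gradeBy ℂ (classOf B n) c) :
    algebraMap (Laurent P) (RatFun P) f / algebraMap (Laurent P) (RatFun P) g ∈ piece B n c :=
  ⟨f, g, hg0, hg, hf, rfl⟩

theorem mul_mem_piece {B : P.InvariantForm} {n : ℕ} {c d : Lattice P ⧸ subLattice P B n}
    {F G : RatFun P} (hF : F ∈ piece B n c) (hG : G ∈ piece B n d) :
    F * G ∈ piece B n (c + d) := by
  obtain ⟨f, g, hg0, hg, hf, rfl⟩ := hF
  obtain ⟨f', g', hg0', hg', hf', rfl⟩ := hG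
  rw [div_mul_div_comm, ← map_mul, ← map_mul]
  refine div_mem_piece (mul_ne_zero hg0 hg0') ?_ (SetLike.GradedMul.mul_mem hf hf')
  have := SetLike.GradedMul.mul_mem (A := AddMonoidAlgebra.gradeBy ℂ (classOf B n))
    (i := 0) (j := 0) hg hg'
  rwa [add_zero] at this

theorem algebraMap_mem_piece {B : P.InvariantForm} {n : ℕ} {c : Lattice P ⧸ subLattice P B n}
    {f : Laurent P} (hf : f ∈ AddMonoidAlgebra.gradeBy ℂ (classOf B n) c) :
    algebraMap (Laurent P) (RatFun P) f ∈ piece B n c := by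
  have := div_mem_piece (one_ne_zero (α := Laurent P))
    (SetLike.GradedOne.one_mem (A := AddMonoidAlgebra.gradeBy ℂ (classOf B n))) hf
  simpa using this

/-- The n-th power of a monomial has degree zero, so A is integral over its degree-zero part, and
every nonzero g divides a nonzero element of that part. -/
theorem exists_mul_mem_gradeBy_zero (b : P.Base) (B : P.InvariantForm) (n : ℕ) [NeZero n]
    {g : Laurent P} (hg : g ≠ 0) :
    ∃ h : Laurent P, g * h ≠ 0 ∧ g * h ∈ AddMonoidAlgebra.gradeBy ℂ (classOf B n) 0 := by
  let R := SetLike.GradeZero.subring (AddMonoidAlgebra.gradeBy ℂ (classOf B n))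
  have hint (g : Laurent P) : IsIntegral R g := by
    induction g using AddMonoidAlgebra.induction_linear with
    | zero => exact isIntegral_zero
    | add f g hf hg => exact hf.add hg
    | single β a =>
      refine IsIntegral.of_pow (NeZero.pos n) ?_
      rw [AddMonoidAlgebra.single_pow]
      have hmem : AddMonoidAlgebra.single (n • β) (a ^ n) ∈
          AddMonoidAlgebra.gradeBy ℂ (classOf B n) 0 := by
        have h0 : classOf B n (n • β) = 0 := by
          have := zsmul_mem_subLattice b B n β
          rw [natCast_zsmul] at this
          exact (Submodule.Quotient.mk_eq_zero _).mpr this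
        rw [← h0]
        exact AddMonoidAlgebra.single_mem_gradeBy _ _ _
      exact isIntegral_algebraMap (R := R) (x := ⟨_, hmem⟩)
  obtain ⟨r, hr0, s, hs⟩ := (hint g).isAlgebraic.exists_nonzero_dvd
      (mem_nonZeroDivisors_of_ne_zero hg)
  have e : (algebraMap R (Laurent P)) r = r := rfl
  rw [e] at hs
  refine ⟨s, ?_, ?_⟩
  · rw [← hs]; exact fun h => hr0 (Subtype.ext h)
  · rw [← hs]; exact r.2

theorem iSup_piece (b : P.Base) (B : P.InvariantForm) (n : ℕ) [NeZero n] :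
    ⨆ c, piece B n c = ⊤ := by
  rw [eq_top_iff]
  rintro F -
  obtain ⟨f, g, hg, rfl⟩ := IsFractionRing.div_surjective (A := Laurent P) F
  obtain ⟨h, h1, h2⟩ := exists_mul_mem_gradeBy_zero b B n (nonZeroDivisors.ne_zero hg)
  have hh : algebraMap (Laurent P) (RatFun P) h ≠ 0 := by
    rw [map_ne_zero_iff _ (IsFractionRing.injective (Laurent P) (RatFun P))]
    exact right_ne_zero_of_mul h1
  rw [← mul_div_mul_right _ _ hh, ← map_mul, ← map_mul]
  induction f * h using AddMonoidAlgebra.induction_linear with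
  | zero => simp
  | add f g hf hg => rw [map_add, add_div]; exact add_mem hf hg
  | single β a =>
    exact Submodule.mem_iSup_of_mem (classOf B n β)
      (div_mem_piece h1 h2 (AddMonoidAlgebra.single_mem_gradeBy _ _ _))

/-- Degree-zero denominators can be cleared without changing classes, which reduces independence to
that of the grading on A. -/
theorem iSupIndep_piece (B : P.InvariantForm) (n : ℕ) : iSupIndep (piece B n) := by
  intro c
  have inj := IsFractionRing.injective (Laurent P) (RatFun P)
  have hmul {f g : Laurent P}
      (hf : f ∈ ⨆ j, ⨆ _ : j ≠ c, AddMonoidAlgebra.gradeBy ℂ (classOf B n) j)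
      (hg : g ∈ AddMonoidAlgebra.gradeBy ℂ (classOf B n) 0) :
      f * g ∈ ⨆ j, ⨆ _ : j ≠ c, AddMonoidAlgebra.gradeBy ℂ (classOf B n) j := by
    rw [iSup_subtype'] at hf ⊢
    induction hf using Submodule.iSup_induction' with
    | mem j x hx =>
      refine Submodule.mem_iSup_of_mem j ?_
      have := SetLike.GradedMul.mul_mem hx hg
      rwa [add_zero] at this
    | zero => simp
    | add x y _ _ hx hy => rw [add_mul]; exact add_mem hx hy
  have hform {F : RatFun P} (hF : F ∈ ⨆ j, ⨆ _ : j ≠ c, piece B n j) : ∃ f g : Laurent P, g ≠ 0 ∧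
      g ∈ AddMonoidAlgebra.gradeBy ℂ (classOf B n) 0 ∧
      f ∈ (⨆ j, ⨆ _ : j ≠ c, AddMonoidAlgebra.gradeBy ℂ (classOf B n) j) ∧
      F = algebraMap (Laurent P) (RatFun P) f / algebraMap (Laurent P) (RatFun P) g := by
    rw [iSup_subtype'] at hF
    induction hF using Submodule.iSup_induction' with
    | mem j x hx =>
      obtain ⟨f, g, hg0, hg, hf, rfl⟩ := hx
      exact ⟨f, g, hg0, hg, Submodule.mem_iSup_of_mem j.1 (Submodule.mem_iSup_of_mem j.2 hf), rfl⟩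
    | zero => exact ⟨0, 1, one_ne_zero,
        SetLike.GradedOne.one_mem (A := AddMonoidAlgebra.gradeBy ℂ (classOf B n)), by simp, by simp⟩
    | add x y _ _ hx hy =>
      obtain ⟨f, g, hg0, hg, hf, rfl⟩ := hx
      obtain ⟨f', g', hg0', hg', hf', rfl⟩ := hy
      refine ⟨f * g' + f' * g, g * g', mul_ne_zero hg0 hg0', ?_,
        add_mem (hmul hf hg') (hmul hf' hg), ?_⟩
      · have := SetLike.GradedMul.mul_mem (A := AddMonoidAlgebra.gradeBy ℂ (classOf B n))
          (i := 0) (j := 0) hg hg'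
        rwa [add_zero] at this
      · rw [div_add_div _ _ ((map_ne_zero_iff _ inj).mpr hg0) ((map_ne_zero_iff _ inj).mpr hg0')]
        simp only [map_add, map_mul]
        ring
  rw [Submodule.disjoint_def]
  rintro F ⟨f, g, hg0, hg, hf, rfl⟩ hF
  obtain ⟨f', g', hg0', hg', hf', e⟩ := hform hF
  rw [div_eq_div_iff ((map_ne_zero_iff _ inj).mpr hg0) ((map_ne_zero_iff _ inj).mpr hg0'),
    ← map_mul, ← map_mul] at e
  replace e := inj e
  have h1 : f * g' ∈ AddMonoidAlgebra.gradeBy ℂ (classOf B n) c := by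
    have := SetLike.GradedMul.mul_mem (A := AddMonoidAlgebra.gradeBy ℂ (classOf B n)) (j := 0)
      hf hg'
    rwa [add_zero] at this
  have hind := (AddMonoidAlgebra.gradeBy.isInternal (R := ℂ) (classOf B n)).submodule_iSupIndep c
  have h0 := Submodule.disjoint_def.mp hind _ h1 (e ▸ hmul hf' hg)
  rw [(mul_eq_zero.mp h0).resolve_right hg0']
  simp

theorem isInternal_piece (b : P.Base) (B : P.InvariantForm) (n : ℕ) [NeZero n] :
    DirectSum.IsInternal (piece B n) :=
  DirectSum.isInternal_submodule_of_iSupIndep_of_iSup_eq_top (iSupIndep_piece B n)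
    (iSup_piece b B n)

end Grading

/-! ### Normalised monomials and the field of degree zero -/

section Monomials

variable [Finite ι] (b : P.Base) (q : ℕ)

/-- The monomial `(qx)^β = q^{d(β)} x^β`. -/
def mon (β : Lattice P) : RatFun P :=
  algebraMap (Laurent P) (RatFun P) (AddMonoidAlgebra.single β ((q : ℂ) ^ height b β))

theorem mon_zero : mon b q 0 = 1 := by
  rw [mon, map_zero, zpow_zero, ← AddMonoidAlgebra.one_def, map_one]

variable [NeZero q]

theorem mon_add (β γ : Lattice P) : mon b q (β + γ) = mon b q β * mon b q γ := by
  have hq : (q : ℂ) ≠ 0 := NeZero.ne _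
  rw [mon, mon, mon, ← map_mul, AddMonoidAlgebra.single_mul_single, map_add, zpow_add₀ hq]

theorem mon_ne_zero (β : Lattice P) : mon b q β ≠ 0 := by
  intro h
  have := mon_add b q β (-β)
  rw [add_neg_cancel, mon_zero, h, zero_mul] at this
  exact one_ne_zero this

theorem mon_neg (β : Lattice P) : mon b q (-β) = (mon b q β)⁻¹ := by
  refine eq_inv_of_mul_eq_one_left ?_
  rw [← mon_add, neg_add_cancel, mon_zero]

theorem mon_zsmul (k : ℤ) (β : Lattice P) : mon b q (k • β) = mon b q β ^ k := by
  induction k using Int.induction_on with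
  | zero => rw [zero_smul, mon_zero, zpow_zero]
  | succ k ih =>
    rw [add_smul, one_smul, mon_add, ih, zpow_add₀ (mon_ne_zero b q β), zpow_one]
  | pred k ih =>
    rw [sub_smul, one_smul, sub_eq_add_neg, mon_add, mon_neg, ih,
      zpow_sub₀ (mon_ne_zero b q β), zpow_one, div_eq_mul_inv]

omit [NeZero q] in
theorem natCast_mul_simpleVar (i : b.support) :
    (q : RatFun P) * simpleVar b i = mon b q (P.rootSpanMem ℤ (i : ι)) := by
  rw [simpleVar, mon, height_simple, zpow_one,
    ← map_natCast (algebraMap (Laurent P) (RatFun P)) q, ← map_mul]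
  congr 1
  rw [← map_natCast (algebraMap ℂ (Laurent P)) q, ← Algebra.smul_def,
    AddMonoidAlgebra.smul_single, smul_eq_mul, mul_one]

theorem eq_zero_of_mon_eq {β : Lattice P} {a : ℂ}
    (h : mon b q β = algebraMap ℂ (RatFun P) a) : β = 0 := by
  have hq : (q : ℂ) ≠ 0 := NeZero.ne _
  rw [mon, IsScalarTower.algebraMap_apply ℂ (Laurent P) (RatFun P)] at h
  replace h := IsFractionRing.injective (Laurent P) (RatFun P) h
  by_contra hβ
  have h' := congrArg (fun f : Laurent P => f.coeff β) h
  rw [Algebra.algebraMap_eq_smul_one, AddMonoidAlgebra.one_def, AddMonoidAlgebra.smul_single] at h'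
  simp [AddMonoidAlgebra.coeff_single, hq, Ne.symm hβ, zpow_ne_zero] at h'

/-- This is the purpose of the normalisation: the factor q^{d(β)} absorbs the powers of q in the
substitution. -/
theorem changeVar_mon [P.IsCrystallographic] (j : b.support) (β : Lattice P) :
    changeVar b q j (mon b q β) = mon b q (latticeReflection (j : ι) β) := by
  have hq : (q : ℂ) ≠ 0 := NeZero.ne _
  rw [mon, mon, changeVar, IsFractionRing.ringEquivOfRingEquiv_algebraMap]
  refine congrArg (algebraMap (Laurent P) (RatFun P)) ((substHom_single b q j _ _).trans ?_)
  rw [← zpow_add₀ hq, ← map_add, add_sub_cancel]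

end Monomials

/-! ### The field of degree zero and its action on the graded pieces. -/

section BaseField

variable [Finite ι]

/-- The subfield `Ã₀` of quotients of Laurent polynomials supported on `Λ'`. -/
def baseField (B : P.InvariantForm) (n : ℕ) : Subfield (RatFun P) where
  carrier := piece B n 0
  zero_mem' := zero_mem _
  add_mem' := add_mem
  neg_mem' := neg_mem
  one_mem' := by
    have := algebraMap_mem_piece
      (SetLike.GradedOne.one_mem (A := AddMonoidAlgebra.gradeBy ℂ (classOf (P := P) B n)))
    rwa [map_one] at this
  mul_mem' := fun hF hG => by simpa using mul_mem_piece hF hG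
  inv_mem' := by
    rintro _ ⟨f, g, hg0, hg, hf, rfl⟩
    by_cases hf0 : f = 0
    · simp [hf0]
    · rw [inv_div]
      exact div_mem_piece hf0 hf hg

theorem mem_baseField {B : P.InvariantForm} {n : ℕ} {F : RatFun P} :
    F ∈ baseField B n ↔ F ∈ piece B n 0 := Iff.rfl

theorem algebraMap_complex_mem_baseField (B : P.InvariantForm) (n : ℕ) (a : ℂ) :
    algebraMap ℂ (RatFun P) a ∈ baseField B n := by
  rw [Algebra.algebraMap_eq_smul_one]
  exact (piece B n 0).smul_mem a (baseField B n).one_mem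

variable (b : P.Base) (q : ℕ)

theorem mon_mem_piece (B : P.InvariantForm) (n : ℕ) (β : Lattice P) :
    mon b q β ∈ piece B n (classOf B n β) :=
  algebraMap_mem_piece (AddMonoidAlgebra.single_mem_gradeBy _ _ _)

theorem classOf_eq_zero_iff {B : P.InvariantForm} {n : ℕ} {β : Lattice P} :
    classOf B n β = 0 ↔ β ∈ subLattice P B n := Submodule.Quotient.mk_eq_zero _

theorem mon_mem_baseField {B : P.InvariantForm} {n : ℕ} {β : Lattice P}
    (hβ : β ∈ subLattice P B n) : mon b q β ∈ baseField B n := by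
  rw [mem_baseField, ← classOf_eq_zero_iff.mpr hβ]
  exact mon_mem_piece b q B n β

variable [NeZero q]

theorem exists_eq_mul_mon {B : P.InvariantForm} {n : ℕ} {β : Lattice P} {F : RatFun P}
    (hF : F ∈ piece B n (classOf B n β)) : ∃ c : baseField B n, F = c * mon b q β := by
  refine ⟨⟨F * mon b q (-β), ?_⟩, ?_⟩
  · rw [mem_baseField]
    have := mul_mem_piece hF (mon_mem_piece b q B n (-β))
    rwa [map_neg, add_neg_cancel] at this
  · rw [mul_assoc, ← mon_add, neg_add_cancel, mon_zero, mul_one]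

theorem mul_mon_mem_piece {B : P.InvariantForm} {n : ℕ} (c : baseField B n) (β : Lattice P) :
    c * mon b q β ∈ piece B n (classOf B n β) := by
  simpa using mul_mem_piece c.2 (mon_mem_piece b q B n β)

/-- An additive statement on the fraction field can be checked on multiples of monomials. -/
theorem induction_mon (B : P.InvariantForm) (n : ℕ) [NeZero n] {p : RatFun P → Prop}
    (h0 : p 0) (hadd : ∀ F G, p F → p G → p (F + G))
    (hmon : ∀ (c : baseField B n) β, p (c * mon b q β)) (F : RatFun P) : p F := by
  have hF : F ∈ ⨆ c, piece B n c := by rw [iSup_piece b B n]; trivial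
  induction hF using Submodule.iSup_induction' with
  | mem c F hF =>
    obtain ⟨β, rfl⟩ : ∃ β, classOf B n β = c := Submodule.Quotient.mk_surjective _ c
    obtain ⟨a, rfl⟩ := exists_eq_mul_mon b q hF
    exact hmon a β
  | zero => exact h0
  | add F G _ _ hF hG => exact hadd F G hF hG

variable [P.IsCrystallographic]

theorem substHom_mem_gradeBy_zero (B : P.InvariantForm) (n : ℕ) (j : b.support) {f : Laurent P}
    (hf : f ∈ AddMonoidAlgebra.gradeBy ℂ (classOf B n) 0) :
    substHom b q j f ∈ AddMonoidAlgebra.gradeBy ℂ (classOf B n) 0 := by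
  have e : f = ∑ β ∈ f.coeff.support, AddMonoidAlgebra.single β (f.coeff β) := by
    conv_lhs => rw [← AddMonoidAlgebra.sum_coeff_single f]
    rfl
  rw [e, map_sum]
  refine Submodule.sum_mem _ fun β hβ => ?_
  rw [substHom_single]
  have h := classOf_eq_zero_iff.mpr
    (latticeReflection_mem_subLattice B n (j : ι) (classOf_eq_zero_iff.mp (hf β hβ)))
  rw [← h]
  exact AddMonoidAlgebra.single_mem_gradeBy _ _ _

theorem changeVar_mem_baseField (B : P.InvariantForm) (n : ℕ) (j : b.support) {F : RatFun P}
    (hF : F ∈ baseField B n) : changeVar b q j F ∈ baseField B n := by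
  obtain ⟨f, g, hg0, hg, hf, rfl⟩ := hF
  rw [map_div₀, changeVar, IsFractionRing.ringEquivOfRingEquiv_algebraMap,
    IsFractionRing.ringEquivOfRingEquiv_algebraMap]
  refine div_mem_piece ?_ (substHom_mem_gradeBy_zero b q B n j hg)
    (substHom_mem_gradeBy_zero b q B n j hf)
  exact (map_ne_zero_iff _ (substEquiv b q j).injective).mpr hg0

/-- The change of variables on the field of degree zero. -/
def baseHom (B : P.InvariantForm) (n : ℕ) (j : b.support) : baseField B n →+* baseField B n :=
  ((changeVar b q j : RatFun P →+* RatFun P).comp (baseField B n).subtype).codRestrict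
    (baseField B n) fun c => changeVar_mem_baseField b q B n j c.2

theorem coe_baseHom (B : P.InvariantForm) (n : ℕ) (j : b.support) (c : baseField B n) :
    (baseHom b q B n j c : RatFun P) = changeVar b q j c := rfl

end BaseField

/-! ### The twisted operators -/

section Operator

variable [Finite ι] [P.IsCrystallographic] (b : P.Base) (B : P.InvariantForm)
  (l : b.support → ℕ) (n q : ℕ) (γ : ZMod n → ℂ)

theorem kappa_simpleDot (i : b.support) (β : Lattice P) :
    kappa b l i (simpleDot b l i β) = -kappa b l i β := by
  rw [simpleDot_eq]
  exact (reflectionPair_dot b l i i).κ₁_reflection₁ β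

/-- The rational function by which `f(σ_i x)` is multiplied. -/
def twistFactor (i : b.support) (β : Lattice P) : RatFun P :=
  ratP b B l n q β i (simpleVar b i) + ratQ b B l n q γ (simpleDot b l i β) i (simpleVar b i)

variable [NeZero n]

theorem gauss_congr (k : ι) {s t : ℤ} (h : (rootMult B n k : ℤ) ∣ s - t) :
    γ ((-((normSq B k : ℤ) * s) : ℤ) : ZMod n) = γ ((-((normSq B k : ℤ) * t) : ℤ) : ZMod n) := by
  congr 1
  rw [ZMod.intCast_eq_intCast_iff_dvd_sub]
  have := (dvd_normSq_mul_iff B n k _).mpr h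
  convert this using 1
  ring

variable {B} [P.IsReduced] [P.IsIrreducible] (hB : IsNormalizedInnerProduct B)

include hB

theorem rootMult_dvd_kappa_sub (i : b.support) {β β' : Lattice P}
    (h : classOf B n β = classOf B n β') :
    (rootMult B n i : ℤ) ∣ kappa b l i β - kappa b l i β' := by
  have h1 : β - β' ∈ subLattice P B n := by
    rw [← classOf_eq_zero_iff, map_sub, h, sub_self]
  have h2 := rootMult_dvd_coroot'In hB (i : ι) h1
  rw [map_sub] at h2
  rw [kappa, kappa]
  convert h2 using 1
  ring

/-- Within a class, κ changes by multiples of m(α_i), which alter neither the remainder in 𝒫 nor the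
argument of γ in 𝒬. Hence the operator can be defined with any representative. -/
theorem twistFactor_congr (i : b.support) {β β' : Lattice P}
    (h : classOf B n β = classOf B n β') :
    twistFactor b B l n q γ i β = twistFactor b B l n q γ i β' := by
  have hd := rootMult_dvd_kappa_sub b l n hB i h
  have h1 : -kappa b l i β % (rootMult B n i : ℤ) = -kappa b l i β' % (rootMult B n i : ℤ) := by
    refine Int.modEq_iff_dvd.mpr ?_
    convert hd using 1
    ring
  have h2 := gauss_congr B n γ (i : ι) hd
  rw [twistFactor, twistFactor, ratP, ratP, ratQ, ratQ]
  have e0 (κ : ℤ) : -(normSq B (i : ι) : ℤ) * κ = -((normSq B (i : ι) : ℤ) * κ) := neg_mul _ _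
  simp only [mu_eq_neg_kappa, kappa_simpleDot, neg_neg, h1]
  rw [e0, e0, h2]

variable [NeZero q]

/-- Multiplication by a rational function after a change of variables, as a `ℂ`-linear map. -/
def twistLinear (i : b.support) (F : RatFun P) : RatFun P →ₗ[ℂ] RatFun P where
  toFun f := F * changeVar b q i f
  map_add' f g := by rw [map_add, mul_add]
  map_smul' a f := by
    rw [Algebra.smul_def, map_mul, changeVar_algebraMap, RingHom.id_apply, Algebra.smul_def]
    ring

theorem exists_isTwistedReflection (i : b.support) :
    ∃ T, IsTwistedReflection b B l n q γ i T := by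
  have hint := isInternal_piece b B n
  let φ := LinearEquiv.ofBijective (DirectSum.coeLinearMap (piece B n)) hint
  let ψ : (DirectSum _ fun c => piece B n c) →ₗ[ℂ] RatFun P :=
    DirectSum.toModule ℂ _ _ fun c =>
      (twistLinear b q i (twistFactor b B l n q γ i (Quotient.out c))).comp (piece B n c).subtype
  refine ⟨ψ.comp φ.symm.toLinearMap, fun β f hf => ?_⟩
  have e : φ.symm f = DirectSum.lof ℂ _ (fun c => piece B n c) (classOf B n β) ⟨f, hf⟩ := by
    rw [LinearEquiv.symm_apply_eq]
    exact (DirectSum.coeLinearMap_lof (piece B n) _ (⟨f, hf⟩ : piece B n (classOf B n β))).symm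
  rw [LinearMap.comp_apply, LinearEquiv.coe_coe, e, DirectSum.toModule_lof]
  have h : classOf B n (Quotient.out (classOf B n β)) = classOf B n β := Quotient.out_eq _
  change twistFactor b B l n q γ i _ * changeVar b q i f = _
  rw [twistFactor_congr b l n q γ hB i h]
  rfl

omit [P.IsReduced] [P.IsIrreducible] hB in
theorem IsTwistedReflection.unique {i : b.support} {T T' : Module.End ℂ (RatFun P)}
    (hT : IsTwistedReflection b B l n q γ i T) (hT' : IsTwistedReflection b B l n q γ i T') :
    T = T' := by
  ext F
  refine induction_mon b q B n (p := fun F => T F = T' F) (by simp)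
    (fun F G h1 h2 => by rw [map_add, map_add, h1, h2]) (fun c β => ?_) F
  rw [hT β _ (mul_mon_mem_piece b q c β), hT' β _ (mul_mon_mem_piece b q c β)]

variable {b l n q γ} {i : b.support} {T : Module.End ℂ (RatFun P)}

omit [P.IsReduced] [P.IsIrreducible] hB in
-- Multiplication by degree zero preserves each piece, so the multiplier of the operator stays the
-- same.
theorem IsTwistedReflection.mul_baseField (hT : IsTwistedReflection b B l n q γ i T)
    (c : baseField B n) (F : RatFun P) : T (c * F) = changeVar b q i c * T F := by
  refine induction_mon b q B n (p := fun F => T (c * F) = changeVar b q i c * T F) (by simp)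
    (fun F G h1 h2 => by rw [mul_add, map_add, h1, h2, map_add, mul_add]) (fun a β => ?_) F
  rw [hT β _ (mul_mon_mem_piece b q a β), ← mul_assoc]
  have := mul_mon_mem_piece b q (c * a) β
  rw [Subfield.coe_mul] at this
  rw [hT β _ this, map_mul, map_mul, map_mul]
  ring

omit [P.IsReduced] [P.IsIrreducible] hB in
theorem IsTwistedReflection.apply_mon (hT : IsTwistedReflection b B l n q γ i T)
    (β : Lattice P) : T (mon b q β) =
      ((1 - (q : RatFun P)⁻¹) * mon b q ((rootMult B n i : ℤ) • P.rootSpanMem ℤ (i : ι)) ^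
          (-kappa b l i β / (rootMult B n i : ℤ)) * mon b q β +
        algebraMap ℂ (RatFun P) (γ ((-((normSq B i : ℤ) * kappa b l i β) : ℤ) : ZMod n)) *
          (1 - (mon b q ((rootMult B n i : ℤ) • P.rootSpanMem ℤ (i : ι)))⁻¹) *
          mon b q (simpleDot b l i β)) /
      (1 - (q : RatFun P)⁻¹ * mon b q ((rootMult B n i : ℤ) • P.rootSpanMem ℤ (i : ι))) := by
  rw [hT β _ (mon_mem_piece b q B n β), ratP, ratQ, natCast_mul_simpleVar, changeVar_mon]
  have ha : mon b q (P.rootSpanMem ℤ (i : ι)) ≠ 0 := mon_ne_zero b q _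
  have h1 : mon b q (latticeReflection (i : ι) β) =
      mon b q (P.rootSpanMem ℤ (i : ι)) ^ (-(kappa b l i β + (l i + 1))) * mon b q β := by
    rw [← mon_zsmul, ← mon_add]
    congr 1
    rw [latticeReflection_apply, kappa]
    module
  have h2 : mon b q (simpleDot b l i β) =
      mon b q (P.rootSpanMem ℤ (i : ι)) ^ (-kappa b l i β) * mon b q β := by
    rw [← mon_zsmul, ← mon_add]
    congr 1
    rw [simpleDot_eq, affineReflection]
    module
  have e0 (κ : ℤ) : -(normSq B (i : ι) : ℤ) * κ = -((normSq B (i : ι) : ℤ) * κ) := neg_mul _ _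
  rw [h1, h2, mu_eq_neg_kappa, mu_eq_neg_kappa, kappa_simpleDot, neg_neg, mon_zsmul, e0]
  set a := mon b q (P.rootSpanMem ℤ (i : ι))
  set m := rootMult B n i
  set κ := kappa b l i β
  -- The remainder of -κ modulo m is traded for the quotient; this puts the 𝒫-term into the Ã₀-line
  -- of y^β.
  have e1 : (a ^ (m : ℤ)) ^ (-κ / (m : ℤ)) =
      a ^ ((l i : ℤ) + 1 - -κ % (m : ℤ)) * a ^ (-(κ + (l i + 1))) := by
    rw [← zpow_mul, ← zpow_add₀ ha]
    congr 1
    have := Int.emod_add_mul_ediv (-κ) m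
    linarith
  have e2 : a ^ ((l i : ℤ) + 1 - (m : ℤ)) * a ^ (-(κ + (l i + 1))) =
      (a ^ (m : ℤ))⁻¹ * a ^ (-κ) := by
    rw [← zpow_neg, ← zpow_add₀ ha, ← zpow_add₀ ha]
    congr 1
    ring
  have e3 : (1 - (a ^ (m : ℤ))⁻¹) = - (a ^ (m : ℤ))⁻¹ * (1 - a ^ (m : ℤ)) := by
    have : a ^ (m : ℤ) ≠ 0 := zpow_ne_zero _ ha
    field_simp
    ring
  have e4 : a ^ m = a ^ (m : ℤ) := (zpow_natCast a m).symm
  rw [e1, e3, e4, div_eq_mul_inv (a ^ (m : ℤ)), mul_comm (a ^ (m : ℤ)) ((q : RatFun P)⁻¹), one_div]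
  rw [add_mul, add_div]
  congr 1
  · ring
  · linear_combination (-algebraMap ℂ (RatFun P) (γ ((-((normSq B i : ℤ) * κ) : ℤ) : ZMod n)) *
      (1 - a ^ (m : ℤ)) * mon b q β * (1 - (q : RatFun P)⁻¹ * a ^ (m : ℤ))⁻¹) * e2

end Operator

/-! ### The twisted operators on monomials -/

section BaseVar

variable [Finite ι] [P.IsCrystallographic] (b : P.Base) (q : ℕ) (B : P.InvariantForm) (n : ℕ)

/-- The monomial `(qx)^{m(α_i) α_i}`, which lies in the field of degree zero. -/
def baseVar (i : b.support) : baseField B n :=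
  ⟨mon b q ((rootMult B n i : ℤ) • P.rootSpanMem ℤ (i : ι)),
    mon_mem_baseField b q (zsmul_root_mem_subLattice B n i)⟩

theorem coe_baseVar (i : b.support) : (baseVar b q B n i : RatFun P) =
    mon b q ((rootMult B n i : ℤ) • P.rootSpanMem ℤ (i : ι)) := rfl

variable [NeZero q]

theorem baseVar_ne_zero (i : b.support) : baseVar b q B n i ≠ 0 := by
  intro h
  exact mon_ne_zero b q _ (congrArg Subtype.val h)

theorem rootSpanMem_ne_zero (k : ι) : P.rootSpanMem ℤ k ≠ 0 := by
  intro h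
  exact P.ne_zero k (congrArg Subtype.val h)

theorem zpow_baseVar_eq_mon (i : b.support) (t : ℤ) :
    ((baseVar b q B n i ^ t : baseField B n) : RatFun P) =
      mon b q ((t * rootMult B n i : ℤ) • P.rootSpanMem ℤ (i : ι)) := by
  rw [mul_smul, mon_zsmul]
  rfl

omit [P.IsCrystallographic] in
theorem natCast_ne_zero : (q : RatFun P) ≠ 0 := by
  rw [← map_natCast (algebraMap ℂ (RatFun P)) q, Ne, map_eq_zero]
  exact NeZero.ne _

/-- A field endomorphism which fixes the constants and the monomials is the identity. -/
theorem apply_eq_self_of_mon (φ : RatFun P →+* RatFun P)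
    (hc : ∀ a : ℂ, φ (algebraMap ℂ _ a) = algebraMap ℂ _ a)
    (hm : ∀ β, φ (mon b q β) = mon b q β) (F : RatFun P) : φ F = F := by
  have key (f : Laurent P) : φ (algebraMap _ _ f) = algebraMap _ _ f := by
    rw [← AddMonoidAlgebra.sum_coeff_single f, Finsupp.sum, map_sum, map_sum]
    refine Finset.sum_congr rfl fun β _ => ?_
    have e : algebraMap (Laurent P) (RatFun P) (AddMonoidAlgebra.single β (f.coeff β)) =
        algebraMap ℂ _ (f.coeff β * ((q : ℂ) ^ height b β)⁻¹) * mon b q β := by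
      have hq : (q : ℂ) ^ height b β ≠ 0 := zpow_ne_zero _ (NeZero.ne _)
      rw [mon, IsScalarTower.algebraMap_apply ℂ (Laurent P) (RatFun P), ← map_mul,
        ← Algebra.smul_def, AddMonoidAlgebra.smul_single, smul_eq_mul, inv_mul_cancel_right₀ hq]
    rw [e, map_mul, hc, hm]
  obtain ⟨f, g, -, rfl⟩ := IsFractionRing.div_surjective (A := Laurent P) F
  rw [map_div₀, key, key]

theorem changeVar_changeVar (i : b.support) (F : RatFun P) :
    changeVar b q i (changeVar b q i F) = F := by
  refine apply_eq_self_of_mon b q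
    ((changeVar b q i : RatFun P →+* RatFun P).comp (changeVar b q i)) (fun a => ?_) (fun β => ?_) F
  · simp [changeVar_algebraMap]
  · simp [changeVar_mon, latticeReflection_latticeReflection]

/-- A monomial of nonzero degree is not a constant. -/
theorem mon_ne_algebraMap {β : Lattice P} (hβ : β ≠ 0) (a : ℂ) :
    mon b q β ≠ algebraMap ℂ (RatFun P) a := fun h => hβ (eq_zero_of_mon_eq b q h)

theorem mon_ne_one {β : Lattice P} (hβ : β ≠ 0) : mon b q β ≠ 1 := by
  simpa using mon_ne_algebraMap b q hβ 1

theorem inv_mul_mon_ne_one {β : Lattice P} (hβ : β ≠ 0) :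
    1 - (q : RatFun P)⁻¹ * mon b q β ≠ 0 := by
  intro h
  refine mon_ne_algebraMap b q hβ q ?_
  rw [map_natCast, ← mul_inv_cancel_left₀ (natCast_ne_zero q) (mon b q β), ← sub_eq_zero.mp h,
    mul_one]

variable [NeZero n]

theorem rootMult_smul_ne_zero (i : ι) : (rootMult B n i : ℤ) • P.rootSpanMem ℤ i ≠ 0 :=
  smul_ne_zero (by exact_mod_cast (rootMult_pos B n i).ne') (rootSpanMem_ne_zero i)

theorem changeVar_baseVar (i : b.support) :
    changeVar b q i (baseVar b q B n i) = (baseVar b q B n i : RatFun P)⁻¹ := by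
  rw [coe_baseVar, changeVar_mon, map_zsmul, latticeReflection_apply,
    P.coroot'In_rootSpanMem_eq_pairingIn, pairingIn_same, ← mon_neg]
  congr 1
  module

end BaseVar

section Steps

variable [Finite ι] [P.IsCrystallographic] {b : P.Base} {B : P.InvariantForm}
  {l : b.support → ℕ} {n q : ℕ} {γ : ZMod n → ℂ}

variable (B n q γ) in
/-- The scalar relating `x^β` and `x^{σ_i • β}`, where `κ = ⟨β - θ, α_i^∨⟩`. -/
def stepScalar (k : ι) (κ : ℤ) : ℂ :=
  -- At κ = 0 the dot reflection fixes β, so the two vectors of a ladder step are proportional; the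
  -- factor must then be the Hecke eigenvalue -v rather than γ(0) = -1.
  if κ = 0 then -(q : ℂ)⁻¹ else γ ((-((normSq B k : ℤ) * κ) : ℤ) : ZMod n)

variable [NeZero n] [NeZero q] (hγ0 : γ 0 = -1)
  (hγ : ∀ i : ZMod n, i ≠ 0 → γ i * γ (-i) = 1 / (q : ℂ))

include hγ0 hγ

theorem gauss_ne_zero (t : ZMod n) : γ t ≠ 0 := by
  rcases eq_or_ne t 0 with rfl | ht
  · rw [hγ0]; norm_num
  · intro h
    have h1 := hγ t ht
    rw [h, zero_mul] at h1
    exact one_div_ne_zero (NeZero.ne (q : ℂ)) h1.symm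

theorem stepScalar_ne_zero (k : ι) (κ : ℤ) : stepScalar B n q γ k κ ≠ 0 := by
  rw [stepScalar]
  split
  · exact neg_ne_zero.mpr (inv_ne_zero (NeZero.ne _))
  · exact gauss_ne_zero hγ0 hγ _

theorem gauss_of_dvd (k : ι) {κ : ℤ} (h : (rootMult B n k : ℤ) ∣ κ) :
    γ ((-((normSq B k : ℤ) * κ) : ℤ) : ZMod n) = -1 := by
  rw [← hγ0]
  congr 1
  rw [ZMod.intCast_zmod_eq_zero_iff_dvd, dvd_neg]
  exact (dvd_normSq_mul_iff B n k κ).mpr h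

theorem gauss_mul_gauss (k : ι) {κ : ℤ} (h : ¬ (rootMult B n k : ℤ) ∣ κ) :
    γ ((-((normSq B k : ℤ) * κ) : ℤ) : ZMod n) * γ ((-((normSq B k : ℤ) * -κ) : ℤ) : ZMod n) =
      (q : ℂ)⁻¹ := by
  have h1 : ((-((normSq B k : ℤ) * κ) : ℤ) : ZMod n) ≠ 0 := by
    rw [Ne, ZMod.intCast_zmod_eq_zero_iff_dvd, dvd_neg]
    exact fun h' => h ((dvd_normSq_mul_iff B n k κ).mp h')
  rw [← one_div, ← hγ _ h1]
  congr 2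
  push_cast
  ring

variable {i : b.support} {T : Module.End ℂ (RatFun P)}
  (hT : IsTwistedReflection b B l n q γ i T)

include hT

/-- For 0 < κ ≤ m the quotient ⌊-κ/m⌋ is -1, which yields the upward rule of the ladder. The case κ
= 0 is covered by the special value of the scalar. -/
theorem IsTwistedReflection.apply_mon_of_nonneg {β : Lattice P} (h0 : 0 ≤ kappa b l i β)
    (hm : kappa b l i β ≤ rootMult B n i) {v Y : RatFun P} (hv : (q : RatFun P)⁻¹ = v)
    (hY : (baseVar b q B n i : RatFun P) = Y) :
    T (mon b q β) = (1 - Y⁻¹) / (1 - v * Y) * ((1 - v) / (Y - 1) * mon b q β +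
      algebraMap ℂ _ (stepScalar B n q γ (i : ι) (kappa b l i β)) * mon b q
          (simpleDot b l i β)) := by
  have hmpos := rootMult_pos B n (i : ι)
  have hY0 : Y ≠ 0 := by rw [← hY]; exact mon_ne_zero b q _
  have hY1 : Y - 1 ≠ 0 := by
    rw [← hY, sub_ne_zero]; exact mon_ne_one b q (rootMult_smul_ne_zero B n (i : ι))
  have hvY : 1 - v * Y ≠ 0 := by
    rw [← hY, ← hv]; exact inv_mul_mon_ne_one b q (rootMult_smul_ne_zero B n (i : ι))
  rw [hT.apply_mon, ← coe_baseVar, hY, hv]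
  rcases h0.eq_or_lt with h0 | h0
  · have e : simpleDot b l i β = β := by
      rw [simpleDot_eq, affineReflection, ← h0, zero_smul, sub_zero]
    rw [e, ← h0, gauss_of_dvd hγ0 hγ (i : ι) (dvd_zero _), stepScalar, if_pos rfl, neg_zero,
      Int.zero_ediv, zpow_zero, map_neg, map_neg, map_one, map_inv₀, map_natCast, hv]
    field_simp
    ring
  · have e : -kappa b l i β / (rootMult B n i : ℤ) = -1 := by
      rw [Int.ediv_eq_iff_of_pos (by exact_mod_cast hmpos)]
      constructor <;> linarith
    rw [e, stepScalar, if_neg h0.ne', zpow_neg_one]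
    field_simp

theorem IsTwistedReflection.apply_mon_simpleDot {β : Lattice P} (h0 : 0 ≤ kappa b l i β)
    (hm : kappa b l i β ≤ rootMult B n i) {v Y : RatFun P} (hv : (q : RatFun P)⁻¹ = v)
    (hY : (baseVar b q B n i : RatFun P) = Y) :
    T (algebraMap ℂ _ (stepScalar B n q γ (i : ι) (kappa b l i β)) * mon b q (simpleDot b l i β)) =
      (1 - Y⁻¹) / (1 - v * Y) * (((1 - v) / (Y - 1) + (1 - v)) *
        (algebraMap ℂ _ (stepScalar B n q γ (i : ι) (kappa b l i β)) *
          mon b q (simpleDot b l i β)) + v * mon b q β) := by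
  have hmpos := rootMult_pos B n (i : ι)
  have hY0 : Y ≠ 0 := by rw [← hY]; exact mon_ne_zero b q _
  have hY1 : Y - 1 ≠ 0 := by
    rw [← hY, sub_ne_zero]; exact mon_ne_one b q (rootMult_smul_ne_zero B n (i : ι))
  have hvY : 1 - v * Y ≠ 0 := by
    rw [← hY, ← hv]; exact inv_mul_mon_ne_one b q (rootMult_smul_ne_zero B n (i : ι))
  have hss : simpleDot b l i (simpleDot b l i β) = β := by
    rw [simpleDot_eq]; exact (reflectionPair_dot b l i i).reflection_reflection₁ β
  rw [← Algebra.smul_def, map_smul, hT.apply_mon, ← coe_baseVar, hY, hv, hss, kappa_simpleDot,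
    neg_neg, Algebra.smul_def, Algebra.smul_def]
  rcases h0.eq_or_lt with h0 | h0
  · have e : simpleDot b l i β = β := by
      rw [simpleDot_eq, affineReflection, ← h0, zero_smul, sub_zero]
    rw [e, ← h0, gauss_of_dvd hγ0 hγ (i : ι) (by simp), stepScalar, if_pos rfl,
      Int.zero_ediv, zpow_zero, map_neg, map_neg, map_one, map_inv₀, map_natCast, hv]
    field_simp
    ring
  rw [stepScalar, if_neg h0.ne']
  -- At κ = m both values of γ are -1 and y^β = Y y^{σ • β}. Below m the quotient ⌊κ/m⌋ is 0 and the
  -- two values of γ multiply to v.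
  rcases hm.eq_or_lt with hm | hm
  · have e : mon b q β = Y * mon b q (simpleDot b l i β) := by
      rw [← hY, coe_baseVar, ← mon_add, simpleDot_eq, affineReflection, hm]
      congr 1
      module
    rw [gauss_of_dvd hγ0 hγ (i : ι) (by rw [hm]), gauss_of_dvd hγ0 hγ (i : ι) (by simp [hm]), hm,
      Int.ediv_self (by exact_mod_cast hmpos.ne'), zpow_one, e, map_neg, map_one]
    field_simp
    ring
  · have hd : ¬ (rootMult B n i : ℤ) ∣ kappa b l i β := fun h =>
      absurd (Int.le_of_dvd h0 h) (not_le.mpr hm)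
    have hG := congrArg (algebraMap ℂ (RatFun P)) (gauss_mul_gauss hγ0 hγ (i : ι) hd)
    rw [map_mul, map_inv₀, map_natCast, hv] at hG
    rw [Int.ediv_eq_zero_of_lt h0.le hm, zpow_zero]
    linear_combination (norm := (field_simp; ring))
      ((1 - Y⁻¹) / (1 - v * Y) * mon b q β) * hG

end Steps

/-! ### Representatives of minimal length of the classes modulo `Λ'` -/

section Energy

variable [P.IsRootSystem] [P.IsCrystallographic] (b : P.Base) (B : P.InvariantForm)
  (l : b.support → ℕ)

/-- The squared distance to `θ`. -/
def energy (β : Lattice P) : ℝ := B.form ((β : M) - theta b l) ((β : M) - theta b l)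

/-- This expands the square, using 2⟨β - θ, α_i⟩ = κ_i(β)‖α_i‖². -/
theorem energy_add_zsmul (i : b.support) (β : Lattice P) (t : ℤ) :
    energy b B l (β + t • P.rootSpanMem ℤ (i : ι)) =
      energy b B l β + ((t * kappa b l i β + t ^ 2 : ℤ) : ℝ) * B.form (P.root i) (P.root i) := by
  have h1 := form_root B ((β : M) - theta b l) (i : ι)
  have h2 : P.toLinearMap ((β : M) - theta b l) (P.coroot i) = (kappa b l i β : ℝ) := by
    rw [map_sub, LinearMap.sub_apply, theta_pairing, kappa]
    have h := P.algebraMap_coroot'In_apply ℤ (i : ι) β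
    have h3 : P.toLinearMap (β : M) (P.coroot i) = ((P.coroot'In ℤ (i : ι) β : ℤ) : ℝ) := by
      rw [← eq_intCast (algebraMap ℤ ℝ), h]; rfl
    rw [h3]
    push_cast
    ring
  rw [h2] at h1
  have e : ((β + t • P.rootSpanMem ℤ (i : ι) : Lattice P) : M) - theta b l =
      ((β : M) - theta b l) + (t : ℝ) • P.root i := by
    rw [Submodule.coe_add, Submodule.coe_smul, ← Int.cast_smul_eq_zsmul ℝ]
    change _ + (t : ℝ) • P.root i - _ = _
    abel
  have hs : B.form (P.root i) ((β : M) - theta b l) = B.form ((β : M) - theta b l) (P.root i) :=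
    B.symm.eq _ _
  rw [energy, e]
  simp only [map_add, map_smul, LinearMap.add_apply, LinearMap.smul_apply, smul_eq_mul, hs]
  rw [energy]
  push_cast
  linear_combination (t : ℝ) * h1

theorem simpleDot_eq_add (i : b.support) (β : Lattice P) :
    simpleDot b l i β = β + (-kappa b l i β) • P.rootSpanMem ℤ (i : ι) := by
  rw [simpleDot_eq, affineReflection]
  module

theorem energy_simpleDot (i : b.support) (β : Lattice P) :
    energy b B l (simpleDot b l i β) = energy b B l β := by
  rw [simpleDot_eq_add, energy_add_zsmul]
  push_cast
  ring

/-- `β` is as close as possible to `θ` in its class modulo `Λ'`. -/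
def IsMinimal (n : ℕ) (β : Lattice P) : Prop :=
  ∀ x ∈ subLattice P B n, energy b B l β ≤ energy b B l (β + x)

variable {b B l} {n : ℕ}

/-- The dot reflection is an isometry fixing θ, and its linear part preserves Λ'. -/
theorem IsMinimal.simpleDot {β : Lattice P} (hβ : IsMinimal b B l n β) (i : b.support) :
    IsMinimal b B l n (simpleDot b l i β) := by
  intro x hx
  have e : TwistedWeylAction.simpleDot b l i β + x =
      TwistedWeylAction.simpleDot b l i (β + latticeReflection (i : ι) x) := by
    rw [TwistedWeylAction.simpleDot, TwistedWeylAction.simpleDot, map_add,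
      latticeReflection_latticeReflection]
    abel
  rw [e, energy_simpleDot, energy_simpleDot]
  exact hβ _ (latticeReflection_mem_subLattice B n (i : ι) hx)

variable [Finite ι] [P.IsReduced] [P.IsIrreducible] (hB : IsNormalizedInnerProduct B)

include hB

theorem form_root_pos (k : ι) : 0 < B.form (P.root k) (P.root k) := hB.pos _ (P.ne_zero k)

/-- Moving by ±m(α_i)α_i cannot bring β closer to θ, so ±mκ + m² ≥ 0. -/
theorem IsMinimal.abs_kappa_le [NeZero n] {β : Lattice P} (hβ : IsMinimal b B l n β)
    (i : b.support) : |kappa b l i β| ≤ rootMult B n i := by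
  have hpos : (0 : ℤ) < rootMult B n i := by exact_mod_cast rootMult_pos B n (i : ι)
  have key (t : ℤ) (ht : t • P.rootSpanMem ℤ (i : ι) ∈ subLattice P B n) :
      0 ≤ t * kappa b l i β + t ^ 2 := by
    have h := hβ _ ht
    rw [energy_add_zsmul] at h
    have h' : (0 : ℝ) ≤ ((t * kappa b l i β + t ^ 2 : ℤ) : ℝ) :=
      nonneg_of_mul_nonneg_left (by linarith) (form_root_pos hB (i : ι))
    exact_mod_cast h'
  have h1 := key _ (zsmul_root_mem_subLattice B n (i : ι))
  have h2 := key (-(rootMult B n i : ℤ)) (by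
    rw [neg_smul]; exact neg_mem (zsmul_root_mem_subLattice B n (i : ι)))
  rw [abs_le]
  constructor <;> nlinarith

theorem exists_int_energy (x : Lattice P) : ∀ β : Lattice P,
    ∃ z : ℤ, energy b B l (β + x) - energy b B l β = z := by
  rw [← b.toWeightBasisInt.sum_repr x]
  refine Finset.sum_induction _
    (fun x => ∀ β : Lattice P, ∃ z : ℤ, energy b B l (β + x) - energy b B l β = z)
    (fun x y hx hy β => ?_) (fun β => ⟨0, by simp⟩) fun i _ β => ?_
  · obtain ⟨z, hz⟩ := hx β
    obtain ⟨w, hw⟩ := hy (β + x)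
    refine ⟨z + w, ?_⟩
    rw [← add_assoc]
    push_cast
    linarith
  · have e : b.toWeightBasisInt i = P.rootSpanMem ℤ (i : ι) := Subtype.ext (by simp)
    rw [e, energy_add_zsmul, ← normSq_cast B hB]
    generalize b.toWeightBasisInt.repr x i = t
    exact ⟨(t * kappa b l i β + t ^ 2) * normSq B i, by push_cast; ring⟩

/-- Within a class, energies differ by integers and are bounded below by 0, so a least one exists.
-/
theorem exists_isMinimal_add (n : ℕ) (β : Lattice P) :
    ∃ x ∈ subLattice P B n, IsMinimal b B l n (β + x) := by
  obtain ⟨z, ⟨x, hx, hz⟩, hmin⟩ := Int.exists_least_of_bdd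
    (P := fun z : ℤ => ∃ x ∈ subLattice P B n, energy b B l (β + x) - energy b B l β = z)
    ⟨⌊-energy b B l β⌋, fun z ⟨x, _, hz⟩ => by
      have h : 0 ≤ energy b B l (β + x) := by
        by_cases h : ((β + x : Lattice P) : M) - theta b l = 0
        · rw [energy, h]; simp
        · exact (hB.pos _ h).le
      have h2 : -energy b B l β ≤ z := by linarith
      exact_mod_cast (Int.floor_le _).trans h2⟩ ⟨0, 0, zero_mem _, by simp⟩
  refine ⟨x, hx, fun y hy => ?_⟩
  obtain ⟨w, hw⟩ := exists_int_energy hB (l := l) (x + y) β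
  have h := hmin w ⟨x + y, add_mem hx hy, hw⟩
  have h' : (z : ℝ) ≤ w := by exact_mod_cast h
  rw [add_assoc]
  linarith

/-- To check an equality of additive operators that are semilinear over the field of degree zero,
it suffices to consider monomials of minimal exponent. -/
theorem induction_minimal (q : ℕ) [NeZero q] [NeZero n] {p : RatFun P → Prop}
    (h0 : p 0) (hadd : ∀ F G, p F → p G → p (F + G))
    (hmul : ∀ (c : baseField B n) F, p F → p (c * F))
    (hmon : ∀ β, IsMinimal b B l n β → p (mon b q β)) (F : RatFun P) : p F := by
  refine induction_mon b q B n h0 hadd (fun c β => hmul c _ ?_) F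
  obtain ⟨x, hx, hβ⟩ := exists_isMinimal_add hB (b := b) (l := l) n β
  have e : mon b q β = ((⟨mon b q (-x), mon_mem_baseField b q (neg_mem hx)⟩ : baseField B n) :
      RatFun P) * mon b q (β + x) := by
    change _ = mon b q (-x) * _
    rw [← mon_add]
    congr 1
    abel
  rw [e]
  exact hmul _ _ (hmon _ hβ)

end Energy

/-! ### Involutivity of the twisted reflections. -/

section Involution

/-- This is T² = 1 on the two vectors of a ladder step. The outer coefficients contain Y⁻¹ because T
is semilinear and its substitution inverts Y. -/
theorem twist_identity {F : Type*} [Field F] {Y v : F} (hY0 : Y ≠ 0) (hY1 : Y - 1 ≠ 0)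
    (hvY : 1 - v * Y ≠ 0) (hvY2 : 1 - v * Y⁻¹ ≠ 0) (x y : F) :
    (1 - Y⁻¹⁻¹) / (1 - v * Y⁻¹) * ((1 - v) / (Y⁻¹ - 1) *
      ((1 - Y⁻¹) / (1 - v * Y) * ((1 - v) / (Y - 1) * x + y)) +
      (1 - Y⁻¹) / (1 - v * Y) * (((1 - v) / (Y - 1) + (1 - v)) * y + v * x)) = x ∧
    (1 - Y⁻¹⁻¹) / (1 - v * Y⁻¹) * (((1 - v) / (Y⁻¹ - 1) + (1 - v)) *
      ((1 - Y⁻¹) / (1 - v * Y) * (((1 - v) / (Y - 1) + (1 - v)) * y + v * x)) +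
      v * ((1 - Y⁻¹) / (1 - v * Y) * ((1 - v) / (Y - 1) * x + y))) = y := by
  have hv : Y - v ≠ 0 := by
    intro h
    apply hvY2
    rw [← sub_eq_zero.mp h, mul_inv_cancel₀ hY0, sub_self]
  have e1 : (1 - v) / (Y⁻¹ - 1) = -((1 - v) * Y / (Y - 1)) := by
    have : Y⁻¹ - 1 = -((Y - 1) / Y) := by field_simp; ring
    rw [this]
    field_simp
  have e2 : (1 - Y⁻¹⁻¹) / (1 - v * Y⁻¹) = -(Y * (Y - 1) / (Y - v)) := by
    have : 1 - v * Y⁻¹ = (Y - v) / Y := by field_simp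
    rw [this, inv_inv]
    field_simp
    ring
  have hvY' : 1 - Y * v ≠ 0 := by rwa [mul_comm]
  rw [e1, e2]
  constructor
  · field_simp
    ring
  · field_simp
    ring

variable [Finite ι] [P.IsRootSystem] [P.IsCrystallographic] [P.IsReduced] [P.IsIrreducible]
  {b : P.Base} {B : P.InvariantForm} {l : b.support → ℕ} {n q : ℕ} [NeZero n] [NeZero q]
  {γ : ZMod n → ℂ} {i : b.support} {T : Module.End ℂ (RatFun P)}

/-- The twisted simple reflections are involutions. -/
theorem IsTwistedReflection.apply_apply (hT : IsTwistedReflection b B l n q γ i T)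
    (hB : IsNormalizedInnerProduct B) (hγ0 : γ 0 = -1)
    (hγ : ∀ i : ZMod n, i ≠ 0 → γ i * γ (-i) = 1 / (q : ℂ)) (F : RatFun P) : T (T F) = F := by
  have key (β : Lattice P) (h0 : 0 ≤ kappa b l i β) (hm : kappa b l i β ≤ rootMult B n i) :
      T (T (mon b q β)) = mon b q β ∧
        T (T (mon b q (simpleDot b l i β))) = mon b q (simpleDot b l i β) := by
    obtain ⟨v, hv⟩ : ∃ v : baseField B n, v = (q : baseField B n)⁻¹ := ⟨_, rfl⟩
    obtain ⟨Y, hY⟩ : ∃ Y, baseVar b q B n i = Y := ⟨_, rfl⟩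
    have hv' : (q : RatFun P)⁻¹ = v := by rw [hv]; push_cast; rfl
    have hY' : (baseVar b q B n i : RatFun P) = Y := by rw [hY]
    have e1 := hT.apply_mon_of_nonneg hγ0 hγ h0 hm hv' hY'
    have e2 := hT.apply_mon_simpleDot hγ0 hγ h0 hm hv' hY'
    have hY0 : (Y : RatFun P) ≠ 0 := by rw [← hY]; exact mon_ne_zero b q _
    have hY1 : (Y : RatFun P) - 1 ≠ 0 := by
      rw [← hY, sub_ne_zero]; exact mon_ne_one b q (rootMult_smul_ne_zero B n (i : ι))
    have hvY : 1 - (v : RatFun P) * Y ≠ 0 := by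
      rw [← hY, ← hv']; exact inv_mul_mon_ne_one b q (rootMult_smul_ne_zero B n (i : ι))
    have sv : changeVar b q i (v : RatFun P) = v := by
      rw [← hv', map_inv₀, map_natCast]
    have sY : changeVar b q i (Y : RatFun P) = (Y : RatFun P)⁻¹ := by
      rw [← hY, changeVar_baseVar]
    have hvY2 : 1 - (v : RatFun P) * (Y : RatFun P)⁻¹ ≠ 0 := by
      intro h
      refine inv_mul_mon_ne_one b q (rootMult_smul_ne_zero B n (i : ι) |> neg_ne_zero.mpr) ?_
      rw [mon_neg, ← coe_baseVar, hY, hv']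
      exact h
    have hG := stepScalar_ne_zero (B := B) hγ0 hγ (i : ι) (kappa b l i β)
    have mulT (c : RatFun P) (hc : c ∈ baseField B n) (F : RatFun P) :
        T (c * F) = changeVar b q i c * T F := hT.mul_baseField ⟨c, hc⟩ F
    have hc1 : (1 - (Y : RatFun P)⁻¹) / (1 - v * Y) ∈ baseField B n :=
      ((1 - Y⁻¹) / (1 - v * Y) : baseField B n).2
    have hc2 : (1 - (v : RatFun P)) / (Y - 1) ∈ baseField B n :=
      ((1 - v) / (Y - 1) : baseField B n).2
    have hc3 : (1 - (v : RatFun P)) / (Y - 1) + (1 - v) ∈ baseField B n :=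
      ((1 - v) / (Y - 1) + (1 - v) : baseField B n).2
    set G := algebraMap ℂ (RatFun P) (stepScalar B n q γ (i : ι) (kappa b l i β)) with hGdef
    have hG0 : G ≠ 0 := by rw [hGdef, Ne, map_eq_zero]; exact hG
    constructor
    · rw [e1, mulT _ hc1, map_add, mulT _ hc2, e1, e2]
      simp only [map_div₀, map_sub, map_one, map_inv₀, map_mul, sv, sY]
      exact (twist_identity hY0 hY1 hvY hvY2 _ _).1
    · refine mul_left_cancel₀ hG0 ?_
      have hGT (F : RatFun P) : T (G * F) = G * T F := by
        rw [hGdef, ← Algebra.smul_def, map_smul, Algebra.smul_def]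
      rw [← hGT, ← hGT, e2, mulT _ hc1, map_add, mulT _ hc3, mulT _ v.2, e1, e2]
      simp only [map_div₀, map_sub, map_add, map_one, map_inv₀, map_mul, sv, sY]
      exact (twist_identity hY0 hY1 hvY hvY2 _ _).2
  refine induction_minimal hB (b := b) (l := l) (n := n) q (p := fun F => T (T F) = F) (by simp)
    (fun F G h1 h2 => by rw [map_add, map_add, h1, h2]) (fun c F h => ?_) (fun β hβ => ?_) F
  · rw [hT.mul_baseField, ← coe_baseHom, hT.mul_baseField, h, coe_baseHom, changeVar_changeVar]
  · have hm := abs_le.mp (hβ.abs_kappa_le hB i)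
    rcases le_total 0 (kappa b l i β) with h0 | h0
    · exact (key β h0 hm.2).1
    · have hss : simpleDot b l i (simpleDot b l i β) = β := by
        rw [simpleDot_eq]; exact (reflectionPair_dot b l i i).reflection_reflection₁ β
      -- For κ ≤ 0, β is the reflected partner of σ_i • β, whose κ is nonnegative.
      have := (key (simpleDot b l i β) (by rw [kappa_simpleDot]; linarith)
        (by rw [kappa_simpleDot]; linarith)).2
      rwa [hss] at this

end Involution

/-! ### Alternating orbits of a pair of reflections -/

namespace ReflectionPair

section Orbit

variable {A : Type*} [AddCommGroup A] {α₁ α₂ : A} {κ₁ κ₂ : A → ℤ} {p₁ p₂ : ℤ}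

variable (α₁ α₂ κ₁ κ₂) in
/-- The images of `β` under the two alternating words of length `k`, the first one beginning and
the second one ending (on the left) with the other reflection. -/
def orbit (β : A) : ℕ → A × A
  | 0 => (β, β)
  | k + 1 => (affineReflection α₁ κ₁ (orbit β k).2, affineReflection α₂ κ₂ (orbit β k).1)

variable (α₁ α₂ κ₁ κ₂) in
/-- The products of the scalars `G₁ (κ₁ γ)`, `G₂ (κ₂ γ)` along the two alternating orbits. -/
def orbitScalar {R : Type*} [CommRing R] (G₁ G₂ : ℤ → R) (β : A) : ℕ → R × R
  | 0 => (1, 1)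
  | k + 1 => ((orbitScalar G₁ G₂ β k).2 * G₁ (κ₁ (orbit α₁ α₂ κ₁ κ₂ β k).2),
      (orbitScalar G₁ G₂ β k).1 * G₂ (κ₂ (orbit α₁ α₂ κ₁ κ₂ β k).1))

/-- Below length r the alternating words are reduced, so the κ-values met are nonnegative
combinations of κ₁ β and κ₂ β. -/
theorem orbit_nonneg {r : ℕ} (hr : IsRankTwoType p₁ p₂ r)
    (h : ReflectionPair α₁ α₂ κ₁ κ₂ p₁ p₂) {β : A} (h₁ : 0 ≤ κ₁ β) (h₂ : 0 ≤ κ₂ β) {k : ℕ}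
    (hk : k < r) :
    0 ≤ κ₁ (orbit α₁ α₂ κ₁ κ₂ β k).2 ∧ 0 ≤ κ₂ (orbit α₁ α₂ κ₁ κ₂ β k).1 := by
  cases hr <;> interval_cases k <;>
    simp only [orbit, h.κ₁_reflection₁, h.κ₂_reflection₁, h.κ₁_reflection₂, h.κ₂_reflection₂] <;>
    constructor <;> linarith

theorem orbit_top {r : ℕ} (hr : IsRankTwoType p₁ p₂ r)
    (h : ReflectionPair α₁ α₂ κ₁ κ₂ p₁ p₂) (β : A) :
    (orbit α₁ α₂ κ₁ κ₂ β r).1 = (orbit α₁ α₂ κ₁ κ₂ β r).2 := by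
  cases hr with
  | A₁A₁ => exact h.braid_two β
  | A₂ => exact h.braid_three β
  | B₂ => exact h.braid_four rfl β
  | C₂ => exact h.braid_four rfl β
  | G₂ => exact h.braid_six rfl β
  | G₂' => exact h.braid_six rfl β

/-- Both paths meet the same κ-values, one for each positive root, in opposite orders. For even r
each value carries the same function on both paths; for r = 3 the functions are interchanged, hence
the condition G₁ = G₂. -/
theorem orbitScalar_top {R : Type*} [CommRing R] {G₁ G₂ : ℤ → R} {r : ℕ}
    (hr : IsRankTwoType p₁ p₂ r) (h : ReflectionPair α₁ α₂ κ₁ κ₂ p₁ p₂)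
    (hG : p₁ = p₂ → p₁ = 1 → G₁ = G₂) (β : A) :
    (orbitScalar α₁ α₂ κ₁ κ₂ G₁ G₂ β r).1 = (orbitScalar α₁ α₂ κ₁ κ₂ G₁ G₂ β r).2 := by
  cases hr with
  | A₂ =>
    rw [hG rfl rfl]
    simp only [orbitScalar, orbit, h.κ₁_reflection₁, h.κ₂_reflection₁, h.κ₁_reflection₂,
      h.κ₂_reflection₂]
    ring_nf
  | _ =>
    simp only [orbitScalar, orbit, h.κ₁_reflection₁, h.κ₂_reflection₁, h.κ₁_reflection₂,
      h.κ₂_reflection₂]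
    ring_nf

theorem orbit_induction {p : A → Prop}
    (h₁ : ∀ β, p β → p (affineReflection α₁ κ₁ β)) (h₂ : ∀ β, p β → p (affineReflection α₂ κ₂ β))
    {β : A} (hβ : p β) (k : ℕ) :
    p (orbit α₁ α₂ κ₁ κ₂ β k).1 ∧ p (orbit α₁ α₂ κ₁ κ₂ β k).2 := by
  induction k with
  | zero => exact ⟨hβ, hβ⟩
  | succ k ih => exact ⟨h₁ _ ih.2, h₂ _ ih.1⟩

/-- A property stable under both reflections that holds on dominant elements holds everywhere, if
`κ₁` and `κ₂` are bounded above. -/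
theorem dominant_induction {r : ℕ} (hr : IsRankTwoType p₁ p₂ r)
    (h : ReflectionPair α₁ α₂ κ₁ κ₂ p₁ p₂) {p s : A → Prop}
    (h₁ : ∀ β, p β → p (affineReflection α₁ κ₁ β)) (h₂ : ∀ β, p β → p (affineReflection α₂ κ₂ β))
    {C₁ C₂ : ℤ} (hC₁ : ∀ β, p β → κ₁ β ≤ C₁) (hC₂ : ∀ β, p β → κ₂ β ≤ C₂)
    (hs : ∀ β, p β → 0 ≤ κ₁ β → 0 ≤ κ₂ β → s β)
    (hs₁ : ∀ β, p β → s β → s (affineReflection α₁ κ₁ β))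
    (hs₂ : ∀ β, p β → s β → s (affineReflection α₂ κ₂ β)) {β : A} (hβ : p β) : s β := by
  -- With these weights, reflecting where κ_i < 0 changes the sum by (4 - p₁p₂)κ_i, which is
  -- negative since p₁p₂ ≤ 3. The bounds C₁, C₂ keep the sum nonnegative.
  induction hN : ((2 + p₁) * (C₁ - κ₁ β) + (2 + p₂) * (C₂ - κ₂ β)).toNat using
    Nat.strong_induction_on generalizing β with
  | _ N ih =>
    subst hN
    have b1 := hC₁ β hβ
    have b2 := hC₂ β hβ
    rcases lt_or_ge (κ₁ β) 0 with c1 | c1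
    · have hp := h₁ β hβ
      have b3 := hC₁ _ hp
      have b4 := hC₂ _ hp
      rw [h.κ₁_reflection₁] at b3
      rw [h.κ₂_reflection₁] at b4
      rw [← h.reflection_reflection₁ β]
      refine hs₁ _ hp (ih _ ?_ hp rfl)
      rw [h.κ₁_reflection₁, h.κ₂_reflection₁]
      cases hr <;> omega
    rcases lt_or_ge (κ₂ β) 0 with c2 | c2
    · have hp := h₂ β hβ
      have b3 := hC₁ _ hp
      have b4 := hC₂ _ hp
      rw [h.κ₁_reflection₂] at b3
      rw [h.κ₂_reflection₂] at b4
      rw [← h.reflection_reflection₂ β]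
      refine hs₂ _ hp (ih _ ?_ hp rfl)
      rw [h.κ₁_reflection₂, h.κ₂_reflection₂]
      cases hr <;> omega
    exact hs β hβ c1 c2

end Orbit

end ReflectionPair

/-- The product of the Cartan integers determines r. This admits the case where the roots m(α)α form
the dual system, with long and short exchanged. -/
theorem IsRankTwoType.of_mul_eq {p₁ p₂ a c : ℤ} {r : ℕ} (hr : IsRankTwoType p₁ p₂ r)
    (ha : 0 ≤ a) (hc : 0 ≤ c) (h : a * c = p₁ * p₂) (h0 : p₁ = 0 → a = 0 ∧ c = 0) :
    IsRankTwoType a c r := by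
  have one {x y : ℤ} (hx : 0 ≤ x) (hy : 0 ≤ y) {d : ℤ} (hd : 0 < d) (e : x * y = d) : x ≤ d :=
    Int.le_of_dvd hd ⟨y, e.symm⟩
  cases hr with
  | A₁A₁ => obtain ⟨rfl, rfl⟩ := h0 rfl; exact .A₁A₁
  | _ =>
    have h1 := one ha hc (by norm_num) h
    have h2 := one hc ha (by norm_num) ((mul_comm _ _).trans h)
    norm_num at h1 h2
    interval_cases a <;> interval_cases c <;> first | (exfalso; revert h; decide) | constructor

section Ladder

variable {L V : Type*} [Field L] [AddCommGroup V] [Module L V] {σ₁ σ₂ : L →+* L}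
  {T₁ T₂ : V →+ V} {v Y₁ Y₂ : L}

/-- The ladder identity for operators that are semilinear with respect to two substitutions acting
on monomials `Y₁`, `Y₂` like the simple reflections of a root system of rank two. -/
theorem iterate_eq_self_of_ladder {a c : ℤ} {r : ℕ} (hr : IsRankTwoType a c r)
    (semilinear₁ : ∀ c x, T₁ (c • x) = σ₁ c • T₁ x)
    (semilinear₂ : ∀ c x, T₂ (c • x) = σ₂ c • T₂ x)
    (involutive₁ : ∀ x, T₁ (T₁ x) = x) (involutive₂ : ∀ x, T₂ (T₂ x) = x)
    (map_v₁ : σ₁ v = v) (map_v₂ : σ₂ v = v)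
    (h₁₁ : σ₁ Y₁ = Y₁⁻¹) (h₁₂ : σ₁ Y₂ = Y₂ * Y₁ ^ a) (h₂₁ : σ₂ Y₁ = Y₁ * Y₂ ^ c)
    (h₂₂ : σ₂ Y₂ = Y₂⁻¹) (hY₁ : Y₁ ≠ 0) (hY₂ : Y₂ ≠ 0)
    (ne_one : ∀ e f : ℕ, 0 < e + f → Y₁ ^ e * Y₂ ^ f ≠ 1)
    (mul_ne_one : ∀ e f : ℕ, 0 < e + f → 1 - v * (Y₁ ^ e * Y₂ ^ f) ≠ 0) {A B : ℕ → V}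
    (zero_eq : B 0 = A 0) (top_eq : B r = A r)
    (up₁ : ∀ k < r, T₁ (B k) =
      ((1 - Y₁⁻¹) / (1 - v * Y₁)) • (A (k + 1) + ((1 - v) / (Y₁ - 1)) • B k))
    (up₂ : ∀ k < r, T₂ (A k) =
      ((1 - Y₂⁻¹) / (1 - v * Y₂)) • (B (k + 1) + ((1 - v) / (Y₂ - 1)) • A k))
    (down₁ : ∀ k < r, T₁ (A (k + 1)) = ((1 - Y₁⁻¹) / (1 - v * Y₁)) •
      (((1 - v) / (Y₁ - 1) + (1 - v)) • A (k + 1) + v • B k))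
    (down₂ : ∀ k < r, T₂ (B (k + 1)) = ((1 - Y₂⁻¹) / (1 - v * Y₂)) •
      (((1 - v) / (Y₂ - 1) + (1 - v)) • B (k + 1) + v • A k)) :
    (T₁ ∘ T₂)^[r] (A 0) = A 0 := by
  -- `e j` and `f j` are the coefficients of the j-th positive root in the two simple roots; the
  -- tables below list them for each type.
  have ladder (e f : ℕ → ℕ) (hpos : ∀ j, 0 < e j + f j) (h1 : e 1 = 1 ∧ f 1 = 0)
      (h2 : e r = 0 ∧ f r = 1)
      (hσ₁ : ∀ j, 2 ≤ j → j ≤ r → e (r + 2 - j) = -e j + a * f j ∧ f (r + 2 - j) = f j)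
      (hσ₂ : ∀ j, 1 ≤ j → j < r → (f (r - j) : ℤ) = -f j + c * e j ∧ e (r - j) = e j) :
      TwistedLadder r σ₁ σ₂ T₁ T₂ v (fun j => Y₁ ^ e j * Y₂ ^ f j) A B := by
    have z1 : Y₁ ^ e 1 * Y₂ ^ f 1 = Y₁ := by rw [h1.1, h1.2, pow_one, pow_zero, mul_one]
    have z2 : Y₁ ^ e r * Y₂ ^ f r = Y₂ := by rw [h2.1, h2.2, pow_one, pow_zero, one_mul]
    refine ⟨semilinear₁, semilinear₂, involutive₁, involutive₂, map_v₁, map_v₂, fun j hj hj' => ?_,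
      fun j hj hj' => ?_,
      fun j _ _ => ne_one _ _ (hpos j), fun j _ _ => mul_ne_one _ _ (hpos j), zero_eq, top_eq,
      fun k hk => ?_, fun k hk => ?_, fun k hk => ?_, fun k hk => ?_⟩
    · obtain ⟨w1, w2⟩ := hσ₁ j hj hj'
      rw [map_mul, map_pow, map_pow, h₁₁, h₁₂, ← zpow_natCast Y₁ (e (r + 2 - j)), w1, w2,
        zpow_add₀ hY₁, zpow_neg, zpow_natCast, zpow_mul, zpow_natCast, mul_pow, inv_pow]
      ring
    · obtain ⟨w1, w2⟩ := hσ₂ j hj hj'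
      rw [map_mul, map_pow, map_pow, h₂₁, h₂₂, ← zpow_natCast Y₂ (f (r - j)), w1, w2,
        zpow_add₀ hY₂, zpow_neg, zpow_natCast, zpow_mul, zpow_natCast, mul_pow, inv_pow]
      ring
    · simpa only [z1] using up₁ k hk
    · simpa only [z2] using up₂ k hk
    · simpa only [z1] using down₁ k hk
    · simpa only [z2] using down₂ k hk
  cases hr with
  | A₁A₁ =>
    refine (ladder (fun | 1 => 1 | _ => 0) (fun | 1 => 0 | _ => 1) ?_ ?_ ?_ ?_ ?_).iterate_two
    case refine_1 => intro j; split <;> simp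
    case refine_2 => simp
    case refine_3 => simp
    all_goals intro j hj hj'; interval_cases j <;> norm_num
  | A₂ =>
    refine (ladder (fun | 1 => 1 | 2 => 1 | _ => 0) (fun | 1 => 0 | 2 => 1 | _ => 1)
      ?_ ?_ ?_ ?_ ?_).iterate_three ?_
    case refine_1 => intro j; split <;> simp
    case refine_2 => simp
    case refine_3 => simp
    case refine_6 => simp only [pow_zero, pow_one, one_mul, mul_one]
    all_goals intro j hj hj'; interval_cases j <;> norm_num
  | C₂ =>
    refine (ladder (fun | 1 => 1 | 2 => 2 | 3 => 1 | _ => 0)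
      (fun | 1 => 0 | 2 => 1 | 3 => 1 | _ => 1)
      ?_ ?_ ?_ ?_ ?_).iterate_four ?_ ?_
    case refine_1 => intro j; split <;> simp
    case refine_2 => simp
    case refine_3 => simp
    case refine_6 => simp only [pow_zero, pow_one, mul_one]; ring
    case refine_7 => simp only [pow_zero, pow_one, one_mul, mul_one]
    all_goals intro j hj hj'; interval_cases j <;> norm_num
  | B₂ =>
    refine (ladder (fun | 1 => 1 | 2 => 1 | 3 => 1 | _ => 0)
      (fun | 1 => 0 | 2 => 1 | 3 => 2 | _ => 1)
      ?_ ?_ ?_ ?_ ?_).iterate_four_dual ?_ ?_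
    case refine_1 => intro j; split <;> simp
    case refine_2 => simp
    case refine_3 => simp
    case refine_6 => simp only [pow_zero, pow_one, one_mul]; ring
    case refine_7 => simp only [pow_zero, pow_one, one_mul, mul_one]; ring
    all_goals intro j hj hj'; interval_cases j <;> norm_num
  | G₂' =>
    refine (ladder (fun | 1 => 1 | 2 => 3 | 3 => 2 | 4 => 3 | 5 => 1 | _ => 0)
      (fun | 1 => 0 | 2 => 1 | 3 => 1 | 4 => 2 | 5 => 1 | _ => 1)
      ?_ ?_ ?_ ?_ ?_).iterate_six ?_ ?_ ?_ ?_ ?_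
    case refine_1 => intro j; split <;> simp
    case refine_2 => simp
    case refine_3 => simp
    case refine_4 => intro j hj hj'; interval_cases j <;> norm_num
    case refine_5 => intro j hj hj'; interval_cases j <;> norm_num
    all_goals simp only [pow_zero, pow_one, one_mul, mul_one] <;> ring
  | G₂ =>
    refine (ladder (fun | 1 => 1 | 2 => 1 | 3 => 2 | 4 => 1 | 5 => 1 | _ => 0)
      (fun | 1 => 0 | 2 => 1 | 3 => 3 | 4 => 2 | 5 => 3 | _ => 1)
      ?_ ?_ ?_ ?_ ?_).iterate_six_dual ?_ ?_ ?_ ?_ ?_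
    case refine_1 => intro j; split <;> simp
    case refine_2 => simp
    case refine_3 => simp
    case refine_4 => intro j hj hj'; interval_cases j <;> norm_num
    case refine_5 => intro j hj hj'; interval_cases j <;> norm_num
    all_goals simp only [pow_zero, pow_one, one_mul, mul_one] <;> ring

end Ladder

/-! ### The braid relations -/

section Braid

variable [Finite ι] [P.IsRootSystem] [P.IsCrystallographic] [P.IsReduced] [P.IsIrreducible]
  {b : P.Base} {B : P.InvariantForm} {l : b.support → ℕ} {n q : ℕ} [NeZero n] [NeZero q]
  {γ : ZMod n → ℂ} {i j : b.support}

theorem changeVar_baseVar_of_eq {a : ℤ} (i j : b.support)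
    (h : -P.pairingIn ℤ j i * rootMult B n j = a * rootMult B n i) :
    changeVar b q i (baseVar b q B n j) =
      (baseVar b q B n j : RatFun P) * (baseVar b q B n i : RatFun P) ^ a := by
  rw [coe_baseVar, coe_baseVar, changeVar_mon, ← mon_zsmul, ← mon_add, smul_smul, ← h, map_zsmul,
    latticeReflection_apply, P.coroot'In_rootSpanMem_eq_pairingIn]
  congr 1
  module

/-- The exponents of the substitutions on the variables of the field of degree zero. -/
theorem exists_isRankTwoType_rootMult (hB : IsNormalizedInnerProduct B) {r : ℕ}
    (hr : IsRankTwoType (-P.pairingIn ℤ i j) (-P.pairingIn ℤ j i) r) :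
    ∃ a c : ℤ, IsRankTwoType a c r ∧ -P.pairingIn ℤ j i * rootMult B n j = a * rootMult B n i ∧
      -P.pairingIn ℤ i j * rootMult B n i = c * rootMult B n j := by
  have hd (i j : b.support) : (rootMult B n i : ℤ) ∣ -P.pairingIn ℤ j i * rootMult B n j := by
    have h := rootMult_dvd_coroot'In hB (i : ι) (zsmul_root_mem_subLattice B n (j : ι))
    rw [map_smul, P.coroot'In_rootSpanMem_eq_pairingIn, smul_eq_mul] at h
    rw [neg_mul, dvd_neg, mul_comm]
    exact h
  obtain ⟨a, ha⟩ := hd i j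
  obtain ⟨c, hc⟩ := hd j i
  have m1 : (0 : ℤ) < rootMult B n i := by exact_mod_cast rootMult_pos B n (i : ι)
  have m2 : (0 : ℤ) < rootMult B n j := by exact_mod_cast rootMult_pos B n (j : ι)
  have hp : 0 ≤ -P.pairingIn ℤ i j ∧ 0 ≤ -P.pairingIn ℤ j i := by
    generalize -P.pairingIn ℤ i j = p₁ at hr
    generalize -P.pairingIn ℤ j i = p₂ at hr
    cases hr <;> norm_num
  have hz : -P.pairingIn ℤ i j = 0 → -P.pairingIn ℤ j i = 0 := by
    generalize -P.pairingIn ℤ i j = p₁ at hr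
    generalize -P.pairingIn ℤ j i = p₂ at hr
    cases hr <;> norm_num
  refine ⟨a, c, hr.of_mul_eq ?_ ?_ ?_ ?_, by rw [ha, mul_comm], by rw [hc, mul_comm]⟩
  · exact nonneg_of_mul_nonneg_right (ha ▸ mul_nonneg hp.2 m2.le) m1
  · exact nonneg_of_mul_nonneg_right (hc ▸ mul_nonneg hp.1 m1.le) m2
  · refine mul_left_cancel₀ (mul_pos m1 m2).ne' ?_
    linear_combination -(c * (rootMult B n j : ℤ)) * ha - (rootMult B n j : ℤ) *
      -P.pairingIn ℤ j i * hc
  · intro h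
    rw [hz h, zero_mul] at ha
    rw [h, zero_mul] at hc
    exact ⟨(mul_eq_zero.mp ha.symm).resolve_left m1.ne',
      (mul_eq_zero.mp hc.symm).resolve_left m2.ne'⟩

theorem stepScalar_congr {k k' : ι} (h : normSq B k = normSq B k') :
    stepScalar B n q γ k = stepScalar B n q γ k' := by
  ext κ
  rw [stepScalar, stepScalar, h]

theorem smul_simple_add_ne_zero (hij : i ≠ j) {s t : ℤ} (h : s ≠ 0 ∨ t ≠ 0) :
    s • P.rootSpanMem ℤ (i : ι) + t • P.rootSpanMem ℤ (j : ι) ≠ 0 := by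
  intro h0
  have e (k : b.support) : P.rootSpanMem ℤ (k : ι) = b.toWeightBasisInt k := Subtype.ext (by simp)
  rw [e, e] at h0
  have h1 := congrArg (fun x => b.toWeightBasisInt.repr x i) h0
  have h2 := congrArg (fun x => b.toWeightBasisInt.repr x j) h0
  simp [hij, hij.symm] at h1 h2
  tauto

variable {T₁ T₂ : Module.End ℂ (RatFun P)} (hT₁ : IsTwistedReflection b B l n q γ i T₁)
  (hT₂ : IsTwistedReflection b B l n q γ j T₂) (hB : IsNormalizedInnerProduct B) (hγ0 : γ 0 = -1)
  (hγ : ∀ i : ZMod n, i ≠ 0 → γ i * γ (-i) = 1 / (q : ℂ)) (hij : i ≠ j)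

include hT₁ hT₂ hB hγ0 hγ hij

/-- Along both alternating orbits the exponents stay minimal and, before the top, κ of the next
reflection stays nonnegative. Every step thus lies in the range of the Hecke formulas, and the
rescaled monomials form a ladder over Ã₀. -/
theorem iterate_mon_of_dominant {β : Lattice P} (hβ : IsMinimal b B l n β)
    (h₁ : 0 ≤ kappa b l i β) (h₂ : 0 ≤ kappa b l j β) :
    (T₁ ∘ T₂)^[relExponent b B i j] (mon b q β) = mon b q β := by
  have hr := isRankTwoType b B hij
  have hpair := reflectionPair_dot b l i j
  have min₁ (β : Lattice P) (h : IsMinimal b B l n β) : IsMinimal b B l n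
      (affineReflection (P.rootSpanMem ℤ (i : ι)) (kappa b l i) β) := by
    rw [← simpleDot_eq]; exact h.simpleDot i
  have min₂ (β : Lattice P) (h : IsMinimal b B l n β) : IsMinimal b B l n
      (affineReflection (P.rootSpanMem ℤ (j : ι)) (kappa b l j) β) := by
    rw [← simpleDot_eq]; exact h.simpleDot j
  have hmin := ReflectionPair.orbit_induction min₁ min₂ hβ
  have hnn (k : ℕ) (hk : k < relExponent b B i j) := hpair.orbit_nonneg hr h₁ h₂ hk
  have htop := hpair.orbit_top hr β
  have hscalar := hpair.orbitScalar_top (G₁ := stepScalar B n q γ (i : ι))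
    (G₂ := stepScalar B n q γ (j : ι)) hr (fun e e' => stepScalar_congr (by
      have := pairingIn_mul_normSq hB (i : ι) (j : ι)
      have e1 : P.pairingIn ℤ i j = -1 := by linarith
      have e2 : P.pairingIn ℤ j i = -1 := by linarith
      rw [e1, e2] at this
      have e3 : (normSq B (i : ι) : ℤ) = normSq B (j : ι) := by linarith
      exact_mod_cast e3)) β
  obtain ⟨a, c, hac, ha, hc⟩ := exists_isRankTwoType_rootMult (n := n) hB hr
  set orb := ReflectionPair.orbit (P.rootSpanMem ℤ (i : ι)) (P.rootSpanMem ℤ (j : ι))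
    (kappa b l i) (kappa b l j) β with horb
  set sc := ReflectionPair.orbitScalar (P.rootSpanMem ℤ (i : ι)) (P.rootSpanMem ℤ (j : ι))
    (kappa b l i) (kappa b l j) (stepScalar B n q γ (i : ι)) (stepScalar B n q γ (j : ι)) β
    with hsc
  obtain ⟨v, hv⟩ : ∃ v : baseField B n, v = (q : baseField B n)⁻¹ := ⟨_, rfl⟩
  have hv' : (q : RatFun P)⁻¹ = v := by rw [hv]; push_cast; rfl
  have sv (k : b.support) : baseHom b q B n k v = v := by
    rw [hv, map_inv₀, map_natCast]
  have const (T : Module.End ℂ (RatFun P)) (z : ℂ) (x : RatFun P) :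
      T (algebraMap ℂ _ z * x) = algebraMap ℂ _ z * T x := by
    rw [← Algebra.smul_def, map_smul, Algebra.smul_def]
  have up {T : Module.End ℂ (RatFun P)} {k : b.support}
      (hT : IsTwistedReflection b B l n q γ k T) {δ : Lattice P} (hδ : IsMinimal b B l n δ)
      (h0 : 0 ≤ kappa b l k δ) (z : ℂ) :
      T (algebraMap ℂ _ z * mon b q δ) =
        ((1 - (baseVar b q B n k)⁻¹) / (1 - v * baseVar b q B n k)) •
          (algebraMap ℂ _ (z * stepScalar B n q γ (k : ι) (kappa b l k δ)) *
              mon b q (affineReflection (P.rootSpanMem ℤ (k : ι)) (kappa b l k) δ) +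
            ((1 - v) / (baseVar b q B n k - 1)) • (algebraMap ℂ _ z * mon b q δ)) := by
    have h := hT.apply_mon_of_nonneg hγ0 hγ h0 (abs_le.mp (hδ.abs_kappa_le hB k)).2 hv' rfl
    rw [const T, h, ← simpleDot_eq, map_mul]
    simp only [Subfield.smul_def, smul_eq_mul]
    push_cast
    ring
  have down {T : Module.End ℂ (RatFun P)} {k : b.support}
      (hT : IsTwistedReflection b B l n q γ k T) {δ : Lattice P} (hδ : IsMinimal b B l n δ)
      (h0 : 0 ≤ kappa b l k δ) (z : ℂ) :
      T (algebraMap ℂ _ (z * stepScalar B n q γ (k : ι) (kappa b l k δ)) *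
          mon b q (affineReflection (P.rootSpanMem ℤ (k : ι)) (kappa b l k) δ)) =
        ((1 - (baseVar b q B n k)⁻¹) / (1 - v * baseVar b q B n k)) •
          (((1 - v) / (baseVar b q B n k - 1) + (1 - v)) •
            (algebraMap ℂ _ (z * stepScalar B n q γ (k : ι) (kappa b l k δ)) *
              mon b q (affineReflection (P.rootSpanMem ℤ (k : ι)) (kappa b l k) δ)) +
            v • (algebraMap ℂ _ z * mon b q δ)) := by
    have h := hT.apply_mon_simpleDot hγ0 hγ h0 (abs_le.mp (hδ.abs_kappa_le hB k)).2 hv' rfl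
    rw [map_mul (algebraMap ℂ (RatFun P)), mul_assoc, ← simpleDot_eq, const T, h]
    simp only [Subfield.smul_def, smul_eq_mul]
    push_cast
    ring
  have semilin {T : Module.End ℂ (RatFun P)} {k : b.support}
      (hT : IsTwistedReflection b B l n q γ k T) (c : baseField B n) (x : RatFun P) :
      T (c • x) = baseHom b q B n k c • T x := by
    rw [Subfield.smul_def, Subfield.smul_def]
    exact hT.mul_baseField c x
  have monomial (e f : ℕ) : ((baseVar b q B n i ^ e * baseVar b q B n j ^ f : baseField B n) :
      RatFun P) = mon b q (((e * rootMult B n i : ℤ)) • P.rootSpanMem ℤ (i : ι) +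
        ((f * rootMult B n j : ℤ)) • P.rootSpanMem ℤ (j : ι)) := by
    rw [mon_add, ← zpow_baseVar_eq_mon, ← zpow_baseVar_eq_mon, zpow_natCast, zpow_natCast]
    rfl
  have exponent (e f : ℕ) (hef : 0 < e + f) : ((e * rootMult B n i : ℤ)) • P.rootSpanMem ℤ (i : ι) +
      ((f * rootMult B n j : ℤ)) • P.rootSpanMem ℤ (j : ι) ≠ 0 := by
    refine smul_simple_add_ne_zero hij ?_
    have m1 := (rootMult_pos B n (i : ι)).ne'
    have m2 := (rootMult_pos B n (j : ι)).ne'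
    rcases Nat.eq_zero_or_pos e with rfl | he
    · exact Or.inr (mul_ne_zero (by omega) (by exact_mod_cast m2))
    · exact Or.inl (mul_ne_zero (by omega) (by exact_mod_cast m1))
  have key := iterate_eq_self_of_ladder (V := RatFun P) (T₁ := (T₁ : RatFun P →+ RatFun P))
    (T₂ := (T₂ : RatFun P →+ RatFun P)) (σ₁ := baseHom b q B n i) (σ₂ := baseHom b q B n j)
    (v := v) (Y₁ := baseVar b q B n i) (Y₂ := baseVar b q B n j)
    (A := fun k => algebraMap ℂ _ (sc k).1 * mon b q (orb k).1)
    (B := fun k => algebraMap ℂ _ (sc k).2 * mon b q (orb k).2) hac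
    (semilin hT₁) (semilin hT₂) (hT₁.apply_apply hB hγ0 hγ) (hT₂.apply_apply hB hγ0 hγ)
    (sv i) (sv j) (Subtype.ext (changeVar_baseVar b q B n i))
    (Subtype.ext (by
      rw [coe_baseHom, changeVar_baseVar_of_eq i j ha, Subfield.coe_mul]
      rfl))
    (Subtype.ext (by
      rw [coe_baseHom, changeVar_baseVar_of_eq j i hc, Subfield.coe_mul]
      rfl))
    (Subtype.ext (changeVar_baseVar b q B n j)) (baseVar_ne_zero b q B n i)
    (baseVar_ne_zero b q B n j)
    (fun e f hef h => mon_ne_one b q (exponent e f hef)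
      ((monomial e f).symm.trans (congrArg Subtype.val h)))
    (fun e f hef h => inv_mul_mon_ne_one b q (exponent e f hef) (by
      rw [hv', ← monomial]
      exact congrArg Subtype.val h))
    rfl (by rw [htop, hscalar])
    (fun k hk => up hT₁ (hmin k).2 (hnn k hk).1 _) (fun k hk => up hT₂ (hmin k).1 (hnn k hk).2 _)
    (fun k hk => down hT₁ (hmin k).2 (hnn k hk).1 _)
    (fun k hk => down hT₂ (hmin k).1 (hnn k hk).2 _)
  have e0 : algebraMap ℂ (RatFun P) (sc 0).1 * mon b q (orb 0).1 = mon b q β := by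
    change algebraMap ℂ (RatFun P) 1 * mon b q β = mon b q β
    rw [map_one, one_mul]
  simp only [e0] at key
  exact key

end Braid

/-! ### From dominant monomials to the defining relations. -/

section Relations

variable [Finite ι] [P.IsRootSystem] [P.IsCrystallographic] [P.IsReduced] [P.IsIrreducible]
  {b : P.Base} {B : P.InvariantForm} {l : b.support → ℕ} {n q : ℕ} [NeZero n] [NeZero q]
  {γ : ZMod n → ℂ} {i j : b.support}

theorem relExponent_dvd (hij : i ≠ j) {k : ℕ}
    (hk : (weylGroup.ofIdx P (i : ι) * weylGroup.ofIdx P (j : ι)) ^ k = 1) :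
    relExponent b B i j ∣ k :=
  (reflectionPair_lattice (i : ι) (j : ι)).dvd_of_iterate_eq_self (isRankTwoType b B hij)
    (β := P.rootSpanMem ℤ (i : ι)) (by simp [P.coroot'In_rootSpanMem_eq_pairingIn])
    (by rw [P.coroot'In_rootSpanMem_eq_pairingIn, neg_neg]) ((mul_pow_eq_one_iff _ _ _).mp hk _)

theorem baseHom_comp_pow {r : ℕ}
    (hr : IsRankTwoType (-P.pairingIn ℤ i j) (-P.pairingIn ℤ j i) r) (c : baseField B n) :
    ((baseHom b q B n i).comp (baseHom b q B n j) ^ r) c = c := by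
  set φ : RatFun P →+* RatFun P :=
    (changeVar b q i : RatFun P →+* RatFun P).comp (changeVar b q j : RatFun P →+* RatFun P)
    with hφ
  have h1 (k : ℕ) : ((((baseHom b q B n i).comp (baseHom b q B n j) ^ k) c : baseField B n) :
      RatFun P) = (φ ^ k) c := by
    induction k with
    | zero => rfl
    | succ k ih =>
      rw [pow_succ', pow_succ']
      change _ = φ ((φ ^ k) c)
      rw [← ih]
      rfl
  apply Subtype.ext
  rw [h1]
  refine apply_eq_self_of_mon b q (φ ^ r) (fun a => ?_) (fun β => ?_) _
  · rw [RingHom.coe_pow]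
    refine Function.iterate_fixed ?_ r
    change changeVar b q i (changeVar b q j _) = _
    rw [changeVar_algebraMap, changeVar_algebraMap]
  · have h2 : Function.Semiconj (mon b q)
        (latticeReflection (i : ι) ∘ latticeReflection (j : ι)) φ := fun β => by
      change _ = changeVar b q i (changeVar b q j _)
      rw [changeVar_mon, changeVar_mon]
      rfl
    rw [RingHom.coe_pow, ← h2.iterate_right r β]
    congr 1
    exact (reflectionPair_lattice (i : ι) (j : ι)).iterate_eq_self hr β

/-- The coefficient of y^{σ • β} in T y^β is nonzero, since γ has no zeros and Y ≠ 1, so the formula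
can be solved for it. This carries invariance from β to σ • β. -/
theorem IsTwistedReflection.exists_mon_simpleDot {T : Module.End ℂ (RatFun P)}
    (hT : IsTwistedReflection b B l n q γ i T) (hγ0 : γ 0 = -1)
    (hγ : ∀ i : ZMod n, i ≠ 0 → γ i * γ (-i) = 1 / (q : ℂ)) (β : Lattice P) :
    ∃ c d : baseField B n, mon b q (simpleDot b l i β) = c * T (mon b q β) + d * mon b q β := by
  have h := hT.apply_mon β
  obtain ⟨v, hv⟩ : ∃ v : baseField B n, v = (q : baseField B n)⁻¹ := ⟨_, rfl⟩
  obtain ⟨Y, hY⟩ : ∃ Y, baseVar b q B n i = Y := ⟨_, rfl⟩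
  have hv' : (q : RatFun P)⁻¹ = v := by rw [hv]; push_cast; rfl
  have hg0 := gauss_ne_zero hγ0 hγ ((-((normSq B (i : ι) : ℤ) * kappa b l i β) : ℤ) : ZMod n)
  set z := γ ((-((normSq B (i : ι) : ℤ) * kappa b l i β) : ℤ) : ZMod n)
  obtain ⟨g, hg⟩ : ∃ g : baseField B n, (g : RatFun P) = algebraMap ℂ (RatFun P) z :=
    ⟨⟨_, algebraMap_complex_mem_baseField B n z⟩, rfl⟩
  rw [← coe_baseVar, hY, hv', ← hg] at h
  have hY0 : (Y : RatFun P) ≠ 0 := by rw [← hY]; exact mon_ne_zero b q _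
  have hY1 : (Y : RatFun P) - 1 ≠ 0 := by
    rw [← hY, sub_ne_zero]; exact mon_ne_one b q (rootMult_smul_ne_zero B n (i : ι))
  have hvY : 1 - (v : RatFun P) * Y ≠ 0 := by
    rw [← hY, ← hv']; exact inv_mul_mon_ne_one b q (rootMult_smul_ne_zero B n (i : ι))
  have hg1 : (g : RatFun P) ≠ 0 := by rw [hg, Ne, map_eq_zero]; exact hg0
  have hY2 : 1 - (Y : RatFun P)⁻¹ ≠ 0 := by
    have : 1 - (Y : RatFun P)⁻¹ = (Y - 1) / Y := by field_simp
    rw [this]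
    exact div_ne_zero hY1 hY0
  refine ⟨(1 - v * Y) / (g * (1 - Y⁻¹)),
    -((1 - v) * Y ^ (-kappa b l i β / (rootMult B n i : ℤ))) / (g * (1 - Y⁻¹)), ?_⟩
  have e : ((Y ^ (-kappa b l i β / (rootMult B n i : ℤ)) : baseField B n) : RatFun P) =
      (Y : RatFun P) ^ (-kappa b l i β / (rootMult B n i : ℤ)) := rfl
  push_cast
  rw [e, h, div_mul_div_comm, div_mul_eq_mul_div, mul_comm (1 - (v : RatFun P) * Y),
    mul_div_mul_right _ _ hvY, ← add_div, eq_div_iff (mul_ne_zero hg1 hY2)]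
  ring

variable {T₁ T₂ : Module.End ℂ (RatFun P)} (hT₁ : IsTwistedReflection b B l n q γ i T₁)
  (hT₂ : IsTwistedReflection b B l n q γ j T₂) (hB : IsNormalizedInnerProduct B) (hγ0 : γ 0 = -1)
  (hγ : ∀ i : ZMod n, i ≠ 0 → γ i * γ (-i) = 1 / (q : ℂ))

include hB hγ0 hγ

theorem IsTwistedReflection.mul_self {T : Module.End ℂ (RatFun P)}
    (hT : IsTwistedReflection b B l n q γ i T) : T * T = 1 :=
  LinearMap.ext fun F => hT.apply_apply hB hγ0 hγ F

include hT₁ hT₂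

/-- On Ã₀ the substitution (σ_iσ_j)^r is trivial, so (T₁T₂)^r is Ã₀-linear. Its inverse is (T₂T₁)^r,
so its fixed vectors are stable under T₁ and T₂. Dominant minimal monomials are fixed, and the
reflections reach all minimal ones from them. -/
theorem mul_pow_relExponent_of_ne (hij : i ≠ j) : (T₁ * T₂) ^ relExponent b B i j = 1 := by
  set r := relExponent b B i j with hrdef
  have hr : IsRankTwoType (-P.pairingIn ℤ i j) (-P.pairingIn ℤ j i) r := isRankTwoType b B hij
  have h₁ := hT₁.mul_self hB hγ0 hγ
  have h₂ := hT₂.mul_self hB hγ0 hγ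
  have semilin (c : baseField B n) (F : RatFun P) (k : ℕ) : ((T₁ * T₂) ^ k) (c * F) =
      ((((baseHom b q B n i).comp (baseHom b q B n j) ^ k) c : baseField B n) : RatFun P) *
        ((T₁ * T₂) ^ k) F := by
    induction k with
    | zero => rfl
    | succ k ih =>
      rw [pow_succ', Module.End.mul_apply, ih, Module.End.mul_apply, hT₂.mul_baseField,
        ← coe_baseHom, hT₁.mul_baseField, ← coe_baseHom, pow_succ']
      rfl
  have hmul (c : baseField B n) (F : RatFun P) :
      ((T₁ * T₂) ^ r) (c * F) = c * ((T₁ * T₂) ^ r) F := by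
    rw [semilin, baseHom_comp_pow hr]
  have hinv : (T₂ * T₁) ^ r * (T₁ * T₂) ^ r = 1 := by
    refine pow_mul_pow_eq_one r ?_
    rw [mul_assoc, ← mul_assoc T₁, h₁, one_mul, h₂]
  have hfix {F : RatFun P} (hF : ((T₁ * T₂) ^ r) F = F) : ((T₂ * T₁) ^ r) F = F := by
    conv_lhs => rw [← hF]
    exact LinearMap.congr_fun hinv F
  have fix₁ {F : RatFun P} (hF : ((T₁ * T₂) ^ r) F = F) : ((T₁ * T₂) ^ r) (T₁ F) = T₁ F := by
    rw [← Module.End.mul_apply, mul_pow_mul, Module.End.mul_apply, hfix hF]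
  have fix₂ {F : RatFun P} (hF : ((T₁ * T₂) ^ r) F = F) : ((T₁ * T₂) ^ r) (T₂ F) = T₂ F := by
    have e : (T₁ * T₂) ^ r * T₂ = T₂ * (T₂ * T₁) ^ r := by
      have := mul_pow_mul T₂ T₁ r
      calc (T₁ * T₂) ^ r * T₂ = T₂ * T₂ * (T₁ * T₂) ^ r * T₂ := by rw [h₂, one_mul]
        _ = T₂ * (T₂ * T₁) ^ r * (T₂ * T₂) := by
            rw [mul_assoc T₂ T₂, ← this]; simp only [mul_assoc]
        _ = _ := by rw [h₂, mul_one]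
    rw [← Module.End.mul_apply, e, Module.End.mul_apply, hfix hF]
  have step {k : b.support} {T : Module.End ℂ (RatFun P)}
      (hT : IsTwistedReflection b B l n q γ k T)
      (hfixT : ∀ F, ((T₁ * T₂) ^ r) F = F → ((T₁ * T₂) ^ r) (T F) = T F) (β : Lattice P)
      (hβ : ((T₁ * T₂) ^ r) (mon b q β) = mon b q β) :
      ((T₁ * T₂) ^ r) (mon b q (affineReflection (P.rootSpanMem ℤ (k : ι)) (kappa b l k) β)) =
        mon b q (affineReflection (P.rootSpanMem ℤ (k : ι)) (kappa b l k) β) := by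
    obtain ⟨c, d, h⟩ := hT.exists_mon_simpleDot hγ0 hγ β
    rw [← simpleDot_eq, h, map_add, hmul, hmul, hβ, hfixT _ hβ]
  have hdom (β : Lattice P) (hβ : IsMinimal b B l n β) (k₁ : 0 ≤ kappa b l i β)
      (k₂ : 0 ≤ kappa b l j β) : ((T₁ * T₂) ^ r) (mon b q β) = mon b q β := by
    rw [Module.End.pow_apply]
    exact iterate_mon_of_dominant hT₁ hT₂ hB hγ0 hγ hij hβ k₁ k₂
  refine LinearMap.ext fun F => ?_
  refine induction_minimal hB (b := b) (l := l) (n := n) q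
    (p := fun F => ((T₁ * T₂) ^ r) F = F) (map_zero _)
    (fun F G h1 h2 => by rw [map_add, h1, h2]) (fun c F h => by rw [hmul, h]) (fun β hβ => ?_) F
  refine (reflectionPair_dot b l i j).dominant_induction hr (p := IsMinimal b B l n)
    (s := fun β => ((T₁ * T₂) ^ r) (mon b q β) = mon b q β)
    (fun β h => by rw [← simpleDot_eq]; exact h.simpleDot i)
    (fun β h => by rw [← simpleDot_eq]; exact h.simpleDot j)
    (fun β h => (abs_le.mp (h.abs_kappa_le hB i)).2)
    (fun β h => (abs_le.mp (h.abs_kappa_le hB j)).2) hdom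
    (fun β _ h => step hT₁ (fun _ => fix₁) β h) (fun β _ h => step hT₂ (fun _ => fix₂) β h) hβ

theorem mul_pow_relExponent : (T₂ * T₁) ^ relExponent b B i j = 1 := by
  have h₁ := hT₁.mul_self hB hγ0 hγ
  by_cases hij : i = j
  · subst hij
    rw [hT₂.unique b l n q γ hT₁, relExponent, if_pos rfl, pow_one, h₁]
  · have h₂ := hT₂.mul_self hB hγ0 hγ
    have hinv : (T₂ * T₁) ^ relExponent b B i j * (T₁ * T₂) ^ relExponent b B i j = 1 := by
      refine pow_mul_pow_eq_one _ ?_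
      rw [mul_assoc, ← mul_assoc T₁, h₁, one_mul, h₂]
    rwa [mul_pow_relExponent_of_ne hT₁ hT₂ hB hγ0 hγ hij, mul_one] at hinv

end Relations

end TwistedWeylAction

end

/-! ### Assembly: the grading, the operators, their relations and the right action. -/

theorem theorem3p2 {ι M N : Type*} [Finite ι] [AddCommGroup M] [Module ℝ M] [AddCommGroup N]
    [Module ℝ N] (P : RootPairing ι ℝ M N) [P.IsRootSystem] [P.IsCrystallographic] [P.IsReduced]
    [P.IsIrreducible] (b : P.Base) (B : P.InvariantForm)
    (hB : TwistedWeylAction.IsNormalizedInnerProduct B)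
    (l : b.support → ℕ) (n q : ℕ) [NeZero n] [NeZero q] (γ : ZMod n → ℂ) (hγ0 : γ 0 = -1)
    (hγ : ∀ i : ZMod n, i ≠ 0 → γ i * γ (-i) = 1 / (q : ℂ)) :
    DirectSum.IsInternal (TwistedWeylAction.piece B n) ∧
    (∃! T : b.support → Module.End ℂ (TwistedWeylAction.RatFun P),
      ∀ i, TwistedWeylAction.IsTwistedReflection b B l n q γ i (T i)) ∧
    ∀ T : b.support → Module.End ℂ (TwistedWeylAction.RatFun P),
      (∀ i, TwistedWeylAction.IsTwistedReflection b B l n q γ i (T i)) →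
      (∀ i j, (T j * T i) ^ TwistedWeylAction.relExponent b B i j = 1) ∧
      ∃! ρ : P.weylGroup →* (Module.End ℂ (TwistedWeylAction.RatFun P))ᵐᵒᵖ,
        ∀ i : b.support, ρ (RootPairing.weylGroup.ofIdx P (i : ι)) = MulOpposite.op (T i) := by
  open TwistedWeylAction in
  refine ⟨isInternal_piece b B n, ?_, fun T hT => ⟨fun i j =>
    mul_pow_relExponent (hT i) (hT j) hB hγ0 hγ, ?_⟩⟩
  · choose T hT using fun i => exists_isTwistedReflection b l n q γ hB i
    exact ⟨T, hT, fun T' hT' => funext fun i => (hT' i).unique b l n q γ (hT i)⟩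
  · have hs (i : b.support) := ofIdx_mul_self (P := P) (i : ι)
    have ht (i : b.support) : MulOpposite.op (T i) * MulOpposite.op (T i) = 1 := by
      rw [← MulOpposite.op_mul, (hT i).mul_self hB hγ0 hγ, MulOpposite.op_one]
    refine existsUnique_monoidHom (s := fun i : b.support => RootPairing.weylGroup.ofIdx P (i : ι))
      (t := fun i => MulOpposite.op (T i)) hs ht (closure_ofIdx_simple b B)
      (wordProd_eq_one_of_deletionProperty hs ht (ofIdx_simple_injective b) (deletionProperty b B)
        fun i j p hp => ?_)
    by_cases hij : i = j
    · subst hij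
      rw [ht, one_pow]
    -- The order of σ_iσ_j in W is a multiple of r(i,j), so any dihedral relation is a power of the
    -- defining one. Passing to the opposite monoid reverses T_i and T_j, as a right action
    -- requires.
    · obtain ⟨k, rfl⟩ := relExponent_dvd (B := B) hij hp
      rw [← MulOpposite.op_mul, ← MulOpposite.op_pow, pow_mul,
        mul_pow_relExponent (hT i) (hT j) hB hγ0 hγ, one_pow, MulOpposite.op_one]
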